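/- Let $a_1,a_2,a_4,a_5\in\mathbb R$ and consider the planar vector field $$x'=-y+x^2+\epsilon a_1x-a_2xy,\qquad y'=\epsilon(x-\lambda)+\epsilon a_5y+\epsilon a_4x^2 .$$ Its Kahan map is $z\mapsto z+h\,(\mathrm{Id}-\tfrac h2 Df(z))^{-1}f(z)$, $z=(x,y)$, where $f$ is the right-hand side. Let $\Phi$ be this map, extended by $\tilde\epsilon=\epsilon$, $\tilde\lambda=\lambda$, $\tilde h=h$ and written in the blow-up chart $K_1$, $$x=r_1x_1,\quad y=r_1^2,\quad \epsilon=r_1^2\epsilon_1,\quad \lambda=r_1\lambda_1,\quad h=h_1/r_1,$$ in which it extends to $r_1=0$. For $\rho,\delta,\kappa,\nu>0$ put $$D_1=\{(x_1,r_1,\epsilon_1,\lambda_1,h_1):0\le r_1\le\rho,\ 0\le\epsilon_1\le\delta,\ |\lambda_1|\le\kappa,\ 0\le h_1\le\nu\}.$$ For every $h_1$ the map $\Phi$ has two curves of fixed points on $\{\epsilon_1=\lambda_1=0\}$, $$S_{\mathrm a,1}(h_1)=\{(x_{\mathrm a}(r_1),r_1,0,0,h_1)\},\quad S_{\mathrm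 r,1}(h_1)=\{(x_{\mathrm r}(r_1),r_1,0,0,h_1)\},\qquad 0\le r_1\le\rho,$$ where $x_{\mathrm a}(r_1)<0<x_{\mathrm r}(r_1)$ are the roots of $x^2-a_2r_1x-1=0$; at $r_1=0$ they end in $p_{\mathrm a,1}(h_1)=(-1,0,0,0,h_1)$ and $p_{\mathrm r,1}(h_1)=(1,0,0,0,h_1)$. A center-stable manifold $\hat M_{\mathrm a,1}$ (respectively center-unstable manifold $\hat M_{\mathrm r,1}$) in $D_1$ is the graph $x_1=\hat g(r_1,\epsilon_1,\lambda_1,h_1)$ of a $C^1$ function $\hat g$ over the whole parameter box of $D_1$ such that $\Phi$ is defined on the graph, the graph is locally invariant (if $z$ is in the graph and $\Phi(z)\in D_1$, then $\Phi(z)$ is in the graph), the graph contains $S_{\mathrm a,1}(h_1)$ (respectively $S_{\mathrm r,1}(h_1)$) for all $0\le h_1\le\nu$, and at these fixed points, for $h_1>0$, one has $|\partial\tilde x_1/\partial x_1|<1$ (respectively $>1$). For $h>0$ and $n\in\mathbb Z$ let $$\gamma_h(n)=\Bigl(\frac{hn}{2},\ \frac{h^2n^2}{4}-\frac12-\frac{h^2}{8}\Bigr)=:(x(n),y(n))$$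 be the special orbit of the Kahan map in the rescaling chart $K_2$ ($x=r_2x_2$, $y=r_2^2y_2$, $\epsilon=r_2^2$, $\lambda=r_2\lambda_2$, $h=h_2/r_2$) for $r_2=\lambda_2=0$ and $h_2=h$. Where $y(n)>0$, its image in $K_1$ is $$\gamma_h^1(n)=\kappa_{21}(\gamma_h(n),h)=\bigl(y(n)^{-1/2}x(n),\,0,\,y(n)^{-1},\,0,\,h\,y(n)^{1/2}\bigr).$$ **Statement.** There are $\rho,\delta,\kappa,\nu>0$ with $\nu<1$, a center-stable manifold $\hat M_{\mathrm a,1}$ and a center-unstable manifold $\hat M_{\mathrm r,1}$ in $D_1$, all independent of $h$ and $n$, such that: 1. for all $h>0$ and all $n$ with $y(n)>0$ for which $|n|$ is so large that $\gamma^1_h(n)$ has entered $D_1$, that is, $y(n)^{-1}\le\delta$ and $h\,y(n)^{1/2}\le\nu$, one has $\gamma^1_h(n)\in\hat M_{\mathrm a,1}$ if $n<0$ and $\gamma^1_h(n)\in\hat M_{\mathrm r,1}$ if $n>0$; 2. for every $h_1^*\in[0,\nu]$ and all neighbourhoods $U_{\mathrm a}$ of $p_{\mathrm a,1}(h_1^*)$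 and $U_{\mathrm r}$ of $p_{\mathrm r,1}(h_1^*)$, for all sufficiently small $h>0$ there are $n<0$ with $\gamma_h^1(n)\in D_1\cap U_{\mathrm a}$ and $n>0$ with $\gamma_h^1(n)\in D_1\cap U_{\mathrm r}$. In this sense $\gamma_h$ connects $\hat M_{\mathrm a,1}$ and $\hat M_{\mathrm r,1}$. -/

import Mathlib

open Set Topology

namespace KahanCanard

/-- The coefficients `a₁, a₂, a₄, a₅` of the planar quadratic model
`x' = -y + x² + ε a₁ x - a₂ x y`, `y' = ε (x - lam) + ε a₅ y + ε a₄ x²`. -/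
structure Coeffs where
  a₁ : ℝ
  a₂ : ℝ
  a₄ : ℝ
  a₅ : ℝ

/-- First component of the vector field
`(-y + x² + r (ε a₁ x - a₂ x y), ε (x - lam) + r ε (a₅ y + a₄ x²))`.
For `r = 1` it is the model in the original variables, and for `ε = 1` it is the
model in the rescaling chart `K₂` (with `r = r₂`, `lam = lam₂`). -/
def field₁ (a : Coeffs) (r ε x y : ℝ) : ℝ :=
  -y + x ^ 2 + r * (ε * a.a₁ * x - a.a₂ * x * y)

/-- Second component of the vector field. -/
def field₂ (a : Coeffs) (r ε lam x y : ℝ) : ℝ :=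
  ε * (x - lam) + r * ε * (a.a₅ * y + a.a₄ * x ^ 2)

/-- Entries of the Jacobian matrix of the vector field with respect to `(x, y)`. -/
def jac₁₁ (a : Coeffs) (r ε x y : ℝ) : ℝ := 2 * x + r * (ε * a.a₁ - a.a₂ * y)

/-- Entry `∂ field₁ / ∂ y`. -/
def jac₁₂ (a : Coeffs) (r x : ℝ) : ℝ := -1 - r * a.a₂ * x

/-- Entry `∂ field₂ / ∂ x`. -/
def jac₂₁ (a : Coeffs) (r ε x : ℝ) : ℝ := ε + 2 * r * ε * a.a₄ * x

/-- Entry `∂ field₂ / ∂ y`. -/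
def jac₂₂ (a : Coeffs) (r ε : ℝ) : ℝ := r * ε * a.a₅

/-- The determinant of `Id - (h/2) Df(x, y)`. -/
noncomputable def kahanDet (a : Coeffs) (r ε h x y : ℝ) : ℝ :=
  (1 - h / 2 * jac₁₁ a r ε x y) * (1 - h / 2 * jac₂₂ a r ε)
    - (h / 2) ^ 2 * jac₁₂ a r x * jac₂₁ a r ε x

/-- First component of the Kahan map `z ↦ z + h (Id - (h/2) Df(z))⁻¹ f(z)`. -/
noncomputable def kahanX (a : Coeffs) (r ε lam h x y : ℝ) : ℝ :=
  x + h * ((1 - h / 2 * jac₂₂ a r ε) * field₁ a r ε x y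
    + h / 2 * jac₁₂ a r x * field₂ a r ε lam x y) / kahanDet a r ε h x y

/-- Second component of the Kahan map `z ↦ z + h (Id - (h/2) Df(z))⁻¹ f(z)`. -/
noncomputable def kahanY (a : Coeffs) (r ε lam h x y : ℝ) : ℝ :=
  y + h * (h / 2 * jac₂₁ a r ε x * field₁ a r ε x y
    + (1 - h / 2 * jac₁₁ a r ε x y) * field₂ a r ε lam x y) / kahanDet a r ε h x y

/-- The Kahan map really solves the Kahan scheme
`(z' - z) / h = Q(z, z') + B (z + z') / 2 + c`. -/
theorem kahan_scheme (a : Coeffs) (r ε lam h x y : ℝ) (hd : kahanDet a r ε h x y ≠ 0) :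
    let X := kahanX a r ε lam h x y
    let Y := kahanY a r ε lam h x y
    X - x = h * (-(y + Y) / 2 + x * X
        + r * (ε * a.a₁ * ((x + X) / 2) - a.a₂ * ((x * Y + X * y) / 2))) ∧
    Y - y = h * (ε * ((x + X) / 2 - lam)
        + r * ε * (a.a₅ * ((y + Y) / 2) + a.a₄ * (x * X))) := by
  intro X Y
  simp only [X, Y, kahanX, kahanY]
  constructor
  · field_simp
    simp only [kahanDet, jac₁₁, jac₁₂, jac₂₁, jac₂₂, field₁, field₂]
    ring
  · field_simp
    simp only [kahanDet, jac₁₁, jac₁₂, jac₂₁, jac₂₂, field₁, field₂]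
    ring

/-- Coordinates `(x₁, (r₁, ε₁, lam₁, h₁))` of the chart `K₁`. -/
abbrev K1 : Type := ℝ × (ℝ × ℝ × ℝ × ℝ)

/-- For a point of `K₁`, the determinant that has to be non-zero for the map to be defined. -/
noncomputable def detK1 (a : Coeffs) (z : K1) : ℝ :=
  kahanDet a z.2.1 z.2.2.1 z.2.2.2.2 z.1 1

/-- The function `G` of the chart `K₁`, i.e. the quotient of the new and the old value of `y`. -/
noncomputable def G (a : Coeffs) (z : K1) : ℝ :=
  kahanY a z.2.1 z.2.2.1 z.2.2.2.1 z.2.2.2.2 z.1 1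

/-- The Kahan map in the chart `K₁`, where
`x = r₁ x₁, y = r₁², ε = r₁² ε₁, lam = r₁ lam₁, h = h₁ / r₁`. After division by the powers of
`r₁`, one step is the Kahan step of the scaled vector field with step size `h₁` at `(x₁, 1)`;
this also makes sense for `r₁ = 0`. -/
noncomputable def mapK1 (a : Coeffs) (z : K1) : K1 :=
  (kahanX a z.2.1 z.2.2.1 z.2.2.2.1 z.2.2.2.2 z.1 1 / √(G a z),
    (z.2.1 * √(G a z), z.2.2.1 / G a z, z.2.2.2.1 / √(G a z), z.2.2.2.2 * √(G a z)))

/-- The chart `K₁` of the blow-up, with values `(x, y, ε, lam, h)`. -/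
noncomputable def blowUpK1 (z : K1) : ℝ × ℝ × ℝ × ℝ × ℝ :=
  (z.2.1 * z.1, z.2.1 ^ 2, z.2.1 ^ 2 * z.2.2.1, z.2.1 * z.2.2.2.1, z.2.2.2.2 / z.2.1)

/-- The Kahan map of the model in the original variables `(x, y, ε, lam, h)`. -/
noncomputable def kahanMap (a : Coeffs) (w : ℝ × ℝ × ℝ × ℝ × ℝ) : ℝ × ℝ × ℝ × ℝ × ℝ :=
  (kahanX a 1 w.2.2.1 w.2.2.2.1 w.2.2.2.2 w.1 w.2.1,
    kahanY a 1 w.2.2.1 w.2.2.2.1 w.2.2.2.2 w.1 w.2.1, w.2.2.1, w.2.2.2.1, w.2.2.2.2)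

/-- `mapK1` is the Kahan map written in the chart `K₁`. -/
theorem blowUpK1_mapK1 (a : Coeffs) (z : K1) (hr : 0 < z.2.1) (hd : detK1 a z ≠ 0)
    (hG : 0 < G a z) : blowUpK1 (mapK1 a z) = kahanMap a (blowUpK1 z) := by
  obtain ⟨x, r, ε, lam, h⟩ := z
  have hs : 0 < √(G a (x, r, ε, lam, h)) := Real.sqrt_pos.2 hG
  have hs2 : √(G a (x, r, ε, lam, h)) ^ 2 = G a (x, r, ε, lam, h) := Real.sq_sqrt hG.le
  have hr' : r ≠ 0 := ne_of_gt hr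
  have hdet : kahanDet a 1 (r ^ 2 * ε) (h / r) (r * x) (r ^ 2) = kahanDet a r ε h x 1 := by
    simp only [kahanDet, jac₁₁, jac₁₂, jac₂₁, jac₂₂]
    field_simp
  simp only [detK1] at hd
  simp only [blowUpK1, mapK1, kahanMap, Prod.mk.injEq]
  refine ⟨?_, ?_, ?_, ?_, ?_⟩
  · have e : kahanX a 1 (r ^ 2 * ε) (r * lam) (h / r) (r * x) (r ^ 2)
        = r * kahanX a r ε lam h x 1 := by
      simp only [kahanX, hdet]
      field_simp
      simp only [jac₁₂, jac₂₂, field₁, field₂]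
      field_simp
    rw [e]
    field_simp
  · have e : kahanY a 1 (r ^ 2 * ε) (r * lam) (h / r) (r * x) (r ^ 2)
        = r ^ 2 * kahanY a r ε lam h x 1 := by
      simp only [kahanY, hdet]
      field_simp
      simp only [jac₂₁, jac₁₁, field₁, field₂]
      field_simp
    rw [e, mul_pow, hs2]
    rfl
  · rw [mul_pow, hs2]
    field_simp
  · field_simp
  · field_simp

/-- The parameter box `0 ≤ r₁ ≤ ρ, 0 ≤ ε₁ ≤ δ, |lam₁| ≤ κ, 0 ≤ h₁ ≤ ν`. -/
def box (ρ δ κ ν : ℝ) : Set (ℝ × ℝ × ℝ × ℝ) :=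
  Icc 0 ρ ×ˢ Icc 0 δ ×ˢ Icc (-κ) κ ×ˢ Icc 0 ν

/-- The domain `D₁` of the chart `K₁`. -/
def D1 (ρ δ κ ν : ℝ) : Set K1 := {z | z.2 ∈ box ρ δ κ ν}

/-- The `x₁`-coordinate, as a function of `r₁`, of the curve of fixed points on
`{ε₁ = 0, lam₁ = 0}` through `x₁ = s` at `r₁ = 0`, for `s = -1` (attracting) and `s = 1`
(repelling): the root of `x² - a₂ r₁ x - 1` with the sign of `s`. -/
noncomputable def fixX (a : Coeffs) (s r : ℝ) : ℝ :=
  (a.a₂ * r + s * √((a.a₂ * r) ^ 2 + 4)) / 2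

/-- The curve of fixed points `S_{a,1}(h₁)` (for `s = -1`) or `S_{r,1}(h₁)` (for `s = 1`). -/
def fixCurve (a : Coeffs) (ρ s h₁ : ℝ) : Set K1 :=
  {z | ∃ r ∈ Icc 0 ρ, z = (fixX a s r, (r, 0, 0, h₁))}

/-- The points of `fixCurve` are fixed points of the map. -/
theorem mapK1_fixX (a : Coeffs) (s r h₁ : ℝ) (hs : s ^ 2 = 1) :
    mapK1 a (fixX a s r, (r, 0, 0, h₁)) = (fixX a s r, (r, 0, 0, h₁)) := by
  have h4 : √((a.a₂ * r) ^ 2 + 4) ^ 2 = (a.a₂ * r) ^ 2 + 4 := Real.sq_sqrt (by positivity)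
  have hf : field₁ a r 0 (fixX a s r) 1 = 0 := by
    simp only [field₁, fixX]
    linear_combination (s ^ 2 / 4) * h4 + (((a.a₂ * r) ^ 2 + 4) / 4) * hs
  simp [mapK1, G, kahanX, kahanY, hf, field₂]

/-- `M` is an invariant manifold of the map in `D₁` over the centre variables
`(r₁, ε₁, lam₁, h₁)`: a `C¹` graph `x₁ = g (r₁, ε₁, lam₁, h₁)` over the whole box, on which the
map is defined, which is locally invariant and contains the curves of fixed points
`S(h₁)`, `0 ≤ h₁ ≤ ν`, belonging to the sign `s`. -/
structure IsCenterGraph (a : Coeffs) (ρ δ κ ν s : ℝ) (M : Set K1) : Prop where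
  graph : ∃ g : ℝ × ℝ × ℝ × ℝ → ℝ, ContDiffOn ℝ 1 g (box ρ δ κ ν) ∧
    M = {z | z.2 ∈ box ρ δ κ ν ∧ z.1 = g z.2}
  defined : ∀ z ∈ M, 0 < detK1 a z ∧ 0 < G a z
  invariant : ∀ z ∈ M, mapK1 a z ∈ D1 ρ δ κ ν → mapK1 a z ∈ M
  fixed : ∀ h₁ ∈ Icc 0 ν, fixCurve a ρ s h₁ ⊆ M

/-- `M` is a center-stable manifold `M̂_{a,1}`: an invariant graph through the fixed points
near `x₁ = -1`, whose normal direction `x₁` is contracting at these points for `h₁ > 0`. -/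
structure IsCenterStable (a : Coeffs) (ρ δ κ ν : ℝ) (M : Set K1) : Prop
    extends IsCenterGraph a ρ δ κ ν (-1) M where
  contracting : ∀ r ∈ Icc 0 ρ, ∀ h₁ ∈ Ioc 0 ν, ∃ m : ℝ, |m| < 1 ∧
    HasDerivAt (fun x => (mapK1 a (x, (r, 0, 0, h₁))).1) m (fixX a (-1) r)

/-- `M` is a center-unstable manifold `M̂_{r,1}`: an invariant graph through the fixed points
near `x₁ = 1`, whose normal direction `x₁` is expanding at these points for `h₁ > 0`. -/
structure IsCenterUnstable (a : Coeffs) (ρ δ κ ν : ℝ) (M : Set K1) : Prop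
    extends IsCenterGraph a ρ δ κ ν 1 M where
  expanding : ∀ r ∈ Icc 0 ρ, ∀ h₁ ∈ Ioc 0 ν, ∃ m : ℝ, 1 < |m| ∧
    HasDerivAt (fun x => (mapK1 a (x, (r, 0, 0, h₁))).1) m (fixX a 1 r)

/-- The special orbit `γ_h(n) = (h n / 2, h² n² / 4 - 1/2 - h² / 8)` in the chart `K₂`. -/
noncomputable def gam (h : ℝ) (n : ℤ) : ℝ × ℝ :=
  (h * n / 2, h ^ 2 * n ^ 2 / 4 - 1 / 2 - h ^ 2 / 8)

/-- `γ_h` is an orbit of the Kahan map of chart `K₂` for `r₂ = lam₂ = 0` (and `ε = 1`). -/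
theorem kahan_gam (a : Coeffs) (h : ℝ) (n : ℤ)
    (hd : kahanDet a 0 1 h (gam h n).1 (gam h n).2 ≠ 0) :
    kahanX a 0 1 0 h (gam h n).1 (gam h n).2 = (gam h (n + 1)).1 ∧
      kahanY a 0 1 0 h (gam h n).1 (gam h n).2 = (gam h (n + 1)).2 := by
  simp only [kahanX, kahanY]
  constructor
  · field_simp
    simp only [kahanDet, jac₁₁, jac₁₂, jac₂₁, jac₂₂, field₁, field₂, gam]
    push_cast
    ring
  · field_simp
    simp only [kahanDet, jac₁₁, jac₁₂, jac₂₁, jac₂₂, field₁, field₂, gam]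
    push_cast
    ring

/-- The change of charts `κ₂₁` from `(x₂, y₂, r₂, lam₂, h₂)`, `y₂ > 0`, to `K₁`. -/
noncomputable def kappa21 (x y r lam h : ℝ) : K1 :=
  (x / √y, (√y * r, 1 / y, lam / √y, h * √y))

/-- `γ_h¹(n) = κ₂₁(γ_h(n), h)`, where `r₂ = lam₂ = 0`; meaningful if `γ_h(n)` has `y₂ > 0`. -/
noncomputable def gam1 (h : ℝ) (n : ℤ) : K1 :=
  kappa21 (gam h n).1 (gam h n).2 0 0 h

end KahanCanard

/-! On `r = lam = 0` the special orbit lies on the parabola `x² = y + 1/2 + h²/8` of the chart `K₂`.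
In `K₁` this parabola becomes the curve `x = ∓√(1 + ε/2 + ε²h²/8)`, which is invariant under the
Kahan map and ends in the fixed points `∓1` at `ε = 0`. Center manifolds are not unique, so the task
is to find one that contains this curve together with the curves of fixed points. It must moreover
be `C¹` up to `h₁ = 0`, where the map degenerates to the identity and normal hyperbolicity (of
strength proportional to `h₁`) is lost.

Near `x = -1` the backward Kahan step expands the fibre `x` at rate about `2h`, while with `ε = δe`
and `δ` small the base moves only at rate `O(δh)`. In the coordinates `(r, e, m, τ)` with `τ = log
h` the base motion is a scaling `(e^S r, e^{-2S} e, e^{-S} m, τ + S)`, and every increment,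
derivative and quadratic error carries the common factor `h`. This factor cancels in all estimates,
so a graph transform preserves a class of `C^{1,1}` functions with constants uniform as `h → 0`. It
contracts at a rate depending on `h`, which suffices because `h` does not decrease under the
backward step. The transform does not change values over a set on which the initial graph is already
invariant; started from `startX`, which interpolates between the special curve and the fixed points,
it yields a graph through both (`IsGraphSystem.exists_invariant`, `special_invariant`,
`startX_invariant`). Cut-offs in `r` and `h` keep the base invariant; an added defect term keeps
`startX` invariant where the cut-off in `h` would destroy this.

The graph `g` is then `C^{1,1}` in `log h`. To be `C¹` in `h` up to `h = 0` it must satisfy `∂g/∂τ =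
o(h)`. The Kahan scheme has second order, so it commutes with its vector field up to small errors.
Hence the failure of the graph to be tangent to the field obeys a contracting linear relation with
source `O(h³)` and is `O(h²)`; a second such relation gives `∂g/∂τ = O(h²)`
(`exists_schemeFun_bounds`, `exists_step_deriv_bound`). The extension to `h = 0` is
`exists_contDiffOn_extension`.

Backward invariance implies forward invariance: as the fibre expands backward, a point whose
backward image lies on the graph lies on the graph (`IsGraphSystem.eq_of_back`). The repelling
manifold comes from the attracting one by the reversal `(x, lam, h) ↦ (-x, -lam, -h)` with negated
coefficients, since the inverse of a Kahan step is the step with `-h`. The approach to the fixed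
points is read off from the explicit orbit at `|n| ≈ 2h₁/h²`. -/

namespace KahanCanard

open scoped ContDiff

/-! ### The graph transform for systems with fibre expansion of variable strength -/

/-- Second order Taylor condition on `D`: at every point of `D` there is a linear map of norm at
most `L` which approximates `u` on `D` up to a quadratic error. -/
def HasJets {E : Type*} [NormedAddCommGroup E] [NormedSpace ℝ E] (D : Set E) (L K : ℝ)
    (u : E → ℝ) : Prop :=
  ∀ q ∈ D, ∃ l : E →L[ℝ] ℝ, ‖l‖ ≤ L ∧ ∀ q' ∈ D, |u q' - u q - l (q' - q)| ≤ K * ‖q' - q‖ ^ 2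

/-- Functions with values in `[lo, hi]`, Lipschitz constant `L` and quadratic Taylor constant `K`. -/
structure GraphClass {E : Type*} [NormedAddCommGroup E] [NormedSpace ℝ E] (D : Set E)
    (lo hi L K : ℝ) (u : E → ℝ) : Prop where
  range : ∀ q ∈ D, u q ∈ Icc lo hi
  lip : ∀ q ∈ D, ∀ q' ∈ D, |u q' - u q| ≤ L * ‖q' - q‖
  jets : HasJets D L K u

/-- A backward skew system `(x, q) ↦ (x + A x q, q + B x q)` over `D` which expands the fibres
`x` at the rate `c H q`, while the base moves with small Lipschitz constant `η H q`. -/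
structure IsGraphSystem {E : Type*} [NormedAddCommGroup E] [NormedSpace ℝ E] (D : Set E)
    (J : Set ℝ) (lo hi : ℝ) (H : E → ℝ) (A : ℝ → E → ℝ) (B : ℝ → E → E) (c C η : ℝ) : Prop where
  sub : Icc lo hi ⊆ J
  H_pos : ∀ q ∈ D, 0 < H q
  H_le : ∀ q ∈ D, H q ≤ 1
  maps : ∀ x ∈ J, ∀ q ∈ D, q + B x q ∈ D
  H_mono : ∀ x ∈ J, ∀ q ∈ D, H q ≤ H (q + B x q)
  mono : ∀ q ∈ D, ∀ x ∈ J, ∀ x' ∈ J, x' ≤ x →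
    c * H q * (x - x') ≤ A x q - A x' q ∧ A x q - A x' q ≤ x - x'
  A_lo : ∀ q ∈ D, A lo q ≤ 0
  A_hi : ∀ q ∈ D, 0 ≤ A hi q
  A_lip : ∀ x ∈ J, ∀ q ∈ D, ∀ q' ∈ D, ‖q' - q‖ ≤ 1 → |A x q' - A x q| ≤ C * H q * ‖q' - q‖
  B_lip : ∀ x ∈ J, ∀ x' ∈ J, ∀ q ∈ D, ∀ q' ∈ D, ‖q' - q‖ ≤ 1 →
    ‖B x' q' - B x q‖ ≤ η * H q * (|x' - x| + ‖q' - q‖)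
  A_jet : ∀ x ∈ J, ∀ q ∈ D, ∃ (α : ℝ) (l : E →L[ℝ] ℝ), c * H q ≤ α ∧ α ≤ 1 ∧ ‖l‖ ≤ C * H q ∧
    ∀ x' ∈ J, ∀ q' ∈ D, ‖q' - q‖ ≤ 1 →
      |A x' q' - A x q - α * (x' - x) - l (q' - q)| ≤ C * H q * (|x' - x| + ‖q' - q‖) ^ 2
  B_jet : ∀ x ∈ J, ∀ q ∈ D, ∃ (β : E) (l : E →L[ℝ] E), ‖β‖ ≤ η * H q ∧ ‖l‖ ≤ η * H q ∧
    ∀ x' ∈ J, ∀ q' ∈ D, ‖q' - q‖ ≤ 1 →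
      ‖B x' q' - B x q - (x' - x) • β - l (q' - q)‖ ≤ C * H q * (|x' - x| + ‖q' - q‖) ^ 2

/-- The averaged graph transform, whose fixed points are the invariant graphs. -/
noncomputable def graphStep {E : Type*} [AddCommGroup E] (A : ℝ → E → ℝ) (B : ℝ → E → E)
    (u : E → ℝ) (q : E) : ℝ :=
  (u q - A (u q) q + u (q + B (u q) q)) / 2

section

variable {E : Type*} [NormedAddCommGroup E] [NormedSpace ℝ E] {D : Set E}
    {J : Set ℝ} {lo hi : ℝ} {H : E → ℝ} {A : ℝ → E → ℝ} {B : ℝ → E → E} {c C η L K : ℝ}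

/-- The slope of `A` lies between `c H` and `1`, so `x ↦ x - A x q` is nondecreasing with slope at
most `1 - c H`. This is the contraction behind `graphStep`; inverting the fibre map is not needed.
-/
theorem IsGraphSystem.abs_mono (S : IsGraphSystem D J lo hi H A B c C η) {q : E} (hq : q ∈ D)
    {x x' : ℝ} (hx : x ∈ J) (hx' : x' ∈ J) :
    |(x' - A x' q) - (x - A x q)| ≤ (1 - c * H q) * |x' - x| := by
  rcases le_total x x' with h | h
  · obtain ⟨h1, h2⟩ := S.mono q hq x' hx' x hx h
    rw [abs_of_nonneg (by linarith), abs_of_nonneg (by linarith)]; linarith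
  · obtain ⟨h1, h2⟩ := S.mono q hq x hx x' hx' h
    rw [abs_of_nonpos (by linarith), abs_of_nonpos (by linarith)]; linarith

/-- The monotone map `x ↦ x - A x q` moves `lo` up and `hi` down, hence maps `[lo, hi]` into itself;
averaging with another value in the interval does no harm. -/
theorem IsGraphSystem.graphStep_range (S : IsGraphSystem D J lo hi H A B c C η) {u : E → ℝ}
    (hu : ∀ q ∈ D, u q ∈ Icc lo hi) : ∀ q ∈ D, graphStep A B u q ∈ Icc lo hi := by
  intro q hq
  have h0 := hu q hq
  have h1 := hu _ (S.maps _ (S.sub h0) q hq)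
  have hlh : lo ≤ hi := h0.1.trans h0.2
  have h2 := S.mono q hq _ (S.sub h0) _ (S.sub (left_mem_Icc.2 hlh)) h0.1
  have h3 := S.mono q hq _ (S.sub (right_mem_Icc.2 hlh)) _ (S.sub h0) h0.2
  have h4 := S.A_lo q hq
  have h5 := S.A_hi q hq
  simp only [graphStep, mem_Icc] at *
  constructor <;> linarith [h1.1, h1.2, h2.2, h3.2]

-- The fibre contributes a gain of `c H` times the constant, the base motion a loss of order `η H`
-- times it, and `A` itself a source of order `C H`. Since all three carry the factor `H`, the
-- smallness conditions contain no `H` and remain valid as `H → 0`.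
set_option maxHeartbeats 1000000 in
theorem IsGraphSystem.graphClass_graphStep (S : IsGraphSystem D J lo hi H A B c C η)
    (hC : 0 ≤ C) (hη : 0 ≤ η) (hL : 0 ≤ L) (hK : 0 ≤ K)
    (hL1 : hi - lo ≤ L) (hL2 : 2 * C ≤ c * L) (hL3 : 2 * (η * (L + 1)) ≤ c)
    (hη1 : η * (L + 1) ≤ 1) (hη2 : 2 * (η * (4 * L + 3)) ≤ c)
    (hK1 : hi - lo + L ≤ K) (hK2 : 2 * (C * (L + 1) ^ 3) ≤ c * K)
    {u : E → ℝ} (hu : GraphClass D lo hi L K u) :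
    GraphClass D lo hi L K (graphStep A B u) := by
  have hran := S.graphStep_range hu.range
  have hosc : ∀ q ∈ D, ∀ q' ∈ D, |graphStep A B u q' - graphStep A B u q| ≤ hi - lo := by
    intro q hq q' hq'
    have h1 := hran q hq
    have h2 := hran q' hq'
    rw [abs_le]; constructor <;> linarith [h1.1, h1.2, h2.1, h2.2]
  have hbase : ∀ q ∈ D, ∀ q' ∈ D, ‖q' - q‖ ≤ 1 →
      ‖(q' + B (u q') q') - (q + B (u q) q)‖ ≤ (1 + η * H q * (L + 1)) * ‖q' - q‖ := by
    intro q hq q' hq' hd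
    have h1 := S.B_lip _ (S.sub (hu.range q hq)) _ (S.sub (hu.range q' hq')) q hq q' hq' hd
    have h2 := hu.lip q hq q' hq'
    have hH := (S.H_pos q hq).le
    calc _ = ‖(q' - q) + (B (u q') q' - B (u q) q)‖ := by congr 1; abel
      _ ≤ ‖q' - q‖ + η * H q * (|u q' - u q| + ‖q' - q‖) := (norm_add_le _ _).trans (by gcongr)
      _ ≤ ‖q' - q‖ + η * H q * (L * ‖q' - q‖ + ‖q' - q‖) := by gcongr
      _ = _ := by ring
  refine ⟨hran, ?_, ?_⟩
  · intro q hq q' hq'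
    -- The conditions on `A` and `B` are local. Beyond distance `1` the total oscillation `hi - lo`
    -- is already covered by `hL1`, and by `hK1` in the second order estimate.
    rcases le_or_gt ‖q' - q‖ 1 with hd | hd
    swap
    · refine (hosc q hq q' hq').trans (hL1.trans ?_)
      nlinarith
    have hH := (S.H_pos q hq).le
    have hx := S.sub (hu.range q hq)
    have hx' := S.sub (hu.range q' hq')
    have h1 := S.abs_mono hq hx hx'
    have h2 := S.A_lip _ hx' q hq q' hq' hd
    have h3 := hu.lip _ (S.maps _ hx q hq) _ (S.maps _ hx' q' hq')
    have h4 := hbase q hq q' hq' hd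
    have h5 := hu.lip q hq q' hq'
    have hcH : 0 ≤ 1 - c * H q := by
      obtain ⟨α, l, ha, hb, -⟩ := S.A_jet _ hx q hq
      linarith
    set d := ‖q' - q‖ with hdd
    have hd0 : 0 ≤ d := norm_nonneg _
    have e : graphStep A B u q' - graphStep A B u q =
        ((u q' - A (u q') q) - (u q - A (u q) q)) / 2 - (A (u q') q' - A (u q') q) / 2
          + (u (q' + B (u q') q') - u (q + B (u q) q)) / 2 := by
      simp only [graphStep]; ring
    have h6 : |u (q' + B (u q') q') - u (q + B (u q) q)| ≤ L * ((1 + η * H q * (L + 1)) * d) :=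
      h3.trans (by gcongr)
    have h7 : |(u q' - A (u q') q) - (u q - A (u q) q)| ≤ (1 - c * H q) * (L * d) :=
      h1.trans (by gcongr)
    have h8 : L * H q * d * (2 * (η * (L + 1))) ≤ L * H q * d * c := by gcongr
    have h9 : H q * d * (2 * C) ≤ H q * d * (c * L) := by gcongr
    rw [e]
    rw [abs_le] at *
    constructor <;> linarith [h2.1, h2.2, h6.1, h6.2, h7.1, h7.2]
  · intro q hq
    have hH := (S.H_pos q hq).le
    have hH1 := S.H_le q hq
    have hx := S.sub (hu.range q hq)
    obtain ⟨α, lA, hα1, hα2, hlA, hA⟩ := S.A_jet _ hx q hq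
    obtain ⟨β, lB, hβ, hlB, hB⟩ := S.B_jet _ hx q hq
    obtain ⟨l, hl, hlu⟩ := hu.jets q hq
    obtain ⟨m, hm, hmu⟩ := hu.jets _ (S.maps _ hx q hq)
    have hcH : 0 ≤ 1 - c * H q := by linarith
    -- The chain rule derivative of `graphStep`, with `l`, `m` the jets of `u` at `q` and at the
    -- moved point.
    let N : E →L[ℝ] ℝ := (1 / 2 : ℝ) • ((1 - α) • l - lA + m +
      m.comp (lB + ContinuousLinearMap.smulRight l β))
    have hNL : ‖N‖ ≤ L := by
      refine ContinuousLinearMap.opNorm_le_bound _ hL fun v => ?_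
      have i1 : |l v| ≤ L * ‖v‖ := (l.le_opNorm v).trans (by gcongr)
      have i2 : |lA v| ≤ C * H q * ‖v‖ := (lA.le_opNorm v).trans (by gcongr)
      have i3 : |m v| ≤ L * ‖v‖ := (m.le_opNorm v).trans (by gcongr)
      have i4 : ‖lB v + l v • β‖ ≤ η * H q * (L + 1) * ‖v‖ := by
        calc _ ≤ ‖lB v‖ + |l v| * ‖β‖ := (norm_add_le _ _).trans (by rw [norm_smul]; rfl)
          _ ≤ η * H q * ‖v‖ + (L * ‖v‖) * (η * H q) := by
            gcongr
            exact (lB.le_opNorm v).trans (by gcongr)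
          _ = _ := by ring
      have i5 : |m (lB v + l v • β)| ≤ L * (η * H q * (L + 1) * ‖v‖) :=
        (m.le_opNorm _).trans (by gcongr)
      have e : N v = ((1 - α) * l v - lA v + m v + m (lB v + l v • β)) / 2 := by
        simp [N]; ring
      have i6 : |(1 - α) * l v| ≤ (1 - c * H q) * (L * ‖v‖) := by
        rw [abs_mul, abs_of_nonneg (by linarith)]
        gcongr
      have h8 : L * H q * ‖v‖ * (2 * (η * (L + 1))) ≤ L * H q * ‖v‖ * c := by gcongr
      have h9 : H q * ‖v‖ * (2 * C) ≤ H q * ‖v‖ * (c * L) := by gcongr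
      rw [Real.norm_eq_abs, e]
      rw [abs_le] at *
      constructor <;> linarith [i2.1, i2.2, i3.1, i3.2, i5.1, i5.2, i6.1, i6.2]
    refine ⟨N, hNL, fun q' hq' => ?_⟩
    rcases le_or_gt ‖q' - q‖ 1 with hd | hd
    swap
    · have h1 := hosc q hq q' hq'
      have h2 : |N (q' - q)| ≤ L * ‖q' - q‖ := (N.le_opNorm _).trans (by gcongr)
      have h3 : hi - lo + L * ‖q' - q‖ ≤ K * ‖q' - q‖ ^ 2 := by
        have hho : 0 ≤ hi - lo := (abs_nonneg _).trans h1
        calc hi - lo + L * ‖q' - q‖ ≤ (hi - lo) * ‖q' - q‖ ^ 2 + L * ‖q' - q‖ ^ 2 := by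
              have : ‖q' - q‖ ≤ ‖q' - q‖ ^ 2 := by nlinarith
              have : 1 ≤ ‖q' - q‖ ^ 2 := by nlinarith
              gcongr
              nlinarith
          _ = (hi - lo + L) * ‖q' - q‖ ^ 2 := by ring
          _ ≤ _ := by gcongr
      rw [abs_le] at *
      constructor <;> linarith [h1.1, h1.2, h2.1, h2.2]
    have hx' := S.sub (hu.range q' hq')
    have j1 := hlu q' hq'
    have j2 := hA _ hx' q' hq' hd
    have j3 := hB _ hx' q' hq' hd
    have j4 := hmu _ (S.maps _ hx' q' hq')
    have j5 := hbase q hq q' hq' hd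
    have j6 := hu.lip q hq q' hq'
    set d := ‖q' - q‖ with hdd
    have hd0 : 0 ≤ d := norm_nonneg _
    set p := q + B (u q) q with hp
    set p' := q' + B (u q') q' with hp'
    set v := q' - q with hv
    have j2' : |A (u q') q' - A (u q) q - α * (u q' - u q) - lA v| ≤
        C * H q * ((L + 1) * d) ^ 2 := j2.trans (by gcongr; linarith)
    have j3' : ‖B (u q') q' - B (u q) q - (u q' - u q) • β - lB v‖ ≤
        C * H q * ((L + 1) * d) ^ 2 := j3.trans (by gcongr; linarith)
    have j4' : |u p' - u p - m (p' - p)| ≤ K * ((1 + η * H q * (L + 1)) * d) ^ 2 :=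
      j4.trans (by gcongr)
    have e1 : p' - p - (v + lB v + l v • β) =
        (B (u q') q' - B (u q) q - (u q' - u q) • β - lB v) + (u q' - u q - l v) • β := by
      simp only [hp, hp', hv, sub_smul]; abel
    have j7 : ‖p' - p - (v + lB v + l v • β)‖ ≤
        C * H q * ((L + 1) * d) ^ 2 + K * d ^ 2 * (η * H q) := by
      rw [e1]
      refine (norm_add_le _ _).trans ?_
      rw [norm_smul, Real.norm_eq_abs]
      gcongr
    have j8 : |m (p' - p - (v + lB v + l v • β))| ≤
        L * (C * H q * ((L + 1) * d) ^ 2 + K * d ^ 2 * (η * H q)) :=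
      (m.le_opNorm _).trans (by gcongr)
    have j9 : |(1 - α) * (u q' - u q - l v)| ≤ (1 - c * H q) * (K * d ^ 2) := by
      rw [abs_mul, abs_of_nonneg (by linarith)]
      gcongr
    -- Four remainders: that of `u`, damped by `1 - α`; that of `A`; that of `u` at the moved point;
    -- and the image under `m` of the remainder of the base motion.
    have e2 : graphStep A B u q' - graphStep A B u q - N v =
        ((1 - α) * (u q' - u q - l v)) / 2
        - (A (u q') q' - A (u q) q - α * (u q' - u q) - lA v) / 2
        + (u p' - u p - m (p' - p)) / 2 + m (p' - p - (v + lB v + l v • β)) / 2 := by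
      simp only [graphStep, N, map_sub, map_add, map_smul, smul_apply, add_apply, sub_apply,
        ContinuousLinearMap.comp_apply, ContinuousLinearMap.smulRight_apply, smul_eq_mul,
        ← hp, ← hp']
      ring
    have k1 : (1 + η * H q * (L + 1)) ^ 2 ≤ 1 + 3 * (η * (L + 1)) * H q := by
      have : η * H q * (L + 1) ≤ 1 := by
        calc η * H q * (L + 1) = η * (L + 1) * H q := by ring
          _ ≤ 1 * 1 := by gcongr
          _ = 1 := one_mul 1
      have : 0 ≤ η * H q * (L + 1) := by positivity
      nlinarith
    have k2 : K * ((1 + η * H q * (L + 1)) * d) ^ 2 ≤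
        K * d ^ 2 * (1 + 3 * (η * (L + 1)) * H q) := by
      calc _ = K * d ^ 2 * (1 + η * H q * (L + 1)) ^ 2 := by ring
        _ ≤ _ := by gcongr
    -- Each of the next two inequalities spends half of the gain `c H K`. The number `4L + 3` is
    -- `3(L + 1)`, from the distorted base distance, plus `L`, from `m` applied to the base
    -- remainder.
    have k3 : H q * d ^ 2 * (2 * (C * (L + 1) ^ 3)) ≤ H q * d ^ 2 * (c * K) := by gcongr
    have k4 : H q * d ^ 2 * K * (2 * (η * (4 * L + 3))) ≤ H q * d ^ 2 * K * c := by gcongr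
    rw [e2]
    rw [abs_le] at *
    constructor <;>
      linarith [j2'.1, j2'.2, j4'.1, j4'.2, j8.1, j8.2, j9.1, j9.2]

/-- There is no uniform contraction, since `H` may tend to `0`. But `H` does not decrease along the
base motion, so the set `{h₀ ≤ H}` can be treated by itself, and there the rate is at least `c h₀ /
4`: half of the gain `c H / 2` is lost to the motion of the base. -/
theorem IsGraphSystem.dist_graphStep_le (S : IsGraphSystem D J lo hi H A B c C η)
    (hη : 0 ≤ η) (hL : 0 ≤ L) (hc : 2 * (η * L) ≤ c) {u w : E → ℝ}
    (hu : GraphClass D lo hi L K u) (hw : ∀ q ∈ D, w q ∈ Icc lo hi) {h₀ M : ℝ}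
    (hM : ∀ q ∈ D, h₀ ≤ H q → |u q - w q| ≤ M) (q : E) (hq : q ∈ D) (hh : h₀ ≤ H q)
    (hc0 : 0 ≤ c) :
    |graphStep A B u q - graphStep A B w q| ≤ (1 - c * h₀ / 4) * M := by
  have hH := (S.H_pos q hq).le
  have hx := S.sub (hu.range q hq)
  have hx' := S.sub (hw q hq)
  have h1 := S.abs_mono hq hx' hx
  have h2 := S.B_lip _ hx' _ hx q hq q hq (by simp)
  have h3 := hu.lip _ (S.maps _ hx' q hq) _ (S.maps _ hx q hq)
  have h4 := hM _ (S.maps _ hx' q hq) (hh.trans (S.H_mono _ hx' q hq))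
  have h5 := hM q hq hh
  simp only [sub_self, norm_zero, add_zero] at h2
  have hcH : 0 ≤ 1 - c * H q := by
    obtain ⟨α, l, ha, hb, -⟩ := S.A_jet _ hx q hq
    linarith
  have h6 : |u (q + B (u q) q) - u (q + B (w q) q)| ≤ L * (η * H q * M) := by
    refine h3.trans ?_
    rw [add_sub_add_left_eq_sub]
    gcongr
    exact h2.trans (by gcongr)
  have h7 : |(u q - A (u q) q) - (w q - A (w q) q)| ≤ (1 - c * H q) * M := h1.trans (by gcongr)
  have e : graphStep A B u q - graphStep A B w q =
      ((u q - A (u q) q) - (w q - A (w q) q)) / 2 + (u (q + B (u q) q) - u (q + B (w q) q)) / 2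
      + (u (q + B (w q) q) - w (q + B (w q) q)) / 2 := by
    simp only [graphStep]; ring
  have hM0 : 0 ≤ M := (abs_nonneg _).trans h5
  have k1 : H q * M * (2 * (η * L)) ≤ H q * M * c := by gcongr
  have k2 : c * M * h₀ ≤ c * M * H q := by gcongr
  rw [e]
  rw [abs_le] at *
  constructor <;> linarith [h4.1, h4.2, h6.1, h6.2, h7.1, h7.2]

/-- A limit along one ultrafilter exists at all points simultaneously, and the jets will converge
along the same ultrafilter; no subsequences have to be chosen. -/
theorem exists_hyperfilter_lim {u : ℕ → ℝ} {lo hi : ℝ} (hu : ∀ n, u n ∈ Icc lo hi) :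
    ∃ x ∈ Icc lo hi, Filter.Tendsto u (Filter.hyperfilter ℕ) (𝓝 x) := by
  have h := (isCompact_Icc (a := lo) (b := hi)).ultrafilter_le_nhds
    ((Filter.hyperfilter ℕ).map u) (by
      rw [Filter.le_principal_iff, Ultrafilter.mem_coe, Ultrafilter.mem_map]
      exact Filter.univ_mem' hu)
  obtain ⟨x, hx, hle⟩ := h
  exact ⟨x, hx, hle⟩

/-- Existence of an invariant graph of class `C^{1,1}`, with prescribed values on a set `Z` over
which the initial graph is already invariant. -/
theorem IsGraphSystem.exists_invariant [FiniteDimensional ℝ E]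
    (S : IsGraphSystem D J lo hi H A B c C η)
    (hc : 0 < c) (hC : 0 ≤ C) (hη : 0 ≤ η) (hL : 0 ≤ L) (hK : 0 ≤ K)
    (hL1 : hi - lo ≤ L) (hL2 : 2 * C ≤ c * L) (hL3 : 2 * (η * (L + 1)) ≤ c)
    (hη1 : η * (L + 1) ≤ 1) (hη2 : 2 * (η * (4 * L + 3)) ≤ c)
    (hK1 : hi - lo + L ≤ K) (hK2 : 2 * (C * (L + 1) ^ 3) ≤ c * K)
    {u : E → ℝ} (hu : GraphClass D lo hi L K u) (Z : Set E) (hZD : Z ⊆ D)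
    (hZ : ∀ q ∈ Z, q + B (u q) q ∈ Z ∧ u (q + B (u q) q) = u q + A (u q) q) :
    ∃ g : E → ℝ, GraphClass D lo hi L K g ∧ (∀ q ∈ Z, g q = u q) ∧
      ∀ q ∈ D, g (q + B (g q) q) = g q + A (g q) q := by
  classical
  let U : ℕ → E → ℝ := fun n => (graphStep A B)^[n] u
  have hUs : ∀ n, U (n + 1) = graphStep A B (U n) := fun n =>
    Function.iterate_succ_apply' (graphStep A B) n u
  have hU : ∀ n, GraphClass D lo hi L K (U n) := by
    intro n
    induction n with
    | zero => exact hu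
    | succ n ih =>
      rw [hUs]
      exact S.graphClass_graphStep hC hη hL hK hL1 hL2 hL3 hη1 hη2 hK1 hK2 ih
  have hUZ : ∀ n, ∀ q ∈ Z, U n q = u q := by
    intro n
    induction n with
    | zero => exact fun q _ => rfl
    | succ n ih =>
      intro q hq
      rw [hUs]
      simp only [graphStep]
      rw [ih q hq, ih _ (hZ q hq).1, (hZ q hq).2]
      ring
  have hex : ∀ q, ∃ x, q ∈ D → x ∈ Icc lo hi ∧
      Filter.Tendsto (fun n => U n q) (Filter.hyperfilter ℕ) (𝓝 x) := by
    intro q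
    by_cases hq : q ∈ D
    · obtain ⟨x, hx, hx'⟩ := exists_hyperfilter_lim (fun n => (hU n).range q hq)
      exact ⟨x, fun _ => ⟨hx, hx'⟩⟩
    · exact ⟨0, fun h => absurd h hq⟩
  choose g hg using hex
  have hgl : ∀ q ∈ D, ∀ q' ∈ D, |g q' - g q| ≤ L * ‖q' - q‖ := by
    intro q hq q' hq'
    exact le_of_tendsto (((hg q' hq').2.sub (hg q hq).2).abs)
      (Filter.Eventually.of_forall fun n => (hU n).lip q hq q' hq')
  have hgc : GraphClass D lo hi L K g := by
    refine ⟨fun q hq => (hg q hq).1, hgl, ?_⟩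
    intro q hq
    choose l hl hlu using fun n => (hU n).jets q hq
    -- Finite dimension enters here: the jets of the iterates stay in a compact ball of the dual
    -- space, so they have a limit, and the Taylor inequality passes to it.
    have hcomp : IsCompact (Metric.closedBall (0 : E →L[ℝ] ℝ) L) := isCompact_closedBall _ _
    obtain ⟨l₀, hl₀, hle⟩ := hcomp.ultrafilter_le_nhds ((Filter.hyperfilter ℕ).map l) (by
      rw [Filter.le_principal_iff, Ultrafilter.mem_coe, Ultrafilter.mem_map]
      exact Filter.univ_mem' fun n => by simpa using hl n)
    have hle' : Filter.Tendsto l (Filter.hyperfilter ℕ) (𝓝 l₀) := hle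
    refine ⟨l₀, by simpa using hl₀, fun q' hq' => ?_⟩
    have hev : Filter.Tendsto (fun n => l n (q' - q)) (Filter.hyperfilter ℕ)
        (𝓝 (l₀ (q' - q))) :=
      ((ContinuousLinearMap.apply ℝ ℝ (q' - q)).continuous.tendsto l₀).comp hle'
    exact le_of_tendsto ((((hg q' hq').2.sub (hg q hq).2).sub hev).abs)
      (Filter.Eventually.of_forall fun n => hlu n q' hq')
  refine ⟨g, hgc, ?_, ?_⟩
  · intro q hq
    refine tendsto_nhds_unique (hg q (hZD hq)).2 ?_
    simp only [hUZ _ q hq]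
    exact tendsto_const_nhds
  · intro q hq
    have hlo : lo ≤ hi := (hu.range q hq).1.trans (hu.range q hq).2
    -- The induction has to range over all points with `H` at least `H q`, because the estimate at
    -- `q` calls for the estimate at its image in the base.
    have hdn : ∀ n, ∀ q' ∈ D, H q ≤ H q' →
        |U (n + 1) q' - U n q'| ≤ (1 - c * H q / 4) ^ n * (hi - lo) := by
      intro n
      induction n with
      | zero =>
        intro q' hq' _
        have h1 := (hU 1).range q' hq'
        have h2 := (hU 0).range q' hq'
        simp only [pow_zero, one_mul]
        rw [abs_le]
        constructor <;> linarith [h1.1, h1.2, h2.1, h2.2]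
      | succ n ih =>
        intro q' hq' hh
        have h1 := S.dist_graphStep_le hη hL (by nlinarith) (hU (n + 1)) (hU n).range ih q' hq' hh hc.le
        rw [hUs (n + 1)]
        nth_rewrite 2 [hUs n]
        rw [pow_succ']
        linarith
    have hx := S.sub (hg q hq).1
    have hcH : c * H q ≤ 1 := by
      obtain ⟨α, l, ha, hb, -⟩ := S.A_jet _ hx q hq
      linarith
    have hcp : 0 < c * H q := mul_pos hc (S.H_pos q hq)
    have hpow : Filter.Tendsto (fun n : ℕ => (1 - c * H q / 4) ^ n * (hi - lo))
        (Filter.hyperfilter ℕ) (𝓝 0) := by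
      have := (tendsto_pow_atTop_nhds_zero_of_lt_one (r := 1 - c * H q / 4) (by linarith)
        (by linarith)).mul_const (hi - lo)
      rw [zero_mul] at this
      exact this.mono_left (Nat.hyperfilter_le_atTop)
    -- An ultrafilter limit is not invariant under a shift of the index. The geometric decay makes
    -- the limits of `U n q` and `U (n + 1) q` agree, so the limit is a fixed point of `graphStep`.
    have hdiff : Filter.Tendsto (fun n => U (n + 1) q - U n q) (Filter.hyperfilter ℕ) (𝓝 0) := by
      rw [tendsto_zero_iff_abs_tendsto_zero]
      exact squeeze_zero (fun n => abs_nonneg _) (fun n => hdn n q hq le_rfl) hpow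
    have hstep : Filter.Tendsto (fun n => graphStep A B (U n) q) (Filter.hyperfilter ℕ)
        (𝓝 (graphStep A B g q)) := by
      have e1 : Filter.Tendsto (fun n => |U n q - g q|) (Filter.hyperfilter ℕ) (𝓝 0) := by
        have := ((hg q hq).2.sub_const (g q)).abs
        simpa using this
      have hA : Filter.Tendsto (fun n => U n q - A (U n q) q) (Filter.hyperfilter ℕ)
          (𝓝 (g q - A (g q) q)) := by
        rw [tendsto_iff_dist_tendsto_zero]
        refine squeeze_zero (fun n => dist_nonneg)
          (fun n => ?_) (e1.const_mul 1 |>.trans (by simp))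
        rw [Real.dist_eq]
        refine (S.abs_mono hq hx (S.sub ((hU n).range q hq))).trans ?_
        gcongr
        linarith
      have hB : Filter.Tendsto (fun n => U n (q + B (U n q) q)) (Filter.hyperfilter ℕ)
          (𝓝 (g (q + B (g q) q))) := by
        have hp := S.maps _ hx q hq
        have h1 := (hg _ hp).2
        have h2 : Filter.Tendsto (fun n => U n (q + B (U n q) q) - U n (q + B (g q) q))
            (Filter.hyperfilter ℕ) (𝓝 0) := by
          rw [tendsto_zero_iff_abs_tendsto_zero]
          refine squeeze_zero (fun n => abs_nonneg _)
            (fun n => ?_) (e1.const_mul (L * (η * H q)) |>.trans (by simp))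
          have hxn := S.sub ((hU n).range q hq)
          have h3 := (hU n).lip _ hp _ (S.maps _ hxn q hq)
          have h4 := S.B_lip _ hx _ hxn q hq q hq (by simp)
          simp only [sub_self, norm_zero, add_zero] at h4
          rw [add_sub_add_left_eq_sub] at h3
          calc _ ≤ L * ‖B (U n q) q - B (g q) q‖ := h3
            _ ≤ L * (η * H q * |U n q - g q|) := by gcongr
            _ = _ := by ring
        simpa using h2.add h1
      exact (hA.add hB).div_const 2
    have hfix : graphStep A B g q = g q := by
      refine tendsto_nhds_unique hstep ?_
      have := hdiff.add (hg q hq).2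
      simp only [sub_add_cancel, zero_add, hUs] at this
      exact this
    simp only [graphStep] at hfix
    linarith

/-- A point whose backward image lies on an invariant graph lies on this graph. -/
theorem IsGraphSystem.eq_of_back (S : IsGraphSystem D J lo hi H A B c C η)
    (hη : 0 ≤ η) (hc : 0 < c) (hL : 0 ≤ L) (hcL : 2 * (η * (L + 1)) ≤ c) {g : E → ℝ}
    (hg : GraphClass D lo hi L K g)
    (hinv : ∀ q ∈ D, g (q + B (g q) q) = g q + A (g q) q) {q : E} (hq : q ∈ D) {x : ℝ}
    (hx : x ∈ J) (h : g (q + B x q) = x + A x q) : x = g q := by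
  have hgJ := S.sub (hg.range q hq)
  have h1 := hg.lip _ (S.maps _ hgJ q hq) _ (S.maps _ hx q hq)
  have h2 := S.B_lip _ hgJ _ hx q hq q hq (by simp)
  simp only [sub_self, norm_zero, add_zero] at h2
  rw [add_sub_add_left_eq_sub, h, hinv q hq] at h1
  have hH := S.H_pos q hq
  have h3 : (1 + c * H q) * |x - g q| ≤ |x + A x q - (g q + A (g q) q)| := by
    rcases le_total (g q) x with hle | hle
    · obtain ⟨h1, h2⟩ := S.mono q hq x hx _ hgJ hle
      have h0 : 0 ≤ c * H q * (x - g q) := by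
        have : 0 ≤ x - g q := by linarith
        positivity
      rw [abs_of_nonneg (by linarith), abs_of_nonneg (by linarith)]; linarith
    · obtain ⟨h1, h2⟩ := S.mono q hq _ hgJ x hx hle
      have h0 : 0 ≤ c * H q * (g q - x) := by
        have : 0 ≤ g q - x := by linarith
        positivity
      rw [abs_of_nonpos (by linarith), abs_of_nonpos (by linarith)]; linarith
  -- Two different points of the fibre separate at least by the factor `1 + c H`, whereas the graph
  -- over the two image points separates only by `L η H` times the original distance.
  have h4 : (1 + c * H q) * |x - g q| ≤ L * (η * H q * |x - g q|) :=
    h3.trans (h1.trans (by gcongr))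
  by_contra hne
  have hpos : 0 < |x - g q| := abs_pos.2 (sub_ne_zero.2 hne)
  have h5 : H q * |x - g q| * (2 * (η * (L + 1))) ≤ H q * |x - g q| * c := by gcongr
  have h6 : 0 ≤ H q * |x - g q| * c := by positivity
  have h7 : 0 ≤ H q * |x - g q| * η := by positivity
  nlinarith

end

/-! ### From `C^{1,1}` in the logarithm of the step size to `C¹` up to step size zero -/

theorem exists_tendsto_of_cauchy {Z : Type*} {l : Filter Z} [l.NeBot] {φ : Z → ℝ}
    (h : ∀ ε > 0, ∃ s ∈ l, ∀ z ∈ s, ∀ z' ∈ s, |φ z - φ z'| < ε) :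
    ∃ x, Filter.Tendsto φ l (𝓝 x) := by
  rw [← cauchy_map_iff_exists_tendsto, Metric.cauchy_iff]
  refine ⟨inferInstance, fun ε hε => ?_⟩
  obtain ⟨s, hs, hz⟩ := h ε hε
  refine ⟨φ '' s, Filter.image_mem_map hs, ?_⟩
  rintro _ ⟨z, hzs, rfl⟩ _ ⟨z', hzs', rfl⟩
  rw [Real.dist_eq]
  exact hz z hzs z' hzs'

/-- First `t` is taken so small that `2 K t` is below `ε`, then `η` small compared with `t`. Thus
mere closeness of function values controls derivatives, thanks to the uniform constant `K`. -/
theorem exists_tendsto_of_difference_quotients {Z : Type*} {l : Filter Z} [l.NeBot] {φ : Z → ℝ}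
    {K t₀ : ℝ} (hK : 0 ≤ K) (ht₀ : 0 < t₀)
    (h : ∀ t, 0 < t → t < t₀ → ∀ η > 0, ∃ s ∈ l, ∀ z ∈ s, ∀ z' ∈ s,
      |φ z - φ z'| * t ≤ η + 2 * K * t ^ 2) :
    ∃ x, Filter.Tendsto φ l (𝓝 x) := by
  refine exists_tendsto_of_cauchy fun ε hε => ?_
  have ht : 0 < min (t₀ / 2) (ε / (8 * (K + 1))) := by positivity
  have ht2 : min (t₀ / 2) (ε / (8 * (K + 1))) < t₀ := (min_le_left _ _).trans_lt (by linarith)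
  have ht3 := min_le_right (t₀ / 2) (ε / (8 * (K + 1)))
  set t := min (t₀ / 2) (ε / (8 * (K + 1)))
  obtain ⟨s, hs, hz⟩ := h t ht ht2 (ε * t / 4) (by positivity)
  refine ⟨s, hs, fun z hzs z' hzs' => ?_⟩
  have h1 := hz z hzs z' hzs'
  rw [le_div_iff₀ (by positivity)] at ht3
  have h2 : |φ z - φ z'| * t ≤ (ε / 2) * t := by nlinarith
  have h3 := le_of_mul_le_mul_right h2 ht
  linarith

/-- The base domain, with `τ = log h`. -/
def logBox (R κ T : ℝ) : Set (ℝ × ℝ × ℝ × ℝ) :=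
  Icc 0 R ×ˢ Icc 0 1 ×ˢ Icc (-κ) κ ×ˢ Iic T

/-- Two nearby points of an interval need the same shift for their difference quotients to be
comparable; the shift is made towards the farther end. -/
theorem shift_sign {a b z z' t d : ℝ} (hz : z ∈ Icc a b) (hz' : z' ∈ Icc a b) (hd : |z - z'| ≤ d)
    (ht : 0 ≤ t) (htd : t + d ≤ (b - a) / 2) :
    ∃ s : ℝ, |s| = t ∧ z + s ∈ Icc a b ∧ z' + s ∈ Icc a b := by
  rw [abs_le] at hd
  rcases le_total z ((a + b) / 2) with h | h
  · refine ⟨t, abs_of_nonneg ht, ?_, ?_⟩ <;> constructor <;> linarith [hz.1, hz'.1, hd.1, hd.2]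
  · refine ⟨-t, by rw [abs_neg, abs_of_nonneg ht], ?_, ?_⟩ <;> constructor <;>
      linarith [hz.2, hz'.2, hd.1, hd.2]

section

variable {R κ T ν L K C : ℝ} {g : ℝ × ℝ × ℝ × ℝ → ℝ}
  {l : ℝ × ℝ × ℝ × ℝ → (ℝ × ℝ × ℝ × ℝ →L[ℝ] ℝ)}

theorem hasFDerivWithinAt_of_jets {D : Set (ℝ × ℝ × ℝ × ℝ)} {q : ℝ × ℝ × ℝ × ℝ}
    (hl : ∀ q' ∈ D, |g q' - g q - l q (q' - q)| ≤ K * ‖q' - q‖ ^ 2) :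
    HasFDerivWithinAt g (l q) D q := by
  rw [hasFDerivWithinAt_iff_isLittleO]
  have h1 : (fun q' => g q' - g q - l q (q' - q)) =O[𝓝[D] q] fun q' => ‖q' - q‖ ^ 2 := by
    refine Asymptotics.IsBigO.of_bound K ?_
    filter_upwards [self_mem_nhdsWithin] with q' hq'
    simpa using hl q' hq'
  refine h1.trans_isLittleO ?_
  have h2 : Filter.Tendsto (fun q' => ‖q' - q‖) (𝓝[D] q) (𝓝 0) := by
    have : Filter.Tendsto (fun q' => ‖q' - q‖) (𝓝 q) (𝓝 0) := by
      have := (continuous_id.sub (continuous_const (y := q))).norm.tendsto q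
      simpa using this
    exact this.mono_left nhdsWithin_le_nhds
  have h3 : (fun q' => ‖q' - q‖ ^ 2) =o[𝓝[D] q] fun q' => ‖q' - q‖ := by
    have h4 : (fun q' => ‖q' - q‖) =o[𝓝[D] q] fun _ => (1 : ℝ) :=
      (Asymptotics.isLittleO_one_iff ℝ).2 h2
    simpa [pow_two] using h4.mul_isBigO (Asymptotics.isBigO_refl (fun q' => ‖q' - q‖) (𝓝[D] q))
  exact h3.trans_isBigO (Asymptotics.isBigO_refl _ _).norm_left

/-- Since `d/dh = h⁻¹ d/d(log h)`, the bound `C h²` for the logarithmic derivative becomes `C h ≤ C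
ν`, without a singularity at `h = 0`. -/
theorem lipschitz_in_step (hT : Real.log ν ≤ T) (hC : 0 ≤ C)
    (hjets : ∀ q ∈ logBox R κ T, ∀ q' ∈ logBox R κ T,
      |g q' - g q - l q (q' - q)| ≤ K * ‖q' - q‖ ^ 2)
    (hk : ∀ q ∈ logBox R κ T, Real.exp q.2.2.2 ≤ ν →
      |l q (0, 0, 0, 1)| ≤ C * Real.exp q.2.2.2 ^ 2)
    {r e m h h' : ℝ} (hr : r ∈ Icc 0 R) (he : e ∈ Icc (0 : ℝ) 1) (hm : m ∈ Icc (-κ) κ)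
    (hh : h ∈ Ioc 0 ν) (hh' : h' ∈ Ioc 0 ν) :
    |g (r, e, m, Real.log h') - g (r, e, m, Real.log h)| ≤ C * ν * |h' - h| := by
  have hmem : ∀ y ∈ Ioc 0 ν, (r, e, m, Real.log y) ∈ logBox R κ T := fun y hy =>
    ⟨hr, he, hm, (Real.log_le_log hy.1 hy.2).trans hT⟩
  have hd : ∀ y ∈ Ioc 0 ν, HasDerivWithinAt (fun y => g (r, e, m, Real.log y))
      (l (r, e, m, Real.log y) (0, 0, 0, y⁻¹)) (Ioc 0 ν) y := by
    intro y hy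
    have h1 := hasFDerivWithinAt_of_jets (hjets _ (hmem y hy))
    have h2 : HasDerivWithinAt (fun y => (r, e, m, Real.log y)) ((0, 0, 0, y⁻¹) : ℝ × ℝ × ℝ × ℝ)
        (Ioc 0 ν) y :=
      (((hasDerivAt_const y r).prodMk ((hasDerivAt_const y e).prodMk
        ((hasDerivAt_const y m).prodMk (Real.hasDerivAt_log hy.1.ne')))).hasDerivWithinAt)
    exact h1.comp_hasDerivWithinAt y h2 hmem
  refine (convex_Ioc 0 ν).norm_image_sub_le_of_norm_hasDerivWithin_le hd (fun y hy => ?_) hh hh'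
  have e1 : ((0, 0, 0, y⁻¹) : ℝ × ℝ × ℝ × ℝ) = y⁻¹ • (0, 0, 0, 1) := by simp
  have h3 := hk _ (hmem y hy) (by simpa [Real.exp_log hy.1] using hy.2)
  simp only [Real.exp_log hy.1] at h3
  rw [e1, map_smul, smul_eq_mul, Real.norm_eq_abs, abs_mul, abs_of_pos (inv_pos.2 hy.1)]
  calc y⁻¹ * |l (r, e, m, Real.log y) (0, 0, 0, 1)| ≤ y⁻¹ * (C * y ^ 2) := by
        have := inv_pos.2 hy.1
        gcongr
    _ = C * y := by field_simp [hy.1.ne']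
    _ ≤ C * ν := by have := hy.2; gcongr

/-- Each derivative differs from the difference quotient with increment `s` by at most `K t`, and
the two quotients are close because the four values of `g` are pairwise close. -/
theorem jet_difference {D : Set (ℝ × ℝ × ℝ × ℝ)}
    (hjets : ∀ q ∈ D, ∀ q' ∈ D, |g q' - g q - l q (q' - q)| ≤ K * ‖q' - q‖ ^ 2)
    {q q' v : ℝ × ℝ × ℝ × ℝ} {s t η : ℝ} (hv : ‖v‖ ≤ 1) (hK : 0 ≤ K)
    (hs : |s| = t) (hq : q ∈ D) (hq' : q' ∈ D)
    (hqs : q + s • v ∈ D) (hqs' : q' + s • v ∈ D) (h1 : |g q - g q'| ≤ η / 2)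
    (h2 : |g (q + s • v) - g (q' + s • v)| ≤ η / 2) :
    |l q v - l q' v| * t ≤ η + 2 * K * t ^ 2 := by
  have j1 := hjets q hq _ hqs
  have j2 := hjets q' hq' _ hqs'
  have e : ‖s • v‖ ^ 2 ≤ t ^ 2 := by
    rw [norm_smul, Real.norm_eq_abs, hs]
    have : 0 ≤ t := hs ▸ abs_nonneg s
    gcongr
    nlinarith
  simp only [add_sub_cancel_left, map_smul, smul_eq_mul] at j1 j2
  have j1' := j1.trans (mul_le_mul_of_nonneg_left e hK)
  have j2' := j2.trans (mul_le_mul_of_nonneg_left e hK)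
  rw [← hs, ← abs_mul, hs]
  rw [abs_le] at *
  constructor <;> linarith [j1'.1, j1'.2, j2'.1, j2'.2, h1.1, h1.2, h2.1, h2.2]

theorem exists_lt_dist_of_nhdsWithin {Z : Type*} [PseudoMetricSpace Z] (s : Set Z) (x : Z) {d : ℝ}
    (hd : 0 < d) : ∃ u ∈ 𝓝[s] x, u ⊆ s ∧ ∀ z ∈ u, ∀ z' ∈ u, dist z z' < d := by
  refine ⟨Metric.ball x (d / 2) ∩ s, ?_, inter_subset_right, ?_⟩
  · exact Filter.inter_mem (nhdsWithin_le_nhds (Metric.ball_mem_nhds x (by positivity)))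
      self_mem_nhdsWithin
  · rintro z ⟨hz, -⟩ z' ⟨hz', -⟩
    rw [Metric.mem_ball] at hz hz'
    linarith [dist_triangle_right z z' x]

theorem dist_coord (z z' : ℝ × ℝ × ℝ × ℝ) : |z.1 - z'.1| ≤ dist z z' ∧
    |z.2.1 - z'.2.1| ≤ dist z z' ∧ |z.2.2.1 - z'.2.2.1| ≤ dist z z' ∧
    |z.2.2.2 - z'.2.2.2| ≤ dist z z' := by
  simp only [Prod.dist_eq, Real.dist_eq]
  refine ⟨le_max_left _ _, ?_, ?_, ?_⟩
  · exact (le_max_left _ _).trans (le_max_right _ _)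
  · exact (le_max_left _ _).trans ((le_max_right _ _).trans (le_max_right _ _))
  · exact (le_max_right _ _).trans ((le_max_right _ _).trans (le_max_right _ _))

end

theorem clm_eq_sum (l : ℝ × ℝ × ℝ × ℝ →L[ℝ] ℝ) :
    l = l (1, 0, 0, 0) • ContinuousLinearMap.fst ℝ ℝ (ℝ × ℝ × ℝ)
      + l (0, 1, 0, 0) • (ContinuousLinearMap.fst ℝ ℝ (ℝ × ℝ)).comp
          (ContinuousLinearMap.snd ℝ ℝ (ℝ × ℝ × ℝ))
      + l (0, 0, 1, 0) • ((ContinuousLinearMap.fst ℝ ℝ ℝ).comp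
          (ContinuousLinearMap.snd ℝ ℝ (ℝ × ℝ))).comp (ContinuousLinearMap.snd ℝ ℝ (ℝ × ℝ × ℝ))
      + l (0, 0, 0, 1) • ((ContinuousLinearMap.snd ℝ ℝ ℝ).comp
          (ContinuousLinearMap.snd ℝ ℝ (ℝ × ℝ))).comp
          (ContinuousLinearMap.snd ℝ ℝ (ℝ × ℝ × ℝ)) := by
  ext <;> simp <;> rfl

theorem exists_tendsto_clm {Z : Type*} {F : Filter Z} {φ : Z → (ℝ × ℝ × ℝ × ℝ →L[ℝ] ℝ)}
    (h1 : ∃ x, Filter.Tendsto (fun z => φ z (1, 0, 0, 0)) F (𝓝 x))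
    (h2 : ∃ x, Filter.Tendsto (fun z => φ z (0, 1, 0, 0)) F (𝓝 x))
    (h3 : ∃ x, Filter.Tendsto (fun z => φ z (0, 0, 1, 0)) F (𝓝 x))
    (h4 : ∃ x, Filter.Tendsto (fun z => φ z (0, 0, 0, 1)) F (𝓝 x)) :
    ∃ l, Filter.Tendsto φ F (𝓝 l) := by
  obtain ⟨x1, h1⟩ := h1
  obtain ⟨x2, h2⟩ := h2
  obtain ⟨x3, h3⟩ := h3
  obtain ⟨x4, h4⟩ := h4
  refine ⟨_, Filter.Tendsto.congr (fun z => (clm_eq_sum (φ z)).symm)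
    ((((h1.smul_const _).add (h2.smul_const _)).add (h3.smul_const _)).add (h4.smul_const _))⟩

/-- A function on an open convex set which, together with its derivative, has limits at the
closure, extends to a `C¹` function on the closure. -/
theorem contDiffOn_extendFrom {s : Set (ℝ × ℝ × ℝ × ℝ)} {F : ℝ × ℝ × ℝ × ℝ → ℝ} (hs : IsOpen s)
    (hc : Convex ℝ s) (hd : DifferentiableOn ℝ F s)
    (h0 : ∀ x ∈ closure s, ∃ y, Filter.Tendsto F (𝓝[s] x) (𝓝 y))
    (h1 : ∀ x ∈ closure s, ∃ y, Filter.Tendsto (fderiv ℝ F) (𝓝[s] x) (𝓝 y)) :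
    ContDiffOn ℝ 1 (extendFrom s F) (closure s) := by
  have hcont : ContinuousOn (extendFrom s F) (closure s) := continuousOn_extendFrom subset_rfl h0
  have hcont' : ContinuousOn (extendFrom s (fderiv ℝ F)) (closure s) :=
    continuousOn_extendFrom subset_rfl h1
  have heq : ∀ x ∈ s, extendFrom s F x = F x := fun x hx =>
    extendFrom_eq (subset_closure hx) ((hd.continuousOn x hx).tendsto)
  have hev : ∀ x ∈ s, extendFrom s F =ᶠ[𝓝 x] F := fun x hx => by
    filter_upwards [hs.mem_nhds hx] with y hy using heq y hy
  have hfd : ∀ x ∈ s, fderiv ℝ (extendFrom s F) x = fderiv ℝ F x := fun x hx =>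
    (hev x hx).fderiv_eq
  have hder : ∀ x ∈ closure s,
      HasFDerivWithinAt (extendFrom s F) (extendFrom s (fderiv ℝ F) x) (closure s) x := by
    intro x hx
    -- By the mean value inequality on a convex open set, the limit of the derivatives at a boundary
    -- point is the derivative there.
    refine hasFDerivWithinAt_closure_of_tendsto_fderiv (fun y hy => ?_) hc hs
      (fun y hy => (hcont y hy).mono subset_closure) ?_
    · exact ((hev y hy).differentiableAt_iff.2
        ((hd y hy).differentiableAt (hs.mem_nhds hy))).differentiableWithinAt
    · obtain ⟨y, hy⟩ := h1 x hx
      rw [extendFrom_eq hx hy]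
      refine hy.congr' ?_
      filter_upwards [self_mem_nhdsWithin] with z hz using (hfd z hz).symm
  have h01 : (1 : WithTop ℕ∞) = 0 + 1 := by norm_num
  rw [h01]
  intro x hx
  rw [contDiffWithinAt_succ_iff_hasFDerivWithinAt (by simp)]
  refine ⟨closure s, ?_, by simp, _, hder, ?_⟩
  · rw [insert_eq_of_mem hx]; exact self_mem_nhdsWithin
  · exact (contDiffOn_zero.2 hcont') x hx

section

variable {R κ T ν L K C : ℝ} {g : ℝ × ℝ × ℝ × ℝ → ℝ}
  {l : ℝ × ℝ × ℝ × ℝ → (ℝ × ℝ × ℝ × ℝ →L[ℝ] ℝ)}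

/-- A `C^{1,1}` function of `(r, e, m, log h)` whose derivative with respect to `log h` is
`O(h²)` extends to a `C¹` function of `(r, e, m, h)` up to `h = 0`. -/
theorem exists_contDiffOn_extension (hR : 0 < R) (hκ : 0 < κ) (hν : 0 < ν) (hT : Real.log ν < T)
    (hC : 0 ≤ C) (hK : 0 ≤ K) (hL : 0 ≤ L)
    (hlip : ∀ q ∈ logBox R κ T, ∀ q' ∈ logBox R κ T, |g q' - g q| ≤ L * ‖q' - q‖)
    (hjets : ∀ q ∈ logBox R κ T, ∀ q' ∈ logBox R κ T,
      |g q' - g q - l q (q' - q)| ≤ K * ‖q' - q‖ ^ 2)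
    (hk : ∀ q ∈ logBox R κ T, Real.exp q.2.2.2 ≤ ν →
      |l q (0, 0, 0, 1)| ≤ C * Real.exp q.2.2.2 ^ 2) :
    ∃ f : ℝ × ℝ × ℝ × ℝ → ℝ,
      ContDiffOn ℝ 1 f (Icc 0 R ×ˢ Icc 0 1 ×ˢ Icc (-κ) κ ×ˢ Icc 0 ν) ∧
      ∀ r ∈ Icc 0 R, ∀ e ∈ Icc (0 : ℝ) 1, ∀ m ∈ Icc (-κ) κ, ∀ h ∈ Ioc 0 ν,
        f (r, e, m, h) = g (r, e, m, Real.log h) := by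
  set s : Set (ℝ × ℝ × ℝ × ℝ) := Ioo 0 R ×ˢ Ioo 0 1 ×ˢ Ioo (-κ) κ ×ˢ Ioo 0 ν with hs_def
  have hs : IsOpen s := isOpen_Ioo.prod (isOpen_Ioo.prod (isOpen_Ioo.prod isOpen_Ioo))
  have hsc : Convex ℝ s :=
    (convex_Ioo _ _).prod ((convex_Ioo _ _).prod ((convex_Ioo _ _).prod (convex_Ioo _ _)))
  have hcl : closure s = Icc 0 R ×ˢ Icc 0 1 ×ˢ Icc (-κ) κ ×ˢ Icc 0 ν := by
    rw [hs_def, closure_prod_eq, closure_prod_eq, closure_prod_eq, closure_Ioo hR.ne,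
      closure_Ioo zero_ne_one, closure_Ioo (by linarith), closure_Ioo hν.ne]
  set Λ : ℝ × ℝ × ℝ × ℝ → ℝ × ℝ × ℝ × ℝ := fun z => (z.1, z.2.1, z.2.2.1, Real.log z.2.2.2)
    with hΛ
  have hΛD : ∀ z : ℝ × ℝ × ℝ × ℝ, z.1 ∈ Icc 0 R → z.2.1 ∈ Icc (0 : ℝ) 1 → z.2.2.1 ∈ Icc (-κ) κ →
      z.2.2.2 ∈ Ioc 0 ν → Λ z ∈ logBox R κ T := fun z h1 h2 h3 h4 =>
    ⟨h1, h2, h3, (Real.log_le_log h4.1 h4.2).trans hT.le⟩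
  have hsD : ∀ z ∈ s, z.1 ∈ Icc 0 R ∧ z.2.1 ∈ Icc (0 : ℝ) 1 ∧ z.2.2.1 ∈ Icc (-κ) κ ∧
      z.2.2.2 ∈ Ioc 0 ν := fun z hz =>
    ⟨Ioo_subset_Icc_self hz.1, Ioo_subset_Icc_self hz.2.1, Ioo_subset_Icc_self hz.2.2.1,
      Ioo_subset_Ioc_self hz.2.2.2⟩
  -- In the true variable `h` the function is Lipschitz although `log h` is unbounded: `(r, e, m)`
  -- is changed at fixed `h` by `hlip`, then `h` by `lipschitz_in_step`.
  have hbound : ∀ z z' : ℝ × ℝ × ℝ × ℝ, z.1 ∈ Icc 0 R → z.2.1 ∈ Icc (0 : ℝ) 1 →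
      z.2.2.1 ∈ Icc (-κ) κ → z.2.2.2 ∈ Ioc 0 ν → z'.1 ∈ Icc 0 R → z'.2.1 ∈ Icc (0 : ℝ) 1 →
      z'.2.2.1 ∈ Icc (-κ) κ → z'.2.2.2 ∈ Ioc 0 ν →
      |g (Λ z) - g (Λ z')| ≤ (L + C * ν) * dist z z' := by
    intro z z' h1 h2 h3 h4 h1' h2' h3' h4'
    obtain ⟨d1, d2, d3, d4⟩ := dist_coord z z'
    have i1 := hlip (z'.1, z'.2.1, z'.2.2.1, Real.log z.2.2.2)
      (hΛD (z'.1, z'.2.1, z'.2.2.1, z.2.2.2) h1' h2' h3' h4) (Λ z) (hΛD z h1 h2 h3 h4)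
    have i2 := lipschitz_in_step hT.le hC hjets hk h1' h2' h3' h4' h4
    have i3 : ‖Λ z - (z'.1, z'.2.1, z'.2.2.1, Real.log z.2.2.2)‖ ≤ dist z z' := by
      simp only [hΛ, Prod.mk_sub_mk, Prod.norm_mk, sub_self, norm_zero, Real.norm_eq_abs]
      exact max_le d1 (max_le d2 (max_le d3 dist_nonneg))
    have i4 : |g (Λ z) - g (z'.1, z'.2.1, z'.2.2.1, Real.log z.2.2.2)| ≤ L * dist z z' :=
      i1.trans (by gcongr)
    have i5 : |g (z'.1, z'.2.1, z'.2.2.1, Real.log z.2.2.2) - g (Λ z')| ≤ C * ν * dist z z' :=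
      i2.trans (by gcongr)
    calc _ = |(g (Λ z) - g (z'.1, z'.2.1, z'.2.2.1, Real.log z.2.2.2))
          + (g (z'.1, z'.2.1, z'.2.2.1, Real.log z.2.2.2) - g (Λ z'))| := by congr 1; ring
      _ ≤ L * dist z z' + C * ν * dist z z' := (abs_add_le _ _).trans (by gcongr)
      _ = _ := by ring
  have hF : ∀ z ∈ s, HasFDerivAt (fun z => g (Λ z)) ((l (Λ z)).comp
      ((ContinuousLinearMap.fst ℝ ℝ (ℝ × ℝ × ℝ)).prod
        (((ContinuousLinearMap.fst ℝ ℝ (ℝ × ℝ)).comp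
          (ContinuousLinearMap.snd ℝ ℝ (ℝ × ℝ × ℝ))).prod
        ((((ContinuousLinearMap.fst ℝ ℝ ℝ).comp (ContinuousLinearMap.snd ℝ ℝ (ℝ × ℝ))).comp
          (ContinuousLinearMap.snd ℝ ℝ (ℝ × ℝ × ℝ))).prod
        (z.2.2.2⁻¹ • (((ContinuousLinearMap.snd ℝ ℝ ℝ).comp
          (ContinuousLinearMap.snd ℝ ℝ (ℝ × ℝ))).comp
          (ContinuousLinearMap.snd ℝ ℝ (ℝ × ℝ × ℝ)))))))) z := by
    intro z hz
    have h4 := hz.2.2.2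
    have hD : logBox R κ T ∈ 𝓝 (Λ z) := by
      refine prod_mem_nhds (Icc_mem_nhds hz.1.1 hz.1.2) (prod_mem_nhds
        (Icc_mem_nhds hz.2.1.1 hz.2.1.2) (prod_mem_nhds (Icc_mem_nhds hz.2.2.1.1 hz.2.2.1.2)
        (Iic_mem_nhds ((Real.log_lt_log h4.1 h4.2).trans hT))))
    have h1 := (hasFDerivWithinAt_of_jets (hjets _ (mem_of_mem_nhds hD))).hasFDerivAt hD
    refine h1.comp z (HasFDerivAt.prodMk ?_ (HasFDerivAt.prodMk ?_ (HasFDerivAt.prodMk ?_ ?_)))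
    · exact hasFDerivAt_fst
    · exact (hasFDerivAt_fst (p := z.2)).comp z hasFDerivAt_snd
    · exact ((ContinuousLinearMap.fst ℝ ℝ ℝ).comp (ContinuousLinearMap.snd ℝ ℝ (ℝ × ℝ))).comp
          (ContinuousLinearMap.snd ℝ ℝ (ℝ × ℝ × ℝ)) |>.hasFDerivAt
    · exact (((ContinuousLinearMap.snd ℝ ℝ ℝ).comp (ContinuousLinearMap.snd ℝ ℝ (ℝ × ℝ))).comp
          (ContinuousLinearMap.snd ℝ ℝ (ℝ × ℝ × ℝ))).hasFDerivAt.log h4.1.ne'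
  have hfd : ∀ v, ∀ z ∈ s, fderiv ℝ (fun z => g (Λ z)) z v =
      l (Λ z) (v.1, v.2.1, v.2.2.1, z.2.2.2⁻¹ * v.2.2.2) := by
    intro v z hz
    rw [(hF z hz).fderiv]
    rfl
  refine ⟨extendFrom s (fun z => g (Λ z)), ?_, ?_⟩
  swap
  · intro r hr e he m hm h hh
    have hx : (r, e, m, h) ∈ closure s := by
      rw [hcl]; exact ⟨hr, he, hm, Ioc_subset_Icc_self hh⟩
    refine extendFrom_eq hx ?_
    rw [tendsto_iff_dist_tendsto_zero]
    have h0 : Filter.Tendsto (fun z => (L + C * ν) * dist z (r, e, m, h)) (𝓝[s] (r, e, m, h))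
        (𝓝 0) := by
      have h1 : Filter.Tendsto (fun z : ℝ × ℝ × ℝ × ℝ => (L + C * ν) * dist z (r, e, m, h))
          (𝓝 (r, e, m, h)) (𝓝 ((L + C * ν) * dist (r, e, m, h) (r, e, m, h))) :=
        (continuous_const.mul (continuous_id.dist continuous_const)).tendsto _
      rw [dist_self, mul_zero] at h1
      exact h1.mono_left nhdsWithin_le_nhds
    refine squeeze_zero' (Filter.Eventually.of_forall fun _ => dist_nonneg) ?_ h0
    filter_upwards [self_mem_nhdsWithin] with z hz
    obtain ⟨a1, a2, a3, a4⟩ := hsD z hz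
    exact hbound z (r, e, m, h) a1 a2 a3 a4 hr he hm hh
  rw [← hcl]
  have hC' : 0 ≤ L + C * ν := by positivity
  refine contDiffOn_extendFrom hs hsc
    (fun z hz => (hF z hz).differentiableAt.differentiableWithinAt) ?_ ?_
  · intro x hx
    have : (𝓝[s] x).NeBot := mem_closure_iff_nhdsWithin_neBot.1 hx
    refine exists_tendsto_of_cauchy fun ε hε => ?_
    obtain ⟨u, hu, hus, hd⟩ := exists_lt_dist_of_nhdsWithin s x
      (d := ε / (L + C * ν + 1)) (by positivity)
    refine ⟨u, hu, fun z hz z' hz' => ?_⟩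
    obtain ⟨a1, a2, a3, a4⟩ := hsD z (hus hz)
    obtain ⟨b1, b2, b3, b4⟩ := hsD z' (hus hz')
    have h1 := hbound z z' a1 a2 a3 a4 b1 b2 b3 b4
    have h2 := hd z hz z' hz'
    rw [lt_div_iff₀ (by positivity)] at h2
    have := dist_nonneg (x := z) (y := z')
    nlinarith
  · intro x hx
    have : (𝓝[s] x).NeBot := mem_closure_iff_nhdsWithin_neBot.1 hx
    have hxb := hx
    rw [hcl] at hxb
    have hwithin : ∀ᶠ z in 𝓝[s] x, z ∈ s := self_mem_nhdsWithin
    -- Directions that leave `h` fixed: the shifted points have the same `h`, so closeness in `h`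
    -- itself, not in `log h`, is enough. This works up to `h = 0`.
    have hgen : ∀ v : ℝ × ℝ × ℝ × ℝ, ‖v‖ ≤ 1 → v.2.2.2 = 0 → ∀ t₀ > 0,
        (∀ t, 0 < t → t < t₀ → ∃ d > 0, ∀ z ∈ s, ∀ z' ∈ s, dist z z' < d →
          ∃ σ : ℝ, |σ| = t ∧ (z + σ • v).1 ∈ Icc 0 R ∧ (z + σ • v).2.1 ∈ Icc (0 : ℝ) 1 ∧
            (z + σ • v).2.2.1 ∈ Icc (-κ) κ ∧ (z' + σ • v).1 ∈ Icc 0 R ∧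
            (z' + σ • v).2.1 ∈ Icc (0 : ℝ) 1 ∧ (z' + σ • v).2.2.1 ∈ Icc (-κ) κ) →
        ∃ y, Filter.Tendsto (fun z => l (Λ z) v) (𝓝[s] x) (𝓝 y) := by
      intro v hv hv4 t₀ ht₀ hsig
      refine exists_tendsto_of_difference_quotients hK ht₀ fun t ht htt η hη => ?_
      obtain ⟨d, hd, hσ⟩ := hsig t ht htt
      obtain ⟨u, hu, hus, hud⟩ := exists_lt_dist_of_nhdsWithin s x
        (d := min d (η / 2 / (L + C * ν + 1))) (by positivity)
      refine ⟨u, hu, fun z hz z' hz' => ?_⟩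
      have hdist := hud z hz z' hz'
      obtain ⟨σ, hσt, b1, b2, b3, b1', b2', b3'⟩ := hσ z (hus hz) z' (hus hz')
        (hdist.trans_le (min_le_left _ _))
      have hdist2 := hdist.trans_le (min_le_right _ _)
      obtain ⟨a1, a2, a3, a4⟩ := hsD z (hus hz)
      obtain ⟨a1', a2', a3', a4'⟩ := hsD z' (hus hz')
      have hz4 : (z + σ • v).2.2.2 = z.2.2.2 := by simp [hv4]
      have hz4' : (z' + σ • v).2.2.2 = z'.2.2.2 := by simp [hv4]
      have e1 : ∀ w : ℝ × ℝ × ℝ × ℝ, Λ (w + σ • v) = Λ w + σ • v := by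
        intro w
        simp only [hΛ]
        ext <;> simp [hv4]
      have c4 : (z + σ • v).2.2.2 ∈ Ioc 0 ν := hz4 ▸ a4
      have c4' : (z' + σ • v).2.2.2 ∈ Ioc 0 ν := hz4' ▸ a4'
      have h1 := hbound z z' a1 a2 a3 a4 a1' a2' a3' a4'
      have h2 := hbound _ _ b1 b2 b3 c4 b1' b2' b3' c4'
      have h3 := hΛD _ b1 b2 b3 c4
      have h3' := hΛD _ b1' b2' b3' c4'
      rw [dist_add_right] at h2
      rw [e1] at h3 h3'
      rw [e1, e1] at h2
      have hsmall : (L + C * ν) * dist z z' ≤ η / 2 := by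
        rw [lt_div_iff₀ (by positivity)] at hdist2
        have := dist_nonneg (x := z) (y := z')
        nlinarith
      exact jet_difference hjets hv hK hσt (hΛD z a1 a2 a3 a4) (hΛD z' a1' a2' a3' a4') h3 h3'
        (h1.trans hsmall) (h2.trans hsmall)
    have hcongr : ∀ v : ℝ × ℝ × ℝ × ℝ, v.2.2.2 = 0 →
        (∃ y, Filter.Tendsto (fun z => l (Λ z) v) (𝓝[s] x) (𝓝 y)) →
        ∃ y, Filter.Tendsto (fun z => fderiv ℝ (fun z => g (Λ z)) z v) (𝓝[s] x) (𝓝 y) := by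
      rintro v hv ⟨y, hy⟩
      refine ⟨y, hy.congr' ?_⟩
      filter_upwards [hwithin] with z hz
      rw [hfd v z hz, hv, mul_zero, ← hv]
    refine exists_tendsto_clm ?_ ?_ ?_ ?_
    · refine hcongr _ rfl (hgen _ (by simp [Prod.norm_mk]) rfl (R / 4) (by positivity) ?_)
      intro t ht htt
      refine ⟨R / 4, by positivity, fun z hz z' hz' hd => ?_⟩
      obtain ⟨a1, a2, a3, a4⟩ := hsD z hz
      obtain ⟨a1', a2', a3', a4'⟩ := hsD z' hz'
      obtain ⟨σ, h1, h2, h3⟩ := shift_sign a1 a1' ((dist_coord z z').1.trans hd.le) ht.le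
        (by linarith)
      exact ⟨σ, h1, by simpa using h2, by simpa using a2, by simpa using a3, by simpa using h3,
        by simpa using a2', by simpa using a3'⟩
    · refine hcongr _ rfl (hgen _ (by simp [Prod.norm_mk]) rfl (1 / 4) (by positivity) ?_)
      intro t ht htt
      refine ⟨1 / 4, by positivity, fun z hz z' hz' hd => ?_⟩
      obtain ⟨a1, a2, a3, a4⟩ := hsD z hz
      obtain ⟨a1', a2', a3', a4'⟩ := hsD z' hz'
      obtain ⟨σ, h1, h2, h3⟩ := shift_sign a2 a2' ((dist_coord z z').2.1.trans hd.le) ht.le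
        (by linarith)
      exact ⟨σ, h1, by simpa using a1, by simpa using h2, by simpa using a3, by simpa using a1',
        by simpa using h3, by simpa using a3'⟩
    · refine hcongr _ rfl (hgen _ (by simp [Prod.norm_mk]) rfl (κ / 4) (by positivity) ?_)
      intro t ht htt
      refine ⟨κ / 4, by positivity, fun z hz z' hz' hd => ?_⟩
      obtain ⟨a1, a2, a3, a4⟩ := hsD z hz
      obtain ⟨a1', a2', a3', a4'⟩ := hsD z' hz'
      obtain ⟨σ, h1, h2, h3⟩ := shift_sign a3 a3' ((dist_coord z z').2.2.1.trans hd.le) ht.le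
        (by linarith)
      exact ⟨σ, h1, by simpa using a1, by simpa using a2, by simpa using h2, by simpa using a1',
        by simpa using a2', by simpa using h3⟩
    · have hform : ∀ z ∈ s, fderiv ℝ (fun z => g (Λ z)) z (0, 0, 0, 1) =
          z.2.2.2⁻¹ * l (Λ z) (0, 0, 0, 1) := by
        intro z hz
        rw [hfd _ z hz]
        have : ((0, 0, 0, z.2.2.2⁻¹ * 1) : ℝ × ℝ × ℝ × ℝ) = z.2.2.2⁻¹ • (0, 0, 0, 1) := by simp
        simp only
        rw [this, map_smul, smul_eq_mul]
      have hcont4 : Filter.Tendsto (fun z : ℝ × ℝ × ℝ × ℝ => z.2.2.2) (𝓝[s] x) (𝓝 x.2.2.2) :=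
        ((continuous_snd.comp (continuous_snd.comp continuous_snd)).tendsto x).mono_left
          nhdsWithin_le_nhds
      -- At `h = 0` the derivative in `h` is squeezed to `0` by `C h`. At positive `h` the logarithm
      -- is continuous, and the limit comes from difference quotients in `log h`.
      rcases hxb.2.2.2.1.eq_or_lt with h0 | h0
      · refine ⟨0, ?_⟩
        have hz0 : Filter.Tendsto (fun z : ℝ × ℝ × ℝ × ℝ => C * z.2.2.2) (𝓝[s] x) (𝓝 0) := by
          have := hcont4.const_mul C
          rwa [← h0, mul_zero] at this
        rw [tendsto_zero_iff_abs_tendsto_zero]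
        refine squeeze_zero' (Filter.Eventually.of_forall fun _ => abs_nonneg _) ?_ hz0
        filter_upwards [hwithin] with z hz
        obtain ⟨a1, a2, a3, a4⟩ := hsD z hz
        have h1 := hk _ (hΛD z a1 a2 a3 a4) (by
          simp only [hΛ]; rw [Real.exp_log a4.1]; exact a4.2)
        simp only [Function.comp]
        rw [hform z hz, abs_mul, abs_of_pos (inv_pos.2 a4.1)]
        simp only [hΛ, Real.exp_log a4.1] at h1 ⊢
        calc _ ≤ z.2.2.2⁻¹ * (C * z.2.2.2 ^ 2) := by
              have := inv_pos.2 a4.1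
              gcongr
          _ = C * z.2.2.2 := by field_simp [a4.1.ne']
      · have hΛc : Filter.Tendsto Λ (𝓝[s] x) (𝓝 (Λ x)) := by
          have : ContinuousAt Λ x := by
            refine ContinuousAt.prodMk (by fun_prop) (ContinuousAt.prodMk (by fun_prop)
              (ContinuousAt.prodMk (by fun_prop) ?_))
            exact ContinuousAt.log (by fun_prop) h0.ne'
          exact this.tendsto.mono_left nhdsWithin_le_nhds
        have hlim : ∃ y, Filter.Tendsto (fun z => l (Λ z) (0, 0, 0, 1)) (𝓝[s] x) (𝓝 y) := by
          refine exists_tendsto_of_difference_quotients hK one_pos fun t ht htt η hη => ?_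
          refine ⟨s ∩ Λ ⁻¹' Metric.ball (Λ x) (η / (4 * (L + 1))), ?_, ?_⟩
          · exact Filter.inter_mem self_mem_nhdsWithin
              (hΛc (Metric.ball_mem_nhds _ (by positivity)))
          rintro z ⟨hz, hzb⟩ z' ⟨hz', hzb'⟩
          obtain ⟨a1, a2, a3, a4⟩ := hsD z hz
          obtain ⟨a1', a2', a3', a4'⟩ := hsD z' hz'
          have hD := hΛD z a1 a2 a3 a4
          have hD' := hΛD z' a1' a2' a3' a4'
          -- The last factor of `logBox` is unbounded below, so a downward shift of `log h` is
          -- always allowed.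
          have hsh : ∀ w ∈ logBox R κ T, w + (-t) • ((0, 0, 0, 1) : ℝ × ℝ × ℝ × ℝ) ∈
              logBox R κ T := by
            rintro w ⟨w1, w2, w3, w4⟩
            refine ⟨by simpa using w1, by simpa using w2, by simpa using w3, ?_⟩
            simp only [mem_Iic] at w4
            simp
            linarith
          have hdist : ‖Λ z - Λ z'‖ ≤ η / (2 * (L + 1)) := by
            rw [← dist_eq_norm]
            simp only [mem_preimage, Metric.mem_ball] at hzb hzb'
            have h1 := dist_triangle_right (Λ z) (Λ z') (Λ x)
            have h2 : η / (2 * (L + 1)) = η / (4 * (L + 1)) + η / (4 * (L + 1)) := by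
              field_simp; norm_num
            linarith
          have hsmall : L * (η / (2 * (L + 1))) ≤ η / 2 := by
            rw [mul_div_assoc', div_le_div_iff₀ (by positivity) (by positivity)]
            nlinarith
          refine jet_difference hjets (s := -t) (by simp [Prod.norm_mk]) hK
            (by rw [abs_neg, abs_of_pos ht]) hD hD' (hsh _ hD) (hsh _ hD') ?_ ?_
          · exact (hlip _ hD' _ hD).trans (le_trans (by gcongr) hsmall)
          · refine (hlip _ (hsh _ hD') _ (hsh _ hD)).trans (le_trans ?_ hsmall)
            rw [add_sub_add_right_eq_sub]
            gcongr
        obtain ⟨y, hy⟩ := hlim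
        refine ⟨x.2.2.2⁻¹ * y, ((hcont4.inv₀ h0.ne').mul hy).congr' ?_⟩
        filter_upwards [hwithin] with z hz using (hform z hz).symm

end

/-! ### Weighted Taylor expansions and schemes of second order -/

/-- The derivative in the direction of the fibre variable `x` of `(x, r, e, m)`. -/
noncomputable def dX (f : ℝ × ℝ × ℝ × ℝ → ℝ) : ℝ × ℝ × ℝ × ℝ → ℝ :=
  fun w => fderiv ℝ f w (1, 0, 0, 0)

/-- The derivative of `s ↦ e^s f (x, e^s r, e^{-2s} e, e^{-s} m)` at `s = 0`. -/
noncomputable def dU (f : ℝ × ℝ × ℝ × ℝ → ℝ) : ℝ × ℝ × ℝ × ℝ → ℝ :=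
  fun w => f w + fderiv ℝ f w (0, w.2.1, -2 * w.2.2.1, -w.2.2.2)

/-- The derivative of `f`, weighted as a coefficient of the step size, along the field with
components `X` and `Y` in the fibre and in the scaling direction. -/
noncomputable def fieldDeriv (X Y f : ℝ × ℝ × ℝ × ℝ → ℝ) : ℝ × ℝ × ℝ × ℝ → ℝ :=
  fun w => X w * dX f w + Y w * dU f w

theorem contDiff_dX {f : ℝ × ℝ × ℝ × ℝ → ℝ} (hf : ContDiff ℝ ∞ f) : ContDiff ℝ ∞ (dX f) :=
  (hf.fderiv_right (m := ∞) (by simp)).clm_apply contDiff_const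

theorem contDiff_dU {f : ℝ × ℝ × ℝ × ℝ → ℝ} (hf : ContDiff ℝ ∞ f) : ContDiff ℝ ∞ (dU f) :=
  hf.add ((hf.fderiv_right (m := ∞) (by simp)).clm_apply (by fun_prop))

theorem contDiff_fieldDeriv {X Y f : ℝ × ℝ × ℝ × ℝ → ℝ} (hX : ContDiff ℝ ∞ X)
    (hY : ContDiff ℝ ∞ Y) (hf : ContDiff ℝ ∞ f) : ContDiff ℝ ∞ (fieldDeriv X Y f) :=
  (hX.mul (contDiff_dX hf)).add (hY.mul (contDiff_dU hf))

/-- The point `(x, y)` moved by `P` in the fibre and by the scaling `e^S` in the base. -/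
noncomputable def moved (P S : ℝ) (w : ℝ × ℝ × ℝ × ℝ) : ℝ × ℝ × ℝ × ℝ :=
  (w.1 + P, Real.exp S * w.2.1, Real.exp (-2 * S) * w.2.2.1, Real.exp (-S) * w.2.2.2)

/-- The weighted value of `g` along the straight path from `w` to `moved P S w`. -/
noncomputable def pathVal (g : ℝ × ℝ × ℝ × ℝ → ℝ) (P S : ℝ) (w : ℝ × ℝ × ℝ × ℝ) (t : ℝ) : ℝ :=
  Real.exp (t * S) * g (moved (t * P) (t * S) w)

/-- The weight `e^S` is the factor by which `h` grows in the step. With it built in, `dX` and `dU`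
reproduce the form of `pathVal`, so that Taylor's formula follows by iteration. -/
theorem hasDerivAt_pathVal {g : ℝ × ℝ × ℝ × ℝ → ℝ} (hg : ContDiff ℝ ∞ g) (P S : ℝ)
    (w : ℝ × ℝ × ℝ × ℝ) (t : ℝ) :
    HasDerivAt (pathVal g P S w) (P * pathVal (dX g) P S w t + S * pathVal (dU g) P S w t) t := by
  have hS : HasDerivAt (fun t : ℝ => t * S) S t := by simpa using (hasDerivAt_id t).mul_const S
  have hP : HasDerivAt (fun t : ℝ => t * P) P t := by simpa using (hasDerivAt_id t).mul_const P
  have hm : HasDerivAt (fun t => moved (t * P) (t * S) w)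
      ((P, Real.exp (t * S) * S * w.2.1, Real.exp (-2 * (t * S)) * (-2 * S) * w.2.2.1,
        Real.exp (-(t * S)) * (-S) * w.2.2.2)) t := by
    refine HasDerivAt.prodMk (hP.const_add _) (HasDerivAt.prodMk ?_ (HasDerivAt.prodMk ?_ ?_))
    · exact (hS.exp).mul_const _
    · exact ((hS.const_mul (-2)).exp).mul_const _
    · exact (hS.neg.exp).mul_const _
  have hgd := (hg.differentiable (by simp) (moved (t * P) (t * S) w)).hasFDerivAt
  have h := (hS.exp).mul (hgd.comp_hasDerivAt t hm)
  refine h.congr_deriv ?_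
  have e : ((P, Real.exp (t * S) * S * w.2.1, Real.exp (-2 * (t * S)) * (-2 * S) * w.2.2.1,
        Real.exp (-(t * S)) * (-S) * w.2.2.2) : ℝ × ℝ × ℝ × ℝ) =
      P • (1, 0, 0, 0) + S • (0, (moved (t * P) (t * S) w).2.1,
        -2 * (moved (t * P) (t * S) w).2.2.1, -(moved (t * P) (t * S) w).2.2.2) := by
    simp only [moved]
    ext <;> simp <;> ring
  simp only [pathVal, dX, dU, Function.comp_apply]
  rw [e, map_add, map_smul, map_smul, smul_eq_mul, smul_eq_mul]
  ring

theorem pathVal_zero (g : ℝ × ℝ × ℝ × ℝ → ℝ) (P S : ℝ) (w : ℝ × ℝ × ℝ × ℝ) :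
    pathVal g P S w 0 = g w := by
  simp [pathVal, moved]

theorem pathVal_one (g : ℝ × ℝ × ℝ × ℝ → ℝ) (P S : ℝ) (w : ℝ × ℝ × ℝ × ℝ) :
    pathVal g P S w 1 = Real.exp S * g (moved P S w) := by
  simp [pathVal]

theorem exists_pathVal_bound {g : ℝ × ℝ × ℝ × ℝ → ℝ} (hg : ContDiff ℝ ∞ g) (b : ℝ) :
    ∃ C, 0 ≤ C ∧ ∀ P S w, |P| ≤ b → |S| ≤ b → ‖w‖ ≤ b → ∀ t ∈ Icc (0 : ℝ) 1,
      |pathVal g P S w t| ≤ C := by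
  have hc : Continuous fun z : ℝ × ℝ × (ℝ × ℝ × ℝ × ℝ) × ℝ =>
      pathVal g z.1 z.2.1 z.2.2.1 z.2.2.2 := by
    have := hg.continuous
    simp only [pathVal, moved]
    fun_prop
  obtain ⟨C, hC⟩ := (isCompact_Icc.prod (isCompact_Icc.prod
    ((isCompact_closedBall (0 : ℝ × ℝ × ℝ × ℝ) b).prod isCompact_Icc))).exists_bound_of_continuousOn
      (s := Icc (-b) b ×ˢ Icc (-b) b ×ˢ Metric.closedBall 0 b ×ˢ Icc (0 : ℝ) 1) hc.continuousOn
  refine ⟨max C 0, le_max_right _ _, fun P S w hP hS hw t ht => ?_⟩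
  exact (hC (P, S, w, t) ⟨abs_le.1 hP, abs_le.1 hS, by simpa using hw, ht⟩).trans (le_max_left _ _)

theorem abs_sub_le_of_deriv_bound {ψ ψ' : ℝ → ℝ} {C : ℝ} (h : ∀ t, HasDerivAt ψ (ψ' t) t)
    (hC : ∀ t ∈ Icc (0 : ℝ) 1, |ψ' t| ≤ C) (h0 : ψ 0 = 0) : ∀ t ∈ Icc (0 : ℝ) 1, |ψ t| ≤ C := by
  intro t ht
  have h1 := (convex_Icc (0 : ℝ) 1).norm_image_sub_le_of_norm_hasDerivWithin_le
    (fun y _ => (h y).hasDerivWithinAt) hC (left_mem_Icc.2 zero_le_one) ht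
  have hC0 : 0 ≤ C := (abs_nonneg _).trans (hC t ht)
  rw [h0, sub_zero, sub_zero, Real.norm_eq_abs, Real.norm_eq_abs, abs_of_nonneg ht.1] at h1
  exact h1.trans (by nlinarith [ht.2])

/-- Each of the three expansions results from applying the preceding estimate to `dX g` and `dU g`
and integrating along the path. -/
theorem exists_pathVal_taylor₁ {g : ℝ × ℝ × ℝ × ℝ → ℝ} (hg : ContDiff ℝ ∞ g) (b : ℝ) :
    ∃ C, 0 ≤ C ∧ ∀ P S w, |P| ≤ b → |S| ≤ b → ‖w‖ ≤ b → ∀ t ∈ Icc (0 : ℝ) 1,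
      |pathVal g P S w t - g w| ≤ C * (|P| + |S|) := by
  obtain ⟨C₁, h₁, hC₁⟩ := exists_pathVal_bound (contDiff_dX hg) b
  obtain ⟨C₂, h₂, hC₂⟩ := exists_pathVal_bound (contDiff_dU hg) b
  refine ⟨C₁ + C₂, by positivity, fun P S w hP hS hw => ?_⟩
  refine abs_sub_le_of_deriv_bound (fun t => (hasDerivAt_pathVal hg P S w t).sub_const _)
    (fun t ht => ?_) (by rw [pathVal_zero, sub_self])
  refine (abs_add_le _ _).trans ?_
  rw [abs_mul, abs_mul]
  have i1 := hC₁ P S w hP hS hw t ht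
  have i2 := hC₂ P S w hP hS hw t ht
  calc _ ≤ |P| * C₁ + |S| * C₂ := by gcongr
    _ ≤ _ := by nlinarith [abs_nonneg P, abs_nonneg S]

theorem exists_pathVal_taylor₂ {g : ℝ × ℝ × ℝ × ℝ → ℝ} (hg : ContDiff ℝ ∞ g) (b : ℝ) :
    ∃ C, 0 ≤ C ∧ ∀ P S w, |P| ≤ b → |S| ≤ b → ‖w‖ ≤ b → ∀ t ∈ Icc (0 : ℝ) 1,
      |pathVal g P S w t - g w - t * (P * dX g w + S * dU g w)| ≤ C * (|P| + |S|) ^ 2 := by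
  obtain ⟨C₁, h₁, hC₁⟩ := exists_pathVal_taylor₁ (contDiff_dX hg) b
  obtain ⟨C₂, h₂, hC₂⟩ := exists_pathVal_taylor₁ (contDiff_dU hg) b
  refine ⟨C₁ + C₂, by positivity, fun P S w hP hS hw => ?_⟩
  refine abs_sub_le_of_deriv_bound (fun t => ((hasDerivAt_pathVal hg P S w t).sub_const _).sub
    ((hasDerivAt_id t).mul_const _)) (fun t ht => ?_) (by simp [pathVal_zero])
  have i1 := hC₁ P S w hP hS hw t ht
  have i2 := hC₂ P S w hP hS hw t ht
  calc _ = |P * (pathVal (dX g) P S w t - dX g w) + S * (pathVal (dU g) P S w t - dU g w)| := by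
        congr 1; ring
    _ ≤ |P| * (C₁ * (|P| + |S|)) + |S| * (C₂ * (|P| + |S|)) := by
        refine (abs_add_le _ _).trans ?_
        rw [abs_mul, abs_mul]
        gcongr
    _ ≤ _ := by
        have := abs_nonneg P
        have := abs_nonneg S
        have : 0 ≤ |P| * (C₂ * (|P| + |S|)) + |S| * (C₁ * (|P| + |S|)) := by positivity
        nlinarith

theorem exists_pathVal_taylor₃ {g : ℝ × ℝ × ℝ × ℝ → ℝ} (hg : ContDiff ℝ ∞ g) (b : ℝ) :
    ∃ C, 0 ≤ C ∧ ∀ P S w, |P| ≤ b → |S| ≤ b → ‖w‖ ≤ b → ∀ t ∈ Icc (0 : ℝ) 1,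
      |pathVal g P S w t - g w - t * (P * dX g w + S * dU g w)
        - t ^ 2 * ((P * (P * dX (dX g) w + S * dU (dX g) w)
          + S * (P * dX (dU g) w + S * dU (dU g) w)) / 2)| ≤ C * (|P| + |S|) ^ 3 := by
  obtain ⟨C₁, h₁, hC₁⟩ := exists_pathVal_taylor₂ (contDiff_dX hg) b
  obtain ⟨C₂, h₂, hC₂⟩ := exists_pathVal_taylor₂ (contDiff_dU hg) b
  refine ⟨C₁ + C₂, by positivity, fun P S w hP hS hw => ?_⟩
  refine abs_sub_le_of_deriv_bound (fun t => (((hasDerivAt_pathVal hg P S w t).sub_const _).sub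
    ((hasDerivAt_id t).mul_const _)).sub ((hasDerivAt_pow 2 t).mul_const _))
    (fun t ht => ?_) (by simp [pathVal_zero])
  have i1 := hC₁ P S w hP hS hw t ht
  have i2 := hC₂ P S w hP hS hw t ht
  calc _ = |P * (pathVal (dX g) P S w t - dX g w - t * (P * dX (dX g) w + S * dU (dX g) w))
          + S * (pathVal (dU g) P S w t - dU g w - t * (P * dX (dU g) w + S * dU (dU g) w))| := by
        congr 1; push_cast; ring
    _ ≤ |P| * (C₁ * (|P| + |S|) ^ 2) + |S| * (C₂ * (|P| + |S|) ^ 2) := by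
        refine (abs_add_le _ _).trans ?_
        rw [abs_mul, abs_mul]
        gcongr
    _ ≤ _ := by
        have := abs_nonneg P
        have := abs_nonneg S
        have : 0 ≤ |P| * (C₂ * (|P| + |S|) ^ 2) + |S| * (C₁ * (|P| + |S|) ^ 2) := by positivity
        nlinarith

theorem dX_fieldDeriv {X Y f : ℝ × ℝ × ℝ × ℝ → ℝ} (hX : ContDiff ℝ ∞ X)
    (hY : ContDiff ℝ ∞ Y) (hf : ContDiff ℝ ∞ f) (w : ℝ × ℝ × ℝ × ℝ) :
    dX (fieldDeriv X Y f) w = dX X w * dX f w + X w * dX (dX f) w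
      + (dX Y w * dU f w + Y w * dX (dU f) w) := by
  have d : ∀ {u : ℝ × ℝ × ℝ × ℝ → ℝ}, ContDiff ℝ ∞ u → DifferentiableAt ℝ u w :=
    fun hu => hu.differentiable (by simp) w
  have h1 : fieldDeriv X Y f = X * dX f + Y * dU f := rfl
  have h2 : ∀ u, dX u w = fderiv ℝ u w (1, 0, 0, 0) := fun _ => rfl
  rw [h2 (fieldDeriv X Y f), h2 X, h2 Y, h2 (dX f), h2 (dU f), h1,
    fderiv_add ((d hX).mul (d (contDiff_dX hf))) ((d hY).mul (d (contDiff_dU hf))),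
    fderiv_mul (d hX) (d (contDiff_dX hf)), fderiv_mul (d hY) (d (contDiff_dU hf))]
  simp
  ring

/-- Both factors of each product carry the weight one, so differentiating the factors separately
counts the weight of the product twice; hence the additional summand on the left. -/
theorem dU_fieldDeriv {X Y f : ℝ × ℝ × ℝ × ℝ → ℝ} (hX : ContDiff ℝ ∞ X)
    (hY : ContDiff ℝ ∞ Y) (hf : ContDiff ℝ ∞ f) (w : ℝ × ℝ × ℝ × ℝ) :
    dU (fieldDeriv X Y f) w + fieldDeriv X Y f w = dU X w * dX f w + X w * dU (dX f) w
      + (dU Y w * dU f w + Y w * dU (dU f) w) := by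
  have d : ∀ {u : ℝ × ℝ × ℝ × ℝ → ℝ}, ContDiff ℝ ∞ u → DifferentiableAt ℝ u w :=
    fun hu => hu.differentiable (by simp) w
  have h1 : fieldDeriv X Y f = X * dX f + Y * dU f := rfl
  have h2 : ∀ u, dU u w = u w + fderiv ℝ u w (0, w.2.1, -2 * w.2.2.1, -w.2.2.2) := fun _ => rfl
  rw [h2 (fieldDeriv X Y f), h2 X, h2 Y, h2 (dX f), h2 (dU f), h1,
    fderiv_add ((d hX).mul (d (contDiff_dX hf))) ((d hY).mul (d (contDiff_dU hf))),
    fderiv_mul (d hX) (d (contDiff_dX hf)), fderiv_mul (d hY) (d (contDiff_dU hf))]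
  simp
  ring

/-- Forget the step size `h` in `(x, r, e, m, h)`. -/
def forgetStep (w : ℝ × ℝ × ℝ × ℝ × ℝ) : ℝ × ℝ × ℝ × ℝ := (w.1, w.2.1, w.2.2.1, w.2.2.2.1)

/-- Increment of a backward scheme of second order for the field `(X, Y)` with remainder `R`. -/
noncomputable def schemeFun (X Y f : ℝ × ℝ × ℝ × ℝ → ℝ) (R : ℝ × ℝ × ℝ × ℝ × ℝ → ℝ)
    (w : ℝ × ℝ × ℝ × ℝ × ℝ) : ℝ :=
  -(w.2.2.2.2 * f (forgetStep w)) + w.2.2.2.2 ^ 2 * (fieldDeriv X Y f (forgetStep w) / 2)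
    + w.2.2.2.2 ^ 3 * R w

section

variable {X Y f : ℝ × ℝ × ℝ × ℝ → ℝ} {R RP RS : ℝ × ℝ × ℝ × ℝ × ℝ → ℝ}

theorem fderiv_schemeFun (hX : ContDiff ℝ ∞ X) (hY : ContDiff ℝ ∞ Y) (hf : ContDiff ℝ ∞ f)
    {w : ℝ × ℝ × ℝ × ℝ × ℝ} (hR : DifferentiableAt ℝ R w) (v : ℝ × ℝ × ℝ × ℝ × ℝ) :
    fderiv ℝ (schemeFun X Y f R) w v =
      -(v.2.2.2.2 * f (forgetStep w) + w.2.2.2.2 * fderiv ℝ f (forgetStep w) (forgetStep v))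
      + (w.2.2.2.2 * v.2.2.2.2 * fieldDeriv X Y f (forgetStep w)
        + w.2.2.2.2 ^ 2 * (fderiv ℝ (fieldDeriv X Y f) (forgetStep w) (forgetStep v) / 2))
      + (3 * w.2.2.2.2 ^ 2 * v.2.2.2.2 * R w + w.2.2.2.2 ^ 3 * fderiv ℝ R w v) := by
  have hF := contDiff_fieldDeriv hX hY hf
  set l : ℝ × ℝ × ℝ × ℝ × ℝ →L[ℝ] ℝ × ℝ × ℝ × ℝ :=
    (ContinuousLinearMap.fst ℝ ℝ (ℝ × ℝ × ℝ × ℝ)).prod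
      (((ContinuousLinearMap.fst ℝ ℝ (ℝ × ℝ × ℝ)).comp
        (ContinuousLinearMap.snd ℝ ℝ (ℝ × ℝ × ℝ × ℝ))).prod
      (((ContinuousLinearMap.fst ℝ ℝ (ℝ × ℝ)).comp ((ContinuousLinearMap.snd ℝ ℝ (ℝ × ℝ × ℝ)).comp
        (ContinuousLinearMap.snd ℝ ℝ (ℝ × ℝ × ℝ × ℝ)))).prod
      ((ContinuousLinearMap.fst ℝ ℝ ℝ).comp ((ContinuousLinearMap.snd ℝ ℝ (ℝ × ℝ)).comp
        ((ContinuousLinearMap.snd ℝ ℝ (ℝ × ℝ × ℝ)).comp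
        (ContinuousLinearMap.snd ℝ ℝ (ℝ × ℝ × ℝ × ℝ)))))))
  set lh : ℝ × ℝ × ℝ × ℝ × ℝ →L[ℝ] ℝ :=
    (ContinuousLinearMap.snd ℝ ℝ ℝ).comp ((ContinuousLinearMap.snd ℝ ℝ (ℝ × ℝ)).comp
        ((ContinuousLinearMap.snd ℝ ℝ (ℝ × ℝ × ℝ)).comp
        (ContinuousLinearMap.snd ℝ ℝ (ℝ × ℝ × ℝ × ℝ))))
  have hl : HasFDerivAt forgetStep l w := l.hasFDerivAt
  have hlh : HasFDerivAt (fun w : ℝ × ℝ × ℝ × ℝ × ℝ => w.2.2.2.2) lh w := lh.hasFDerivAt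
  have h1 := ((hf.differentiable (by simp) (forgetStep w)).hasFDerivAt).comp w hl
  have h2 := ((hF.differentiable (by simp) (forgetStep w)).hasFDerivAt).comp w hl
  have h3 := ((hlh.mul h1).neg.add ((hlh.pow 2).mul (h2.mul_const (1 / 2)))).add
    ((hlh.pow 3).mul hR.hasFDerivAt)
  have h4 : HasFDerivAt (schemeFun X Y f R) _ w := h3.congr_of_eventuallyEq
    (Filter.Eventually.of_forall fun z => by
      simp only [schemeFun, Pi.add_apply, Pi.mul_apply, Pi.neg_apply, Function.comp_apply]; ring)
  have e1 : l v = forgetStep v := rfl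
  have e2 : lh v = v.2.2.2.2 := rfl
  rw [h4.fderiv]
  simp [e1, e2]
  ring

/-- A scheme of second order commutes with its field up to fourth order, and its derivative with
respect to the step size is the field up to third order. -/
theorem exists_schemeFun_bounds (hX : ContDiff ℝ ∞ X) (hY : ContDiff ℝ ∞ Y)
    (hf : ContDiff ℝ ∞ f) {s : Set (ℝ × ℝ × ℝ × ℝ × ℝ)} (hs : IsCompact s)
    (hs1 : ∀ w ∈ s, w.2.2.2.2 ∈ Icc (0 : ℝ) 1)
    (hR : ∀ w ∈ s, ContDiffAt ℝ 1 R w) (hRP : ∀ w ∈ s, ContDiffAt ℝ 1 RP w)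
    (hRS : ∀ w ∈ s, ContDiffAt ℝ 1 RS w) :
    ∃ C, 0 ≤ C ∧ ∀ w ∈ s,
      |f (forgetStep w) + X (forgetStep w) * fderiv ℝ (schemeFun X Y f R) w (1, 0, 0, 0, 0)
        + Y (forgetStep w) * fderiv ℝ (schemeFun X Y f R) w
            (0, w.2.1, -2 * w.2.2.1, -w.2.2.2.1, w.2.2.2.2)
        - Real.exp (schemeFun X Y Y RS w) *
          f (moved (schemeFun X Y X RP w) (schemeFun X Y Y RS w) (forgetStep w))|
        ≤ C * w.2.2.2.2 ^ 3 ∧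
      |fderiv ℝ (schemeFun X Y f R) w (0, 0, 0, 0, w.2.2.2.2)
        + w.2.2.2.2 * (Real.exp (schemeFun X Y Y RS w) *
          f (moved (schemeFun X Y X RP w) (schemeFun X Y Y RS w) (forgetStep w)))|
        ≤ C * w.2.2.2.2 ^ 3 := by
  have hfs : Continuous forgetStep := by unfold forgetStep; fun_prop
  have cont : ∀ {u : ℝ × ℝ × ℝ × ℝ → ℝ}, ContDiff ℝ ∞ u →
      ContinuousOn (fun w => u (forgetStep w)) s :=
    fun hu => (hu.continuous.comp hfs).continuousOn
  have hcR : ∀ {u : ℝ × ℝ × ℝ × ℝ × ℝ → ℝ}, (∀ w ∈ s, ContDiffAt ℝ 1 u w) → ContinuousOn u s :=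
    fun hu w hw => (hu w hw).continuousAt.continuousWithinAt
  have hcd : ContinuousOn (fderiv ℝ R) s := fun w hw =>
    ((hR w hw).fderiv_right (m := 0) (by norm_num)).continuousAt.continuousWithinAt
  have hh : ContinuousOn (fun w : ℝ × ℝ × ℝ × ℝ × ℝ => w.2.2.2.2) s := by fun_prop
  -- The increments are `h P1` and `h S1` with `P1 = -X + h P2` and `S1 = -Y + h S2`. This makes the
  -- powers of `h` explicit and keeps the coefficients continuous.
  set P2 : ℝ × ℝ × ℝ × ℝ × ℝ → ℝ := fun w =>
    fieldDeriv X Y X (forgetStep w) / 2 + w.2.2.2.2 * RP w with hP2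
  set S2 : ℝ × ℝ × ℝ × ℝ × ℝ → ℝ := fun w =>
    fieldDeriv X Y Y (forgetStep w) / 2 + w.2.2.2.2 * RS w with hS2
  have hcP2 : ContinuousOn P2 s :=
    ((cont (contDiff_fieldDeriv hX hY hX)).div_const 2).add (hh.mul (hcR hRP))
  have hcS2 : ContinuousOn S2 s :=
    ((cont (contDiff_fieldDeriv hX hY hY)).div_const 2).add (hh.mul (hcR hRS))
  set P1 : ℝ × ℝ × ℝ × ℝ × ℝ → ℝ := fun w => -X (forgetStep w) + w.2.2.2.2 * P2 w with hP1
  set S1 : ℝ × ℝ × ℝ × ℝ × ℝ → ℝ := fun w => -Y (forgetStep w) + w.2.2.2.2 * S2 w with hS1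
  have hcP1 : ContinuousOn P1 s := (cont hX).neg.add (hh.mul hcP2)
  have hcS1 : ContinuousOn S1 s := (cont hY).neg.add (hh.mul hcS2)
  have hP : ∀ w, schemeFun X Y X RP w = w.2.2.2.2 * P1 w := fun w => by
    simp only [schemeFun, hP1, hP2]; ring
  have hS : ∀ w, schemeFun X Y Y RS w = w.2.2.2.2 * S1 w := fun w => by
    simp only [schemeFun, hS1, hS2]; ring
  obtain ⟨B1, hB1⟩ := hs.exists_bound_of_continuousOn hcP1
  obtain ⟨B2, hB2⟩ := hs.exists_bound_of_continuousOn hcS1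
  obtain ⟨B3, hB3⟩ := hs.exists_bound_of_continuousOn hfs.continuousOn
  set b : ℝ := max (max B1 B2) (max B3 0)
  have hb1 : B1 ≤ b := (le_max_left _ _).trans (le_max_left _ _)
  have hb2 : B2 ≤ b := (le_max_right _ _).trans (le_max_left _ _)
  have hb3 : B3 ≤ b := (le_max_left _ _).trans (le_max_right _ _)
  have hb0 : 0 ≤ b := (le_max_right _ _).trans (le_max_right _ _)
  obtain ⟨C₂, hC₂0, hC₂⟩ := exists_pathVal_taylor₂ hf b
  obtain ⟨C₃, hC₃0, hC₃⟩ := exists_pathVal_taylor₃ hf b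
  have hfx := contDiff_dX hf
  have hfu := contDiff_dU hf
  -- What is left at order `h³` after the terms of order `1`, `h` and `h²` have cancelled, apart
  -- from the Taylor error. The term `h²` of the scheme, half the derivative of the field along
  -- itself, is exactly what this cancellation requires.
  set E1 : ℝ × ℝ × ℝ × ℝ × ℝ → ℝ := fun w =>
    X (forgetStep w) * fderiv ℝ R w (1, 0, 0, 0, 0) + Y (forgetStep w) * (3 * R w
      + fderiv ℝ R w (0, w.2.1, -2 * w.2.2.1, -w.2.2.2.1, w.2.2.2.2))
    - (RP w * dX f (forgetStep w) + RS w * dU f (forgetStep w))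
    - (P2 w * (P1 w - X (forgetStep w)) * dX (dX f) (forgetStep w)
      + (P2 w * S1 w - X (forgetStep w) * S2 w)
        * (dU (dX f) (forgetStep w) + dX (dU f) (forgetStep w))
      + S2 w * (S1 w - Y (forgetStep w)) * dU (dU f) (forgetStep w)) / 2 with hE1
  set E2 : ℝ × ℝ × ℝ × ℝ × ℝ → ℝ := fun w =>
    3 * R w + fderiv ℝ R w (0, 0, 0, 0, w.2.2.2.2)
      + (P2 w * dX f (forgetStep w) + S2 w * dU f (forgetStep w)) with hE2
  have c1 := cont hX
  have c2 := cont hY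
  have c3 := hcR hR
  have c4 := hcR hRP
  have c5 := hcR hRS
  have c6 := cont hfx
  have c7 := cont hfu
  have c8 := cont (contDiff_dX hfx)
  have c9 := cont (contDiff_dX hfu)
  have c10 := cont (contDiff_dU hfx)
  have c11 := cont (contDiff_dU hfu)
  have d1 : ContinuousOn (fun w => fderiv ℝ R w (1, 0, 0, 0, 0)) s :=
    hcd.clm_apply continuousOn_const
  have d2 : ContinuousOn (fun w => fderiv ℝ R w
      (0, w.2.1, -2 * w.2.2.1, -w.2.2.2.1, w.2.2.2.2)) s := hcd.clm_apply (by fun_prop)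
  have d3 : ContinuousOn (fun w => fderiv ℝ R w (0, 0, 0, 0, w.2.2.2.2)) s :=
    hcd.clm_apply (by fun_prop)
  have hcE1 : ContinuousOn E1 s :=
    ((((c1.mul d1).add (c2.mul ((continuousOn_const.mul c3).add d2))).sub
      ((c4.mul c6).add (c5.mul c7))).sub
      (((((hcP2.mul (hcP1.sub c1)).mul c8).add
        (((hcP2.mul hcS1).sub (c1.mul hcS2)).mul (c10.add c9))).add
        ((hcS2.mul (hcS1.sub c2)).mul c11)).div_const 2))
  have hcE2 : ContinuousOn E2 s :=
    (((continuousOn_const.mul c3).add d3).add ((hcP2.mul c6).add (hcS2.mul c7)))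
  obtain ⟨D1, hD1⟩ := hs.exists_bound_of_continuousOn hcE1
  obtain ⟨D2, hD2⟩ := hs.exists_bound_of_continuousOn hcE2
  refine ⟨max D1 0 + max D2 0 + C₂ * (2 * b) ^ 2 + C₃ * (2 * b) ^ 3, by positivity,
    fun w hw => ?_⟩
  obtain ⟨h0, h1⟩ := hs1 w hw
  have i1 : |P1 w| ≤ b := (hB1 w hw).trans hb1
  have i2 : |S1 w| ≤ b := (hB2 w hw).trans hb2
  have i3 : |w.2.2.2.2 * P1 w| ≤ w.2.2.2.2 * b := by
    rw [abs_mul, abs_of_nonneg h0]; gcongr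
  have i4 : |w.2.2.2.2 * S1 w| ≤ w.2.2.2.2 * b := by
    rw [abs_mul, abs_of_nonneg h0]; gcongr
  have i5 : w.2.2.2.2 * b ≤ b := by nlinarith
  have i6 : |w.2.2.2.2 * P1 w| + |w.2.2.2.2 * S1 w| ≤ w.2.2.2.2 * (2 * b) := by linarith
  have t2 := hC₂ (w.2.2.2.2 * P1 w) (w.2.2.2.2 * S1 w) (forgetStep w) (i3.trans i5) (i4.trans i5)
    ((hB3 w hw).trans hb3) 1 (right_mem_Icc.2 zero_le_one)
  have t3 := hC₃ (w.2.2.2.2 * P1 w) (w.2.2.2.2 * S1 w) (forgetStep w) (i3.trans i5) (i4.trans i5)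
    ((hB3 w hw).trans hb3) 1 (right_mem_Icc.2 zero_le_one)
  rw [pathVal_one] at t2 t3
  have t2' := t2.trans (mul_le_mul_of_nonneg_left (pow_le_pow_left₀ (by positivity) i6 2) hC₂0)
  have t3' := t3.trans (mul_le_mul_of_nonneg_left (pow_le_pow_left₀ (by positivity) i6 3) hC₃0)
  have hdR : DifferentiableAt ℝ R w := (hR w hw).differentiableAt (by norm_num)
  have g1 : forgetStep ((1, 0, 0, 0, 0) : ℝ × ℝ × ℝ × ℝ × ℝ) = (1, 0, 0, 0) := rfl
  have g2 : forgetStep (0, w.2.1, -2 * w.2.2.1, -w.2.2.2.1, w.2.2.2.2) =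
      (0, (forgetStep w).2.1, -2 * (forgetStep w).2.2.1, -(forgetStep w).2.2.2) := rfl
  have g3 : forgetStep (0, 0, 0, 0, w.2.2.2.2) = 0 := rfl
  have q1 : ∀ u : ℝ × ℝ × ℝ × ℝ → ℝ, fderiv ℝ u (forgetStep w) (1, 0, 0, 0)
      = dX u (forgetStep w) := fun u => rfl
  have q2 : ∀ u : ℝ × ℝ × ℝ × ℝ → ℝ, fderiv ℝ u (forgetStep w)
      (0, (forgetStep w).2.1, -2 * (forgetStep w).2.2.1, -(forgetStep w).2.2.2)
      = dU u (forgetStep w) - u (forgetStep w) := fun u => by simp [dU]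
  have r1 := dX_fieldDeriv hX hY hf (forgetStep w)
  have r2 : dU (fieldDeriv X Y f) (forgetStep w) = _ := eq_sub_of_add_eq
    (dU_fieldDeriv hX hY hf (forgetStep w))
  have s1 : fieldDeriv X Y f (forgetStep w) = X (forgetStep w) * dX f (forgetStep w)
    + Y (forgetStep w) * dU f (forgetStep w) := rfl
  have s2 : fieldDeriv X Y X (forgetStep w) = X (forgetStep w) * dX X (forgetStep w)
    + Y (forgetStep w) * dU X (forgetStep w) := rfl
  have s3 : fieldDeriv X Y Y (forgetStep w) = X (forgetStep w) * dX Y (forgetStep w)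
    + Y (forgetStep w) * dU Y (forgetStep w) := rfl
  rw [hP, hS, fderiv_schemeFun hX hY hf hdR, fderiv_schemeFun hX hY hf hdR,
    fderiv_schemeFun hX hY hf hdR, g1, g2, g3, map_zero, map_zero, q1, q1, q2, q2, r1, r2]
  have hE1w : |w.2.2.2.2 ^ 3 * E1 w| ≤ w.2.2.2.2 ^ 3 * max D1 0 := by
    rw [abs_mul, abs_of_nonneg (by positivity)]
    gcongr
    exact (hD1 w hw).trans (le_max_left _ _)
  have hE2w : |w.2.2.2.2 ^ 3 * E2 w| ≤ w.2.2.2.2 ^ 3 * max D2 0 := by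
    rw [abs_mul, abs_of_nonneg (by positivity)]
    gcongr
    exact (hD2 w hw).trans (le_max_left _ _)
  have hh3 : 0 ≤ w.2.2.2.2 ^ 3 := by positivity
  have z1 : 0 ≤ w.2.2.2.2 ^ 3 * max D1 0 := by positivity
  have z2 : 0 ≤ w.2.2.2.2 ^ 3 * max D2 0 := by positivity
  have z3 : 0 ≤ w.2.2.2.2 ^ 3 * (C₂ * (2 * b) ^ 2) := by positivity
  have z4 : 0 ≤ w.2.2.2.2 ^ 3 * (C₃ * (2 * b) ^ 3) := by positivity
  set M := Real.exp (w.2.2.2.2 * S1 w) *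
    f (moved (w.2.2.2.2 * P1 w) (w.2.2.2.2 * S1 w) (forgetStep w))
  constructor
  · refine le_trans (le_of_eq ?_) ((abs_sub (w.2.2.2.2 ^ 3 * E1 w) _).trans
      ((add_le_add hE1w t3').trans (by linarith)))
    congr 1
    simp only [hE1, hP1, hS1, hP2, hS2, s1, s2, s3]
    ring
  · have t4 : |w.2.2.2.2 * (M - f (forgetStep w) - 1 * (w.2.2.2.2 * P1 w * dX f (forgetStep w)
        + w.2.2.2.2 * S1 w * dU f (forgetStep w)))| ≤
        w.2.2.2.2 * (C₂ * (w.2.2.2.2 * (2 * b)) ^ 2) := by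
      rw [abs_mul, abs_of_nonneg h0]; gcongr
    refine le_trans (le_of_eq ?_) ((abs_add_le (w.2.2.2.2 ^ 3 * E2 w) _).trans
      ((add_le_add hE2w t4).trans (by linarith)))
    congr 1
    simp only [hE2, hP1, hS1, hP2, hS2, s1]
    ring

end

/-! ### The derivative of an invariant graph with respect to `log h` -/

/-- The scaling action on the base, in the coordinates `(r, e, m, log h)`. -/
noncomputable def scaled (S : ℝ) (q : ℝ × ℝ × ℝ × ℝ) : ℝ × ℝ × ℝ × ℝ :=
  (Real.exp S * q.1, Real.exp (-2 * S) * q.2.1, Real.exp (-S) * q.2.2.1, q.2.2.2 + S)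

/-- The generator of the scaling action. -/
noncomputable def scaleGen (q : ℝ × ℝ × ℝ × ℝ) : ℝ × ℝ × ℝ × ℝ := (q.1, -2 * q.2.1, -q.2.2.1, 1)

/-- The point `(x, r, e, m, h)` over the base point `(r, e, m, log h)`. -/
noncomputable def overBase (x : ℝ) (q : ℝ × ℝ × ℝ × ℝ) : ℝ × ℝ × ℝ × ℝ × ℝ :=
  (x, q.1, q.2.1, q.2.2.1, Real.exp q.2.2.2)

/-- The a priori bound `h3` degenerates as `h → 0`, but `h` does not decrease along `p`. Hence along
the orbit of a fixed `q` the contraction factor is at most `1 - a < 1` and the a priori bound at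
most `G`; after `n` steps the excess over `max C₁ (C / c)` is at most `(1 - a)^n G`, which tends to
`0`. -/
theorem bounded_of_backward_contraction {Z : Type*} {D : Set Z} {F h : Z → ℝ} {p : Z → Z}
    {c C C₁ C₂ ν : ℝ} (hc : 0 < c) (hC₁ : 0 ≤ C₁) (hh : ∀ q ∈ D, 0 < h q)
    (hch : ∀ q ∈ D, h q < ν → c * h q ≤ 1)
    (hp : ∀ q ∈ D, p q ∈ D) (hmono : ∀ q ∈ D, h q ≤ h (p q))
    (h1 : ∀ q ∈ D, h q < ν → F q ≤ (1 - c * h q) * F (p q) + C * h q)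
    (h2 : ∀ q ∈ D, ν ≤ h q → F q ≤ C₁) (h3 : ∀ q ∈ D, F q * h q ^ 2 ≤ C₂) :
    ∀ q ∈ D, F q ≤ max C₁ (C / c) := by
  intro q hq
  set B := max C₁ (C / c) with hB
  have hB1 : C₁ ≤ B := le_max_left _ _
  have hB2 : C ≤ c * B := by
    have : C / c ≤ B := le_max_right _ _
    rw [div_le_iff₀ hc] at this
    linarith
  have hB0 : 0 ≤ B := hC₁.trans hB1
  set a := min (c * h q) 1 with ha
  have ha0 : 0 < a := lt_min (mul_pos hc (hh q hq)) one_pos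
  set G := max C₂ 0 / h q ^ 2 with hG
  have hG0 : 0 ≤ G := by have := hh q hq; positivity
  have hiter : ∀ n : ℕ, ∀ z ∈ D, h q ≤ h z → F z - B ≤ (1 - a) ^ n * G := by
    intro n
    induction n with
    | zero =>
      intro z hz hzq
      have i1 := h3 z hz
      have i2 := hh q hq
      have i3 : F z ≤ G := by
        rw [hG, le_div_iff₀ (by positivity)]
        rcases le_or_gt (F z) 0 with hF | hF
        · exact (mul_nonpos_of_nonpos_of_nonneg hF (by positivity)).trans (le_max_right _ _)
        · refine le_trans ?_ (i1.trans (le_max_left _ _))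
          gcongr
      simp only [pow_zero, one_mul]; linarith
    | succ n ih =>
      intro z hz hzq
      have ha1 : a ≤ 1 := min_le_right _ _
      have hpos : 0 ≤ (1 - a) ^ n * G := by
        have : 0 ≤ 1 - a := by linarith
        positivity
      rcases lt_or_ge (h z) ν with hν | hν
      · have i1 := h1 z hz hν
        have i2 := ih (p z) (hp z hz) (hzq.trans (hmono z hz))
        have i3 := hch z hz hν
        have i4 : a ≤ c * h z := (min_le_left _ _).trans (by gcongr)
        have i5 : (1 - c * h z) * (F (p z) - B) ≤ (1 - c * h z) * ((1 - a) ^ n * G) :=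
          mul_le_mul_of_nonneg_left i2 (by linarith)
        have i6 : (1 - c * h z) * ((1 - a) ^ n * G) ≤ (1 - a) * ((1 - a) ^ n * G) := by gcongr
        have i7 : C * h z ≤ c * B * h z := by have := (hh z hz).le; gcongr
        rw [pow_succ']
        linarith
      · have i1 := h2 z hz hν
        have : 0 ≤ (1 - a) ^ (n + 1) * G := by
          have : 0 ≤ 1 - a := by linarith
          positivity
        linarith
  have hlim : Filter.Tendsto (fun n : ℕ => (1 - a) ^ n * G) Filter.atTop (𝓝 (0 * G)) :=
    (tendsto_pow_atTop_nhds_zero_of_lt_one (by linarith [min_le_right (c * h q) 1])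
      (by linarith)).mul_const G
  rw [zero_mul] at hlim
  have := ge_of_tendsto' hlim fun n => hiter n q hq le_rfl
  linarith

section

variable {R κ T K : ℝ} {g : ℝ × ℝ × ℝ × ℝ → ℝ} {l : ℝ × ℝ × ℝ × ℝ → (ℝ × ℝ × ℝ × ℝ →L[ℝ] ℝ)}
  {P S : ℝ × ℝ × ℝ × ℝ × ℝ → ℝ}

/-- Differentiating the invariance of a graph along a path in the base. -/
theorem invariance_deriv
    (hjets : ∀ q ∈ logBox R κ T, ∀ q' ∈ logBox R κ T,
      |g q' - g q - l q (q' - q)| ≤ K * ‖q' - q‖ ^ 2)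
    (hmaps : ∀ q ∈ logBox R κ T, scaled (S (overBase (g q) q)) q ∈ logBox R κ T)
    (hinv : ∀ q ∈ logBox R κ T,
      g (scaled (S (overBase (g q) q)) q) = g q + P (overBase (g q) q))
    {γ : ℝ → ℝ × ℝ × ℝ × ℝ} {q ξ : ℝ × ℝ × ℝ × ℝ} (h0 : γ 0 = q) (hγ : HasDerivAt γ ξ 0)
    (hγD : ∀ᶠ t in 𝓝[≥] (0 : ℝ), γ t ∈ logBox R κ T) (hq : q ∈ logBox R κ T)
    (hP : DifferentiableAt ℝ P (overBase (g q) q))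
    (hS : DifferentiableAt ℝ S (overBase (g q) q)) :
    l (scaled (S (overBase (g q) q)) q)
      (fderiv ℝ S (overBase (g q) q)
          (l q ξ, ξ.1, ξ.2.1, ξ.2.2.1, Real.exp q.2.2.2 * ξ.2.2.2) •
        scaleGen (scaled (S (overBase (g q) q)) q)
      + (Real.exp (S (overBase (g q) q)) * ξ.1, Real.exp (-2 * S (overBase (g q) q)) * ξ.2.1,
        Real.exp (-S (overBase (g q) q)) * ξ.2.2.1, ξ.2.2.2))
      = l q ξ + fderiv ℝ P (overBase (g q) q)
          (l q ξ, ξ.1, ξ.2.1, ξ.2.2.1, Real.exp q.2.2.2 * ξ.2.2.2) := by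
  -- The base has a boundary, so the path need only stay in it for `t ≥ 0`; one-sided derivatives
  -- are still unique.
  set u : Set ℝ := Ici 0 ∩ γ ⁻¹' logBox R κ T with hu
  have hun : u ∈ 𝓝[≥] (0 : ℝ) := Filter.inter_mem self_mem_nhdsWithin hγD
  have hmt : MapsTo γ u (logBox R κ T) := fun t ht => ht.2
  have hγu : HasDerivWithinAt γ ξ u 0 := hγ.hasDerivWithinAt
  have hg : HasDerivWithinAt (fun t => g (γ t)) (l q ξ) u 0 := by
    have h1 := hasFDerivWithinAt_of_jets (hjets q hq)
    rw [← h0] at h1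
    have h2 := h1.comp_hasDerivWithinAt 0 hγu hmt
    rw [h0] at h2
    exact h2
  have c1 : HasDerivWithinAt (fun t => (γ t).1) ξ.1 u 0 := hγu.fst
  have c2 : HasDerivWithinAt (fun t => (γ t).2.1) ξ.2.1 u 0 := hγu.snd.fst
  have c3 : HasDerivWithinAt (fun t => (γ t).2.2.1) ξ.2.2.1 u 0 := hγu.snd.snd.fst
  have c4 : HasDerivWithinAt (fun t => (γ t).2.2.2) ξ.2.2.2 u 0 := hγu.snd.snd.snd
  have hw : HasDerivWithinAt (fun t => overBase (g (γ t)) (γ t))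
      (l q ξ, ξ.1, ξ.2.1, ξ.2.2.1, Real.exp q.2.2.2 * ξ.2.2.2) u 0 := by
    have h4 := c4.exp
    rw [h0] at h4
    exact hg.prodMk (c1.prodMk (c2.prodMk (c3.prodMk h4)))
  have hPd : HasDerivWithinAt (fun t => P (overBase (g (γ t)) (γ t))) (fderiv ℝ P (overBase (g q) q)
      (l q ξ, ξ.1, ξ.2.1, ξ.2.2.1, Real.exp q.2.2.2 * ξ.2.2.2)) u 0 := by
    have h1 := hP.hasFDerivAt
    rw [← h0] at h1
    have h2 := h1.comp_hasDerivWithinAt 0 hw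
    rw [h0] at h2
    exact h2
  have hSd : HasDerivWithinAt (fun t => S (overBase (g (γ t)) (γ t))) (fderiv ℝ S (overBase (g q) q)
      (l q ξ, ξ.1, ξ.2.1, ξ.2.2.1, Real.exp q.2.2.2 * ξ.2.2.2)) u 0 := by
    have h1 := hS.hasFDerivAt
    rw [← h0] at h1
    have h2 := h1.comp_hasDerivWithinAt 0 hw
    rw [h0] at h2
    exact h2
  set S' := fderiv ℝ S (overBase (g q) q)
      (l q ξ, ξ.1, ξ.2.1, ξ.2.2.1, Real.exp q.2.2.2 * ξ.2.2.2)
  have hpd : HasDerivWithinAt (fun t => scaled (S (overBase (g (γ t)) (γ t))) (γ t))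
      (S' • scaleGen (scaled (S (overBase (g q) q)) q)
      + (Real.exp (S (overBase (g q) q)) * ξ.1, Real.exp (-2 * S (overBase (g q) q)) * ξ.2.1,
        Real.exp (-S (overBase (g q) q)) * ξ.2.2.1, ξ.2.2.2)) u 0 := by
    have e1 := hSd.exp.mul c1
    have e2 := (hSd.const_mul (-2)).exp.mul c2
    have e3 := hSd.neg.exp.mul c3
    have e4 := c4.add hSd
    refine (e1.prodMk (e2.prodMk (e3.prodMk e4))).congr_deriv ?_
    simp only [scaleGen, scaled]
    ext <;> simp [h0] <;> ring
  have hgp : HasDerivWithinAt (fun t => g (scaled (S (overBase (g (γ t)) (γ t))) (γ t)))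
      (l (scaled (S (overBase (g q) q)) q) (S' • scaleGen (scaled (S (overBase (g q) q)) q)
      + (Real.exp (S (overBase (g q) q)) * ξ.1, Real.exp (-2 * S (overBase (g q) q)) * ξ.2.1,
        Real.exp (-S (overBase (g q) q)) * ξ.2.2.1, ξ.2.2.2))) u 0 := by
    have h1 := hasFDerivWithinAt_of_jets (hjets _ (hmaps q hq))
    rw [← h0] at h1
    have h2 := h1.comp_hasDerivWithinAt 0 hpd (fun t ht => hmaps _ (hmt ht))
    rw [h0] at h2
    exact h2
  have heq : HasDerivWithinAt (fun t => g (scaled (S (overBase (g (γ t)) (γ t))) (γ t)))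
      (l q ξ + fderiv ℝ P (overBase (g q) q)
          (l q ξ, ξ.1, ξ.2.1, ξ.2.2.1, Real.exp q.2.2.2 * ξ.2.2.2)) u 0 :=
    (hg.add hPd).congr (fun t ht => hinv _ (hmt ht)) (hinv _ (by rw [h0]; exact hq))
  have huniq : UniqueDiffWithinAt ℝ u 0 := by
    have h1 : UniqueDiffWithinAt ℝ (Ici (0 : ℝ)) 0 := uniqueDiffOn_Ici 0 0 self_mem_Ici
    exact h1.inter' hγD
  exact huniq.eq_deriv _ hgp heq

end

section

variable {R κ T K L c η ν lo hi : ℝ} {g : ℝ × ℝ × ℝ × ℝ → ℝ}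
  {l : ℝ × ℝ × ℝ × ℝ → (ℝ × ℝ × ℝ × ℝ →L[ℝ] ℝ)}
  {P S RP RS : ℝ × ℝ × ℝ × ℝ × ℝ → ℝ} {X Y : ℝ × ℝ × ℝ × ℝ → ℝ}

theorem norm_scaleGen_le (hR : R ≤ 2) (hκ : κ ≤ 2) {q : ℝ × ℝ × ℝ × ℝ} (hq : q ∈ logBox R κ T) :
    ‖scaleGen q‖ ≤ 2 := by
  obtain ⟨h1, h2, h3, -⟩ := hq
  simp only [scaleGen, Prod.norm_mk, Real.norm_eq_abs, mem_Icc] at *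
  refine max_le ?_ (max_le ?_ (max_le ?_ (by norm_num))) <;> rw [abs_le] <;>
    constructor <;> linarith [h1.1, h1.2, h2.1, h2.2, h3.1, h3.2]

/-- For `t ≥ 0` the scaling shrinks `e` and `|m|` and enlarges `r` and `log h`, so room is required
only at the upper ends of the latter two. -/
theorem eventually_scaled_mem {q : ℝ × ℝ × ℝ × ℝ} (hq : q ∈ logBox R κ T) (hqR : q.1 < R)
    (hqT : q.2.2.2 < T) : ∀ᶠ t in 𝓝[≥] (0 : ℝ), scaled t q ∈ logBox R κ T := by
  obtain ⟨h1, h2, h3, -⟩ := hq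
  have e1 : ∀ᶠ t in 𝓝[≥] (0 : ℝ), Real.exp t * q.1 < R := by
    have : Filter.Tendsto (fun t => Real.exp t * q.1) (𝓝[≥] (0 : ℝ)) (𝓝 q.1) := by
      have : Continuous (fun t => Real.exp t * q.1) := by fun_prop
      simpa using (this.tendsto 0).mono_left nhdsWithin_le_nhds
    exact this.eventually_lt_const hqR
  have e2 : ∀ᶠ t in 𝓝[≥] (0 : ℝ), q.2.2.2 + t < T := by
    have : Filter.Tendsto (fun t => q.2.2.2 + t) (𝓝[≥] (0 : ℝ)) (𝓝 q.2.2.2) := by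
      have : Continuous (fun t => q.2.2.2 + t) := by fun_prop
      simpa using (this.tendsto 0).mono_left nhdsWithin_le_nhds
    exact this.eventually_lt_const hqT
  filter_upwards [e1, e2, self_mem_nhdsWithin] with t ht1 ht2 ht0
  simp only [mem_Ici] at ht0
  have i2 : Real.exp (-2 * t) ≤ 1 := Real.exp_le_one_iff.2 (by linarith)
  have i3 : Real.exp (-t) ≤ 1 := Real.exp_le_one_iff.2 (by linarith)
  have i2' := (Real.exp_pos (-2 * t)).le
  have i3' := (Real.exp_pos (-t)).le
  refine ⟨⟨mul_nonneg (Real.exp_pos _).le h1.1, ht1.le⟩,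
    ⟨mul_nonneg i2' h2.1, ?_⟩, ⟨?_, ?_⟩, ht2.le⟩
  · exact mul_le_one₀ i2 h2.1 h2.2
  · have := h3.1
    have := h3.2
    simp only [scaled]
    nlinarith
  · have := h3.1
    have := h3.2
    simp only [scaled]
    nlinarith

theorem scaled_zero (q : ℝ × ℝ × ℝ × ℝ) : scaled 0 q = q := by simp [scaled]

theorem hasDerivAt_scaled (q : ℝ × ℝ × ℝ × ℝ) :
    HasDerivAt (fun t => scaled t q) (scaleGen q) 0 := by
  have h1 := (Real.hasDerivAt_exp 0).mul_const q.1
  have h2 := (((hasDerivAt_id (0 : ℝ)).const_mul (-2)).exp).mul_const q.2.1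
  have h3 := ((hasDerivAt_id (0 : ℝ)).neg.exp).mul_const q.2.2.1
  have h4 := (hasDerivAt_id (0 : ℝ)).const_add q.2.2.2
  refine (h1.prodMk (h2.prodMk (h3.prodMk h4))).congr_deriv ?_
  simp [scaleGen]

theorem forgetStep_overBase_scaled (x P S : ℝ) (q : ℝ × ℝ × ℝ × ℝ) :
    forgetStep (overBase (x + P) (scaled S q)) = moved P S (forgetStep (overBase x q)) := rfl

theorem fderiv_split_step (f : ℝ × ℝ × ℝ × ℝ × ℝ → ℝ) (w : ℝ × ℝ × ℝ × ℝ × ℝ) (a : ℝ)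
    (b : ℝ × ℝ × ℝ × ℝ) : fderiv ℝ f w (a, b) =
      a * fderiv ℝ f w (1, 0, 0, 0, 0) + fderiv ℝ f w (0, b) := by
  have : ((a, b) : ℝ × ℝ × ℝ × ℝ × ℝ) = a • (1, 0, 0, 0, 0) + (0, b) := by
    simp only [Prod.smul_mk, Prod.mk_add_mk, smul_eq_mul, mul_one, mul_zero, add_zero]
    ext <;> simp
  rw [this, map_add, map_smul, smul_eq_mul]

set_option maxHeartbeats 1000000 in
/-- For an invariant graph of a backward scheme of second order, the derivative with respect to
`log h` is `O(h²)`. -/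
theorem exists_step_deriv_bound (hR : R ≤ 2) (hκ : κ ≤ 2) (hν : 0 < ν) (hν1 : ν ≤ 1)
    (hT : Real.log ν ≤ T) (hX : ContDiff ℝ ∞ X) (hY : ContDiff ℝ ∞ Y)
    {s : Set (ℝ × ℝ × ℝ × ℝ × ℝ)} (hs : IsCompact s)
    (hs1 : ∀ w ∈ s, w.2.2.2.2 ∈ Icc (0 : ℝ) 1)
    (hRP : ∀ w ∈ s, ContDiffAt ℝ 1 RP w) (hRS : ∀ w ∈ s, ContDiffAt ℝ 1 RS w)
    (hran : ∀ q ∈ logBox R κ T, g q ∈ Icc lo hi)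
    (hmem : ∀ q ∈ logBox R κ T, Real.exp q.2.2.2 < ν → overBase (g q) q ∈ s)
    (hPs : ∀ q ∈ logBox R κ T, Real.exp q.2.2.2 < ν →
      P =ᶠ[𝓝 (overBase (g q) q)] schemeFun X Y X RP)
    (hSs : ∀ q ∈ logBox R κ T, Real.exp q.2.2.2 < ν →
      S =ᶠ[𝓝 (overBase (g q) q)] schemeFun X Y Y RS)
    (hmaps : ∀ q ∈ logBox R κ T, scaled (S (overBase (g q) q)) q ∈ logBox R κ T)
    (hmapsR : ∀ q ∈ logBox R κ T, q.1 < R → (scaled (S (overBase (g q) q)) q).1 < R)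
    (hS0 : ∀ q ∈ logBox R κ T, 0 ≤ S (overBase (g q) q))
    (hinv : ∀ q ∈ logBox R κ T,
      g (scaled (S (overBase (g q) q)) q) = g q + P (overBase (g q) q))
    (hL : 0 ≤ L) (hl : ∀ q ∈ logBox R κ T, ‖l q‖ ≤ L)
    (hjets : ∀ q ∈ logBox R κ T, ∀ q' ∈ logBox R κ T,
      |g q' - g q - l q (q' - q)| ≤ K * ‖q' - q‖ ^ 2)
    (hc : 0 < c) (hc1 : c ≤ 1) (hη : 4 * (L * η) ≤ c)
    (hPx : ∀ q ∈ logBox R κ T, Real.exp q.2.2.2 < ν →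
      c * Real.exp q.2.2.2 ≤ fderiv ℝ P (overBase (g q) q) (1, 0, 0, 0, 0))
    (hSx : ∀ q ∈ logBox R κ T, Real.exp q.2.2.2 < ν →
      |fderiv ℝ S (overBase (g q) q) (1, 0, 0, 0, 0)| ≤ η * Real.exp q.2.2.2)
    (hS3 : ∀ q ∈ logBox R κ T, Real.exp q.2.2.2 < ν →
      Real.exp (S (overBase (g q) q)) ^ 3 ≤ 1 + c * Real.exp q.2.2.2 / 4) :
    ∃ C, 0 ≤ C ∧ ∀ q ∈ logBox R κ T, q.1 < R →
      |l q (0, 0, 0, 1)| ≤ C * Real.exp q.2.2.2 ^ 2 := by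
  obtain ⟨CX, hCX0, hCX⟩ := exists_schemeFun_bounds hX hY hX hs hs1 hRP hRP hRS
  obtain ⟨CY, hCY0, hCY⟩ := exists_schemeFun_bounds hX hY hY hs hs1 hRS hRP hRS
  set D := logBox R κ T with hD
  set p : ℝ × ℝ × ℝ × ℝ → ℝ × ℝ × ℝ × ℝ := fun q => scaled (S (overBase (g q) q)) q with hp
  -- The field is `X` in the fibre and `Y` times `scaleGen` in the base, so `a` measures by how much
  -- the graph fails to be tangent to it.
  set a : ℝ × ℝ × ℝ × ℝ → ℝ := fun q => X (forgetStep (overBase (g q) q))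
    - Y (forgetStep (overBase (g q) q)) * l q (scaleGen q) with ha
  have hv : ∀ q ∈ D, |l q (scaleGen q)| ≤ 2 * L := by
    intro q hq
    refine ((l q).le_opNorm _).trans ?_
    calc ‖l q‖ * ‖scaleGen q‖ ≤ L * 2 := by
          have := hl q hq
          have := norm_scaleGen_le hR hκ hq
          gcongr
      _ = 2 * L := by ring
  -- bounds for the field along the graph
  obtain ⟨BX, hBX⟩ := (isCompact_Icc.prod (isCompact_Icc.prod (isCompact_Icc.prod
    isCompact_Icc))).exists_bound_of_continuousOn
      (s := Icc lo hi ×ˢ Icc 0 R ×ˢ Icc (0 : ℝ) 1 ×ˢ Icc (-κ) κ) hX.continuous.continuousOn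
  obtain ⟨BY, hBY⟩ := (isCompact_Icc.prod (isCompact_Icc.prod (isCompact_Icc.prod
    isCompact_Icc))).exists_bound_of_continuousOn
      (s := Icc lo hi ×ˢ Icc 0 R ×ˢ Icc (0 : ℝ) 1 ×ˢ Icc (-κ) κ) hY.continuous.continuousOn
  set Ba := max BX 0 + max BY 0 * (2 * L) with hBa
  have hBa0 : 0 ≤ Ba := by positivity
  have habound : ∀ q ∈ D, |a q| ≤ Ba := by
    intro q hq
    have hm : forgetStep (overBase (g q) q) ∈
        Icc lo hi ×ˢ Icc 0 R ×ˢ Icc (0 : ℝ) 1 ×ˢ Icc (-κ) κ :=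
      ⟨hran q hq, hq.1, hq.2.1, hq.2.2.1⟩
    refine (abs_sub _ _).trans ?_
    rw [abs_mul]
    have i1 := (hBX _ hm).trans (le_max_left BX 0)
    have i2 := (hBY _ hm).trans (le_max_left BY 0)
    have i3 := hv q hq
    rw [Real.norm_eq_abs] at i1 i2
    exact add_le_add i1 (mul_le_mul i2 i3 (abs_nonneg _) (le_max_right _ _))
  -- the two linear relations
  have hrel : ∀ q ∈ D, q.1 < R → Real.exp q.2.2.2 < ν →
      ∃ M E₁ E₂ : ℝ, 1 + c * Real.exp q.2.2.2 / 2 ≤ M ∧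
        |E₁| ≤ (CX + 2 * L * CY) * Real.exp q.2.2.2 ^ 3 ∧
        |E₂| ≤ (CX + 2 * L * CY) * Real.exp q.2.2.2 ^ 3 ∧
        M * a q = Real.exp (S (overBase (g q) q)) * a (p q) + E₁ ∧
        M * l q (0, 0, 0, 1) = l (p q) (0, 0, 0, 1) +
          Real.exp q.2.2.2 * (Real.exp (S (overBase (g q) q)) * a (p q)) + E₂ := by
    intro q hq hqR hqν
    have hqT : q.2.2.2 < T := by
      have := (Real.lt_log_iff_exp_lt hν).2 hqν
      linarith
    have hw := hmem q hq hqν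
    have hPd : DifferentiableAt ℝ P (overBase (g q) q) := by
      refine (hPs q hq hqν).differentiableAt_iff.2 ?_
      have h1 := (hRP _ hw).differentiableAt (by norm_num)
      have := (contDiff_fieldDeriv hX hY hX).differentiable (by simp)
      have := hX.differentiable (by simp)
      unfold schemeFun forgetStep
      fun_prop
    have hSd : DifferentiableAt ℝ S (overBase (g q) q) := by
      refine (hSs q hq hqν).differentiableAt_iff.2 ?_
      have h1 := (hRS _ hw).differentiableAt (by norm_num)
      have := (contDiff_fieldDeriv hX hY hY).differentiable (by simp)
      have := hY.differentiable (by simp)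
      unfold schemeFun forgetStep
      fun_prop
    -- Differentiation along the scaling orbit; multiplied by `Y`, this is differentiation along the
    -- base part of the field and leads to the relation for `a`.
    have r1 := invariance_deriv hjets hmaps hinv (γ := fun t => scaled t q) (scaled_zero q)
      (hasDerivAt_scaled q) (eventually_scaled_mem hq hqR hqT) hq hPd hSd
    -- Differentiation in the direction of `log h`. It brings in the derivative of the scheme with
    -- respect to its step size, which is minus the field at the image point up to `O(h³)`.
    have r2 := invariance_deriv hjets hmaps hinv (γ := fun t => (q.1, q.2.1, q.2.2.1, q.2.2.2 + t))
      (q := q) (ξ := (0, 0, 0, 1)) (by simp) (by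
        have h4 := (hasDerivAt_id (0 : ℝ)).const_add q.2.2.2
        exact (hasDerivAt_const _ _).prodMk ((hasDerivAt_const _ _).prodMk
          ((hasDerivAt_const _ _).prodMk h4))) (by
        have : Filter.Tendsto (fun t => q.2.2.2 + t) (𝓝[≥] (0 : ℝ)) (𝓝 q.2.2.2) := by
          have : Continuous (fun t => q.2.2.2 + t) := by fun_prop
          simpa using (this.tendsto 0).mono_left nhdsWithin_le_nhds
        filter_upwards [this.eventually_lt_const hqT] with t ht
        exact ⟨hq.1, hq.2.1, hq.2.2.1, ht.le⟩) hq hPd hSd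
    have g1 : (Real.exp (S (overBase (g q) q)) * (scaleGen q).1,
        Real.exp (-2 * S (overBase (g q) q)) * (scaleGen q).2.1,
        Real.exp (-S (overBase (g q) q)) * (scaleGen q).2.2.1, (scaleGen q).2.2.2) =
        scaleGen (p q) := by
      simp only [scaleGen, hp, scaled]
      ext <;> simp <;> ring
    have g2 : ((Real.exp (S (overBase (g q) q)) * 0, Real.exp (-2 * S (overBase (g q) q)) * 0,
        Real.exp (-S (overBase (g q) q)) * 0, 1) : ℝ × ℝ × ℝ × ℝ) = (0, 0, 0, 1) := by simp
    have qP : fderiv ℝ P (overBase (g q) q) =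
        fderiv ℝ (schemeFun X Y X RP) (overBase (g q) q) := (hPs q hq hqν).fderiv_eq
    have qS : fderiv ℝ S (overBase (g q) q) =
        fderiv ℝ (schemeFun X Y Y RS) (overBase (g q) q) := (hSs q hq hqν).fderiv_eq
    have i1 := hPx q hq hqν
    have i2 := hSx q hq hqν
    obtain ⟨b1, b2⟩ := hCX _ hw
    obtain ⟨b3, b4⟩ := hCY _ hw
    have hvp := hv (p q) (hmaps q hq)
    rw [← (hPs q hq hqν).self_of_nhds, ← (hSs q hq hqν).self_of_nhds,
      ← forgetStep_overBase_scaled, ← hinv q hq] at b1 b2 b3 b4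
    rw [← qP] at b1 b2
    rw [← qS] at b3 b4
    change l (p q) (_ • scaleGen (p q) + _) = _ at r1 r2
    rw [g1, map_add, map_smul, smul_eq_mul, fderiv_split_step S, fderiv_split_step P] at r1
    simp only at r2
    rw [g2, map_add, map_smul, smul_eq_mul, fderiv_split_step S, fderiv_split_step P] at r2
    change |_ - _ * X (forgetStep (overBase (g (p q)) (p q)))| ≤ _ at b1
    change |_ + _ * (_ * X (forgetStep (overBase (g (p q)) (p q))))| ≤ _ at b2
    change |_ - _ * Y (forgetStep (overBase (g (p q)) (p q)))| ≤ _ at b3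
    change |_ + _ * (_ * Y (forgetStep (overBase (g (p q)) (p q))))| ≤ _ at b4
    have e5 : (overBase (g q) q).2.2.2.2 = Real.exp q.2.2.2 := rfl
    have e6 : ((0, (scaleGen q).1, (scaleGen q).2.1, (scaleGen q).2.2.1,
        Real.exp q.2.2.2 * (scaleGen q).2.2.2) : ℝ × ℝ × ℝ × ℝ × ℝ) =
        (0, (overBase (g q) q).2.1, -2 * (overBase (g q) q).2.2.1,
          -(overBase (g q) q).2.2.2.1, (overBase (g q) q).2.2.2.2) := by
      simp [scaleGen, overBase]
    rw [e6] at r1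
    rw [mul_one] at r2
    rw [e5] at b1 b2 b3 b4 r1
    set h := Real.exp q.2.2.2
    set Px := fderiv ℝ P (overBase (g q) q) (1, 0, 0, 0, 0)
    set Sx := fderiv ℝ S (overBase (g q) q) (1, 0, 0, 0, 0)
    set v := l q (scaleGen q) with hvdef
    set v' := l (p q) (scaleGen (p q)) with hvdef'
    set X0 := X (forgetStep (overBase (g q) q))
    set Y0 := Y (forgetStep (overBase (g q) q))
    have hh0 : 0 < h := Real.exp_pos _
    -- The derivative of `g` at `q` enters the chain rule with this coefficient: `Px ≥ c h` is the
    -- fibre expansion, and `v' Sx`, the reaction of the base, takes at most half of it because `4 L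
    -- η ≤ c`.
    refine ⟨1 + Px - v' * Sx, _, _, ?_, ?_, ?_, eq_add_of_sub_eq' rfl, eq_add_of_sub_eq' rfl⟩
    · have i3 : |v' * Sx| ≤ 2 * L * (η * h) := by
        rw [abs_mul]; exact mul_le_mul hvp i2 (abs_nonneg _) (by positivity)
      have i4 : h * (4 * (L * η)) ≤ h * c := by gcongr
      rw [abs_le] at i3
      linarith [i3.2]
    · have j1 : |v' * (Y0 + X0 * Sx + Y0 * fderiv ℝ S (overBase (g q) q)
          (0, (overBase (g q) q).2.1, -2 * (overBase (g q) q).2.2.1,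
          -(overBase (g q) q).2.2.2.1, h) - Real.exp (S (overBase (g q) q)) *
          Y (forgetStep (overBase (g (p q)) (p q))))| ≤ 2 * L * (CY * h ^ 3) := by
        rw [abs_mul]; exact mul_le_mul hvp b3 (abs_nonneg _) (by positivity)
      refine le_trans (le_of_eq ?_) ((abs_sub _ _).trans ((add_le_add b1 j1).trans
        (le_of_eq (by ring))))
      congr 1
      simp only [ha, ← hvdef, ← hvdef']
      linear_combination Y0 * r1
    · have j1 : |v' * (fderiv ℝ S (overBase (g q) q) (0, 0, 0, 0, h) + h *
          (Real.exp (S (overBase (g q) q)) *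
          Y (forgetStep (overBase (g (p q)) (p q)))))| ≤ 2 * L * (CY * h ^ 3) := by
        rw [abs_mul]; exact mul_le_mul hvp b4 (abs_nonneg _) (by positivity)
      refine le_trans (le_of_eq ?_) ((abs_sub _ _).trans ((add_le_add b2 j1).trans
        (le_of_eq (by ring))))
      rw [← abs_neg]
      congr 1
      simp only [ha, ← hvdef']
      linear_combination r2
  -- weighted contraction
  set C₀ := CX + 2 * L * CY with hC₀
  have hC₀0 : 0 ≤ C₀ := by positivity
  -- Quantities are divided by `h²`. As `h` grows by `e^S` in a step, this turns the factor `e^S`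
  -- into `e^{3S} ≤ 1 + c h / 4`, which against `M ≥ 1 + c h / 2` still leaves the contraction `1 -
  -- c h / 8`.
  have hcontr : ∀ (q : ℝ × ℝ × ℝ × ℝ) (F F' M E C' : ℝ), q ∈ D → Real.exp q.2.2.2 < ν →
      1 + c * Real.exp q.2.2.2 / 2 ≤ M → 0 ≤ F → 0 ≤ C' →
      M * (F * Real.exp q.2.2.2 ^ 2) ≤ Real.exp (S (overBase (g q) q)) *
        (F' * Real.exp (p q).2.2.2 ^ 2) + E → 0 ≤ F' → E ≤ C' * Real.exp q.2.2.2 ^ 3 →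
      F ≤ (1 - c / 8 * Real.exp q.2.2.2) * F' + C' * Real.exp q.2.2.2 := by
    intro q F F' M E C' hq hqν hM hF hC' hrec hF' hE
    have e1 : Real.exp (p q).2.2.2 = Real.exp q.2.2.2 * Real.exp (S (overBase (g q) q)) := by
      rw [← Real.exp_add]; rfl
    have i3 := hS3 q hq hqν
    rw [e1] at hrec
    set h := Real.exp q.2.2.2
    set σ := Real.exp (S (overBase (g q) q))
    have hh0 : 0 < h := Real.exp_pos _
    have hh1 : h ≤ 1 := hqν.le.trans hν1
    have hM0 : 0 < M := lt_of_lt_of_le (by positivity) hM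
    have k1 : M * F ≤ σ ^ 3 * F' + C' * h := by
      have : M * F * h ^ 2 ≤ (σ ^ 3 * F' + C' * h) * h ^ 2 := by nlinarith
      exact le_of_mul_le_mul_right this (by positivity)
    have hch : c * h ≤ 1 := by nlinarith
    have hch0 : 0 < c * h := by positivity
    have k2 : σ ^ 3 ≤ (1 - c / 8 * h) * (1 + c * h / 2) := by nlinarith
    have k3 : σ ^ 3 * F' ≤ (1 - c / 8 * h) * F' * M := by
      calc σ ^ 3 * F' ≤ (1 - c / 8 * h) * (1 + c * h / 2) * F' := by gcongr
        _ ≤ (1 - c / 8 * h) * M * F' := by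
            have : 0 ≤ 1 - c / 8 * h := by linarith
            gcongr
        _ = _ := by ring
    have k4 : C' * h ≤ C' * h * M := by
      have : 0 ≤ C' * h := by positivity
      nlinarith
    refine le_of_mul_le_mul_right (a := M) ?_ hM0
    nlinarith
  -- On `r = R` the scaling would leave the base, so the relations are available only for `r < R`;
  -- `hmapsR` says that this part is preserved.
  set D' : Set (ℝ × ℝ × ℝ × ℝ) := {q | q ∈ D ∧ q.1 < R} with hD'
  have hpD : ∀ q ∈ D', p q ∈ D' := fun q hq => ⟨hmaps q hq.1, hmapsR q hq.1 hq.2⟩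
  have hmono : ∀ q ∈ D', Real.exp q.2.2.2 ≤ Real.exp (p q).2.2.2 := fun q hq => by
    have := hS0 q hq.1
    refine Real.exp_le_exp.2 ?_
    simp only [hp, scaled]; linarith
  have hch : ∀ q ∈ D', Real.exp q.2.2.2 < ν → c / 8 * Real.exp q.2.2.2 ≤ 1 := fun q _ hν' => by
    have : Real.exp q.2.2.2 ≤ 1 := hν'.le.trans hν1
    have := Real.exp_pos q.2.2.2
    nlinarith
  have hdiv : ∀ (q : ℝ × ℝ × ℝ × ℝ) (y : ℝ),
      y / Real.exp q.2.2.2 ^ 2 * Real.exp q.2.2.2 ^ 2 = y := fun q y => by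
    have := Real.exp_pos q.2.2.2
    field_simp
  have hbig : ∀ (q : ℝ × ℝ × ℝ × ℝ) (y B : ℝ), 0 ≤ B → y ≤ B → ν ≤ Real.exp q.2.2.2 →
      y / Real.exp q.2.2.2 ^ 2 ≤ B / ν ^ 2 := fun q y B hB hy hq => by
    gcongr
  have hA := bounded_of_backward_contraction (D := D') (p := p) (h := fun q => Real.exp q.2.2.2)
    (F := fun q => |a q| / Real.exp q.2.2.2 ^ 2) (c := c / 8) (C := C₀) (C₁ := Ba / ν ^ 2)
    (C₂ := Ba) (ν := ν) (by positivity) (by positivity) (fun q _ => Real.exp_pos _) hch hpD hmono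
    (fun q hq hqν => by
      obtain ⟨M, E₁, E₂, hM, hE₁, hE₂, h1, -⟩ := hrel q hq.1 hq.2 hqν
      have hM0 : 0 < M := lt_of_lt_of_le (by positivity) hM
      refine hcontr q _ _ M |E₁| C₀ hq.1 hqν hM (by positivity) hC₀0 ?_ (by positivity) hE₁
      rw [hdiv, hdiv]
      calc M * |a q| = |M * a q| := by rw [abs_mul, abs_of_pos hM0]
        _ ≤ |Real.exp (S (overBase (g q) q)) * a (p q)| + |E₁| := by rw [h1]; exact abs_add_le _ _
        _ = _ := by rw [abs_mul, abs_of_pos (Real.exp_pos _)])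
    (fun q hq hqν => hbig q _ _ hBa0 (habound q hq.1) hqν)
    (fun q hq => by rw [hdiv]; exact habound q hq.1)
  set A₀ := max (Ba / ν ^ 2) (C₀ / (c / 8)) with hA₀
  have hA₀0 : 0 ≤ A₀ := le_max_of_le_left (by positivity)
  have hkb : ∀ q ∈ D, |l q (0, 0, 0, 1)| ≤ L := fun q hq => by
    have h1 := (l q).le_opNorm (0, 0, 0, 1)
    have h2 : ‖((0, 0, 0, 1) : ℝ × ℝ × ℝ × ℝ)‖ = 1 := by simp [Prod.norm_mk]
    rw [h2, mul_one] at h1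
    exact h1.trans (hl q hq)
  have hB := bounded_of_backward_contraction (D := D') (p := p) (h := fun q => Real.exp q.2.2.2)
    (F := fun q => |l q (0, 0, 0, 1)| / Real.exp q.2.2.2 ^ 2) (c := c / 8) (C := C₀ + 2 * A₀)
    (C₁ := L / ν ^ 2) (C₂ := L) (ν := ν) (by positivity) (by positivity)
    (fun q _ => Real.exp_pos _) hch hpD hmono
    (fun q hq hqν => by
      obtain ⟨M, E₁, E₂, hM, hE₁, hE₂, -, h1⟩ := hrel q hq.1 hq.2 hqν
      have hM0 : 0 < M := lt_of_lt_of_le (by positivity) hM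
      have hap := hA (p q) (hpD q hq)
      have hS1 : 1 ≤ Real.exp (S (overBase (g q) q)) := Real.one_le_exp (hS0 q hq.1)
      have hS3' := hS3 q hq.1 hqν
      have e1 : Real.exp (p q).2.2.2 = Real.exp q.2.2.2 * Real.exp (S (overBase (g q) q)) := by
        rw [← Real.exp_add]; rfl
      rw [div_le_iff₀ (by positivity), e1] at hap
      refine hcontr q _ _ M (Real.exp q.2.2.2 * (Real.exp (S (overBase (g q) q)) * |a (p q)|)
        + |E₂|) _ hq.1 hqν hM (by positivity) (by positivity) ?_ (by positivity) ?_
      · rw [hdiv, hdiv]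
        calc M * |l q (0, 0, 0, 1)| = |M * l q (0, 0, 0, 1)| := by rw [abs_mul, abs_of_pos hM0]
          _ ≤ |l (p q) (0, 0, 0, 1)| + |Real.exp q.2.2.2 *
              (Real.exp (S (overBase (g q) q)) * a (p q))| + |E₂| := by
            rw [h1]; exact (abs_add_le _ _).trans (by gcongr; exact abs_add_le _ _)
          _ = |l (p q) (0, 0, 0, 1)| + Real.exp q.2.2.2 *
              (Real.exp (S (overBase (g q) q)) * |a (p q)|) + |E₂| := by
            rw [abs_mul, abs_mul, abs_of_pos (Real.exp_pos _), abs_of_pos (Real.exp_pos _)]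
          _ ≤ _ := by
            have := abs_nonneg (l (p q) (0, 0, 0, 1))
            nlinarith
      -- By the first estimate `a` is `O(h²)`, so the source term `h e^S a (p q)` has order `h³`
      -- like `E₂`.
      · set h := Real.exp q.2.2.2
        set σ := Real.exp (S (overBase (g q) q))
        have hh0 : 0 < h := Real.exp_pos _
        have hh1 : h ≤ 1 := hqν.le.trans hν1
        have hσ2 : σ ^ 3 ≤ 2 := by nlinarith
        have : h * (σ * |a (p q)|) ≤ 2 * A₀ * h ^ 3 := by
          calc h * (σ * |a (p q)|) ≤ h * (σ * (A₀ * (h * σ) ^ 2)) := by gcongr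
            _ = σ ^ 3 * (A₀ * h ^ 3) := by ring
            _ ≤ 2 * (A₀ * h ^ 3) := by gcongr
            _ = _ := by ring
        linarith)
    (fun q hq hqν => hbig q _ _ hL (hkb q hq.1) hqν)
    (fun q hq => by rw [hdiv]; exact hkb q hq.1)
  refine ⟨max (L / ν ^ 2) ((C₀ + 2 * A₀) / (c / 8)), le_max_of_le_left (by positivity),
    fun q hq hqR => ?_⟩
  have := hB q ⟨hq, hqR⟩
  rwa [div_le_iff₀ (by positivity)] at this

end

/-! ### Uniform Taylor estimates in logarithmic coordinates -/

theorem exists_taylor_bound {E F : Type*} [NormedAddCommGroup E] [NormedSpace ℝ E]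
    [NormedAddCommGroup F] [NormedSpace ℝ F] {Φ : E → F} {K : Set E} (hK : IsCompact K)
    (hc : Convex ℝ K) (h : ∀ z ∈ K, ContDiffAt ℝ 2 Φ z) :
    ∃ C, 0 ≤ C ∧ ∀ z ∈ K, ‖Φ z‖ ≤ C ∧ ‖fderiv ℝ Φ z‖ ≤ C ∧ ∀ z' ∈ K,
      ‖Φ z' - Φ z‖ ≤ C * ‖z' - z‖ ∧
      ‖Φ z' - Φ z - fderiv ℝ Φ z (z' - z)‖ ≤ C * ‖z' - z‖ ^ 2 := by
  have h1 : ∀ z ∈ K, ContDiffAt ℝ 1 (fderiv ℝ Φ) z := fun z hz =>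
    (h z hz).fderiv_right (by norm_num)
  have h2 : ∀ z ∈ K, ContinuousAt (fderiv ℝ (fderiv ℝ Φ)) z := fun z hz =>
    ((h1 z hz).fderiv_right (m := 0) (by norm_num)).continuousAt
  obtain ⟨C₀, hC₀⟩ := hK.exists_bound_of_continuousOn
    (fun z hz => (h z hz).continuousAt.continuousWithinAt : ContinuousOn Φ K)
  obtain ⟨C₁, hC₁⟩ := hK.exists_bound_of_continuousOn
    (fun z hz => (h1 z hz).continuousAt.continuousWithinAt : ContinuousOn (fderiv ℝ Φ) K)
  have h3 : ContinuousOn (fderiv ℝ (fderiv ℝ Φ)) K := fun z hz => (h2 z hz).continuousWithinAt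
  obtain ⟨C₂, hC₂'⟩ := hK.bddAbove_image (ContinuousOn.norm (E := E →L[ℝ] E →L[ℝ] F) h3)
  have hC₂ : ∀ z ∈ K, ‖fderiv ℝ (fderiv ℝ Φ) z‖ ≤ C₂ := fun z hz => hC₂' ⟨z, hz, rfl⟩
  have d0 : ∀ z ∈ K, DifferentiableAt ℝ Φ z := fun z hz => (h z hz).differentiableAt (by norm_num)
  have d1 : ∀ z ∈ K, DifferentiableAt ℝ (fderiv ℝ Φ) z := fun z hz =>
    (h1 z hz).differentiableAt (by norm_num)
  set C := max (max C₀ C₁) (max C₂ 0)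
  have i0 : C₀ ≤ C := (le_max_left _ _).trans (le_max_left _ _)
  have i1 : C₁ ≤ C := (le_max_right _ _).trans (le_max_left _ _)
  have i2 : C₂ ≤ C := (le_max_left _ _).trans (le_max_right _ _)
  have i3 : 0 ≤ C := (le_max_right _ _).trans (le_max_right _ _)
  refine ⟨C, i3, fun z hz => ⟨(hC₀ z hz).trans i0, (hC₁ z hz).trans i1, fun z' hz' => ⟨?_, ?_⟩⟩⟩
  · exact hc.norm_image_sub_le_of_norm_fderiv_le d0 (fun x hx => (hC₁ x hx).trans i1) hz hz'
  · have hs := hc.segment_subset hz hz'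
    have hd : ∀ x ∈ segment ℝ z z', ‖fderiv ℝ Φ x - fderiv ℝ Φ z‖ ≤ C * ‖z' - z‖ := by
      intro x hx
      refine (hc.norm_image_sub_le_of_norm_fderiv_le d1 (fun x hx => (hC₂ x hx).trans i2) hz
        (hs hx)).trans ?_
      gcongr
      have := norm_sub_le_of_mem_segment hx
      exact this
    have := (convex_segment z z').norm_image_sub_le_of_norm_hasFDerivWithin_le' (f := Φ)
      (f' := fderiv ℝ Φ) (φ := fderiv ℝ Φ z) (C := C * ‖z' - z‖)
      (fun x hx => (d0 x (hs hx)).hasFDerivAt.hasFDerivWithinAt) hd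
      (left_mem_segment ℝ z z') (right_mem_segment ℝ z z')
    rw [pow_two, ← mul_assoc]
    exact this

/-- The compact set of all `(δ, x, r, e, m, h)` over `logBox R κ T`, with `x` in `J`. -/
def stepBox (d : ℝ) (J : Set ℝ) (R κ T : ℝ) : Set (ℝ × ℝ × ℝ × ℝ × ℝ × ℝ) :=
  Icc 0 d ×ˢ J ×ˢ Icc 0 R ×ˢ Icc 0 1 ×ˢ Icc (-κ) κ ×ˢ Icc 0 (Real.exp T)

theorem overBase_mem_stepBox {J : Set ℝ} {d R κ T δ x : ℝ} {q : ℝ × ℝ × ℝ × ℝ}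
    (hδ : δ ∈ Icc 0 d) (hx : x ∈ J) (hq : q ∈ logBox R κ T) :
    (δ, overBase x q) ∈ stepBox d J R κ T :=
  ⟨hδ, hx, hq.1, hq.2.1, hq.2.2.1, (Real.exp_pos _).le, Real.exp_le_exp.2 hq.2.2.2⟩

theorem isCompact_stepBox {d a b R κ T : ℝ} : IsCompact (stepBox d (Icc a b) R κ T) :=
  isCompact_Icc.prod (isCompact_Icc.prod (isCompact_Icc.prod (isCompact_Icc.prod
    (isCompact_Icc.prod isCompact_Icc))))

theorem convex_stepBox {d a b R κ T : ℝ} : Convex ℝ (stepBox d (Icc a b) R κ T) :=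
  (convex_Icc _ _).prod ((convex_Icc _ _).prod ((convex_Icc _ _).prod ((convex_Icc _ _).prod
    ((convex_Icc _ _).prod (convex_Icc _ _)))))

/-- The derivative of `q ↦ (δ, overBase x q)` with respect to the base point. -/
noncomputable def baseDeriv (h : ℝ) : (ℝ × ℝ × ℝ × ℝ) →L[ℝ] (ℝ × ℝ × ℝ × ℝ × ℝ × ℝ) :=
  (0 : (ℝ × ℝ × ℝ × ℝ) →L[ℝ] ℝ).prod ((0 : (ℝ × ℝ × ℝ × ℝ) →L[ℝ] ℝ).prod
    ((ContinuousLinearMap.fst ℝ ℝ (ℝ × ℝ × ℝ)).prod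
    (((ContinuousLinearMap.fst ℝ ℝ (ℝ × ℝ)).comp (ContinuousLinearMap.snd ℝ ℝ (ℝ × ℝ × ℝ))).prod
    (((ContinuousLinearMap.fst ℝ ℝ ℝ).comp ((ContinuousLinearMap.snd ℝ ℝ (ℝ × ℝ)).comp
      (ContinuousLinearMap.snd ℝ ℝ (ℝ × ℝ × ℝ)))).prod
    (h • (ContinuousLinearMap.snd ℝ ℝ ℝ).comp ((ContinuousLinearMap.snd ℝ ℝ (ℝ × ℝ)).comp
      (ContinuousLinearMap.snd ℝ ℝ (ℝ × ℝ × ℝ))))))))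

theorem baseDeriv_apply (h : ℝ) (v : ℝ × ℝ × ℝ × ℝ) :
    baseDeriv h v = (0, 0, v.1, v.2.1, v.2.2.1, h * v.2.2.2) := rfl

theorem norm_coords_le (v : ℝ × ℝ × ℝ × ℝ) :
    |v.1| ≤ ‖v‖ ∧ |v.2.1| ≤ ‖v‖ ∧ |v.2.2.1| ≤ ‖v‖ ∧ |v.2.2.2| ≤ ‖v‖ :=
  ⟨norm_fst_le v, (norm_fst_le v.2).trans (norm_snd_le v),
    (norm_fst_le v.2.2).trans ((norm_snd_le v.2).trans (norm_snd_le v)),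
    (norm_snd_le v.2.2).trans ((norm_snd_le v.2).trans (norm_snd_le v))⟩

theorem norm_baseDeriv_le {h b : ℝ} (h0 : 0 ≤ h) (hb : h ≤ b) (hb1 : 1 ≤ b) :
    ‖baseDeriv h‖ ≤ b := by
  refine ContinuousLinearMap.opNorm_le_bound _ (by linarith) fun v => ?_
  obtain ⟨i1, i2, i3, i4⟩ := norm_coords_le v
  have hv := norm_nonneg v
  rw [baseDeriv_apply]
  simp only [Prod.norm_mk, norm_zero, Real.norm_eq_abs, abs_mul, abs_of_nonneg h0]
  have : ‖v‖ ≤ b * ‖v‖ := by nlinarith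
  have : 0 ≤ b * ‖v‖ := by positivity
  refine max_le this (max_le this (max_le (by linarith) (max_le (by linarith)
    (max_le (by linarith) ?_))))
  exact mul_le_mul hb i4 (abs_nonneg _) (by linarith)

theorem exp_sub_le {s t T : ℝ} (hs : s ≤ T) (ht : t ≤ T) :
    |Real.exp t - Real.exp s| ≤ Real.exp T * |t - s| := by
  have := (convex_Iic T).norm_image_sub_le_of_norm_deriv_le (f := Real.exp) (C := Real.exp T)
    (fun x _ => Real.differentiableAt_exp) (fun x hx => by
      rw [Real.deriv_exp, Real.norm_eq_abs, abs_of_pos (Real.exp_pos _)]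
      exact Real.exp_le_exp.2 hx) hs ht
  exact this

theorem exp_taylor_le {s t T : ℝ} (hs : s ≤ T) (ht : t ≤ T) :
    |Real.exp t - Real.exp s - Real.exp s * (t - s)| ≤ Real.exp T * |t - s| ^ 2 := by
  have hd : ∀ x, HasDerivAt (fun x => Real.exp x - Real.exp s * x) (Real.exp x - Real.exp s) x :=
    fun x => by
      have := (Real.hasDerivAt_exp x).sub ((hasDerivAt_id x).const_mul (Real.exp s))
      rw [mul_one] at this
      exact this
  have := (convex_uIcc s t).norm_image_sub_le_of_norm_hasDerivWithin_le
    (C := Real.exp T * |t - s|) (fun x _ => (hd x).hasDerivWithinAt) (fun x hx => by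
      have hxT : x ≤ T := hx.2.trans (max_le hs ht)
      refine (exp_sub_le hs hxT).trans ?_
      have : |x - s| ≤ |t - s| := abs_sub_left_of_mem_uIcc hx
      gcongr) left_mem_uIcc right_mem_uIcc
  rw [Real.norm_eq_abs, Real.norm_eq_abs] at this
  rw [pow_two, ← mul_assoc]
  refine le_trans (le_of_eq ?_) this
  congr 1
  ring

section

variable {F : Type*} [NormedAddCommGroup F] [NormedSpace ℝ F]
  {Φ : ℝ × ℝ × ℝ × ℝ × ℝ × ℝ → F} {d a b R κ T : ℝ}

/-- A smooth function of the step size has bounded second order jets in the logarithm of it. -/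
theorem exists_log_taylor_bound (h : ∀ z ∈ stepBox d (Icc a b) R κ T, ContDiffAt ℝ 2 Φ z) :
    ∃ C, 0 ≤ C ∧ ∀ δ ∈ Icc 0 d, ∀ x ∈ Icc a b, ∀ q ∈ logBox R κ T,
      ‖Φ (δ, overBase x q)‖ ≤ C ∧ ‖fderiv ℝ Φ (δ, overBase x q) (0, 1, 0, 0, 0, 0)‖ ≤ C ∧
      ∃ l : (ℝ × ℝ × ℝ × ℝ) →L[ℝ] F, ‖l‖ ≤ C ∧ ∀ x' ∈ Icc a b, ∀ q' ∈ logBox R κ T,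
        ‖Φ (δ, overBase x' q') - Φ (δ, overBase x q)‖ ≤ C * (|x' - x| + ‖q' - q‖) ∧
        ‖Φ (δ, overBase x' q') - Φ (δ, overBase x q) - (x' - x) •
          fderiv ℝ Φ (δ, overBase x q) (0, 1, 0, 0, 0, 0) - l (q' - q)‖
          ≤ C * (|x' - x| + ‖q' - q‖) ^ 2 := by
  obtain ⟨C₀, hC₀, hC⟩ := exists_taylor_bound isCompact_stepBox convex_stepBox h
  -- `M` bounds the derivatives of all orders of the substitution `h = e^τ` on `τ ≤ T`. Although the
  -- domain is unbounded in `τ`, the points `(δ, overBase x q)` stay in a compact box.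
  set M := max 1 (Real.exp T)
  have hM1 : 1 ≤ M := le_max_left _ _
  have hMT : Real.exp T ≤ M := le_max_right _ _
  refine ⟨2 * C₀ * M ^ 2, by positivity, fun δ hδ x hx q hq => ?_⟩
  obtain ⟨b1, b2, b3⟩ := hC _ (overBase_mem_stepBox hδ hx hq)
  have hM2 : 1 ≤ M ^ 2 := one_le_pow₀ hM1
  have hMM : M ≤ M ^ 2 := by nlinarith
  have k1 : C₀ ≤ 2 * C₀ * M ^ 2 := by nlinarith
  have k2 : C₀ * M ≤ 2 * C₀ * M ^ 2 := by
    have : 0 ≤ C₀ * M := by positivity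
    nlinarith
  refine ⟨b1.trans k1, ?_, (fderiv ℝ Φ (δ, overBase x q)).comp (baseDeriv (Real.exp q.2.2.2)),
    ?_, fun x' hx' q' hq' => ?_⟩
  · refine ((fderiv ℝ Φ (δ, overBase x q)).le_opNorm _).trans ?_
    have : ‖((0, 1, 0, 0, 0, 0) : ℝ × ℝ × ℝ × ℝ × ℝ × ℝ)‖ = 1 := by simp [Prod.norm_mk]
    rw [this, mul_one]
    exact b2.trans k1
  · refine (ContinuousLinearMap.opNorm_comp_le _ _).trans (le_trans ?_ k2)
    have := norm_baseDeriv_le (Real.exp_pos q.2.2.2).le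
      ((Real.exp_le_exp.2 hq.2.2.2).trans hMT) hM1
    gcongr
  · obtain ⟨b4, b5⟩ := b3 _ (overBase_mem_stepBox hδ hx' hq')
    set D := |x' - x| + ‖q' - q‖
    obtain ⟨i1, i2, i3, i4⟩ := norm_coords_le (q' - q)
    have hx0 := abs_nonneg (x' - x)
    have hq0 := norm_nonneg (q' - q)
    have hD0 : 0 ≤ D := by positivity
    have hDM : D ≤ M * D := by nlinarith
    have hz : ‖((δ, overBase x' q') - (δ, overBase x q) : ℝ × ℝ × ℝ × ℝ × ℝ × ℝ)‖ ≤ M * D := by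
      have e : ((δ, overBase x' q') - (δ, overBase x q) : ℝ × ℝ × ℝ × ℝ × ℝ × ℝ) =
        (0, x' - x, (q' - q).1, (q' - q).2.1, (q' - q).2.2.1,
          Real.exp q'.2.2.2 - Real.exp q.2.2.2) := by simp [overBase]
      rw [e]
      simp only [Prod.norm_mk, norm_zero, Real.norm_eq_abs]
      refine max_le (by positivity) (max_le (by linarith) (max_le (by linarith)
        (max_le (by linarith) (max_le (by linarith) ?_))))
      refine (exp_sub_le hq.2.2.2 hq'.2.2.2).trans (mul_le_mul hMT ?_ (abs_nonneg _) (by linarith))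
      exact i4.trans (by linarith)
    constructor
    · calc _ ≤ C₀ * (M * D) := b4.trans (by gcongr)
        _ = C₀ * M * D := by ring
        _ ≤ _ := by gcongr
    · have e : ((δ, overBase x' q') - (δ, overBase x q) : ℝ × ℝ × ℝ × ℝ × ℝ × ℝ) =
          (x' - x) • (0, 1, 0, 0, 0, 0) + baseDeriv (Real.exp q.2.2.2) (q' - q) +
          (0, 0, 0, 0, 0, Real.exp q'.2.2.2 - Real.exp q.2.2.2
            - Real.exp q.2.2.2 * (q'.2.2.2 - q.2.2.2)) := by
        rw [baseDeriv_apply]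
        simp [overBase]
      have i5 : ‖fderiv ℝ Φ (δ, overBase x q) (0, 0, 0, 0, 0, Real.exp q'.2.2.2
          - Real.exp q.2.2.2 - Real.exp q.2.2.2 * (q'.2.2.2 - q.2.2.2))‖ ≤ C₀ * (M * D ^ 2) := by
        refine ((fderiv ℝ Φ (δ, overBase x q)).le_opNorm _).trans ?_
        refine mul_le_mul b2 ?_ (norm_nonneg _) hC₀
        simp only [Prod.norm_mk, norm_zero, Real.norm_eq_abs]
        have h6 := exp_taylor_le hq.2.2.2 hq'.2.2.2
        have h7 : Real.exp T * |q'.2.2.2 - q.2.2.2| ^ 2 ≤ M * D ^ 2 := by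
          have : |q'.2.2.2 - q.2.2.2| ≤ D := i4.trans (by linarith)
          gcongr
        have h8 : 0 ≤ M * D ^ 2 := by positivity
        simp only [max_le_iff]
        exact ⟨h8, h8, h8, h8, h8, h6.trans h7⟩
      rw [e, map_add, map_add, map_smul] at b5
      rw [← e] at b5
      have i6 : ‖Φ (δ, overBase x' q') - Φ (δ, overBase x q) - (x' - x) •
          fderiv ℝ Φ (δ, overBase x q) (0, 1, 0, 0, 0, 0) -
          fderiv ℝ Φ (δ, overBase x q) (baseDeriv (Real.exp q.2.2.2) (q' - q))‖ ≤
          C₀ * (M * D) ^ 2 + C₀ * (M * D ^ 2) := by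
        refine le_trans (le_of_eq ?_) ((norm_add_le _ _).trans (add_le_add
          (b5.trans (by gcongr)) i5))
        congr 1
        abel
      refine i6.trans ?_
      have : C₀ * (M * D ^ 2) ≤ C₀ * (M ^ 2 * D ^ 2) := by gcongr
      nlinarith

/-- Weighted version of `exists_log_taylor_bound` for an increment proportional to the step. -/
theorem exists_weighted_taylor_bound (h : ∀ z ∈ stepBox d (Icc a b) R κ T, ContDiffAt ℝ 2 Φ z) :
    ∃ C, 0 ≤ C ∧ ∀ δ ∈ Icc 0 d, ∀ x ∈ Icc a b, ∀ q ∈ logBox R κ T,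
      ‖Φ (δ, overBase x q)‖ ≤ C ∧ ‖fderiv ℝ Φ (δ, overBase x q) (0, 1, 0, 0, 0, 0)‖ ≤ C ∧
      ∃ l : (ℝ × ℝ × ℝ × ℝ) →L[ℝ] F, ‖l‖ ≤ C * Real.exp q.2.2.2 ∧
        ∀ x' ∈ Icc a b, ∀ q' ∈ logBox R κ T, ‖q' - q‖ ≤ 1 →
        ‖Real.exp q'.2.2.2 • Φ (δ, overBase x' q') - Real.exp q.2.2.2 • Φ (δ, overBase x q)‖
          ≤ C * Real.exp q.2.2.2 * (|x' - x| + ‖q' - q‖) ∧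
        ‖Real.exp q'.2.2.2 • Φ (δ, overBase x' q') - Real.exp q.2.2.2 • Φ (δ, overBase x q)
          - (x' - x) • (Real.exp q.2.2.2 • fderiv ℝ Φ (δ, overBase x q) (0, 1, 0, 0, 0, 0))
          - l (q' - q)‖ ≤ C * Real.exp q.2.2.2 * (|x' - x| + ‖q' - q‖) ^ 2 := by
  obtain ⟨C, hC0, hC⟩ := exists_log_taylor_bound h
  refine ⟨5 * C, by positivity, fun δ hδ x hx q hq => ?_⟩
  obtain ⟨b1, b2, l, hl, b3⟩ := hC δ hδ x hx q hq
  set τ := q.2.2.2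
  have hτ := Real.exp_pos τ
  set Φ₀ := Φ (δ, overBase x q)
  set lτ : (ℝ × ℝ × ℝ × ℝ) →L[ℝ] ℝ := (ContinuousLinearMap.snd ℝ ℝ ℝ).comp
    ((ContinuousLinearMap.snd ℝ ℝ (ℝ × ℝ)).comp (ContinuousLinearMap.snd ℝ ℝ (ℝ × ℝ × ℝ)))
  have hlτ : ∀ v, lτ v = v.2.2.2 := fun _ => rfl
  -- Product rule: differentiating the factor `e^τ` contributes `e^τ Φ₀` in the direction of `τ`.
  refine ⟨by linarith, by linarith, Real.exp τ • l + Real.exp τ • lτ.smulRight Φ₀, ?_,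
    fun x' hx' q' hq' hqq => ?_⟩
  · refine ContinuousLinearMap.opNorm_le_bound _ (by positivity) fun v => ?_
    obtain ⟨-, -, -, i4⟩ := norm_coords_le v
    have j1 := (l.le_opNorm v).trans (mul_le_mul_of_nonneg_right hl (norm_nonneg v))
    have j2 : ‖v.2.2.2 • Φ₀‖ ≤ ‖v‖ * C := by
      rw [norm_smul]; exact mul_le_mul i4 b1 (norm_nonneg _) (norm_nonneg _)
    calc ‖Real.exp τ • l v + Real.exp τ • (v.2.2.2 • Φ₀)‖
        ≤ Real.exp τ * (C * ‖v‖) + Real.exp τ * (‖v‖ * C) := by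
          refine (norm_add_le _ _).trans ?_
          rw [norm_smul, norm_smul (Real.exp τ), Real.norm_eq_abs, abs_of_pos hτ]
          gcongr
      _ ≤ _ := by
          have : 0 ≤ Real.exp τ * (C * ‖v‖) := by positivity
          nlinarith
  · obtain ⟨b4, b5⟩ := b3 x' hx' q' hq'
    obtain ⟨-, -, -, i4⟩ := norm_coords_le (q' - q)
    change |q'.2.2.2 - τ| ≤ _ at i4
    set s := q'.2.2.2 - τ with hs
    set D := |x' - x| + ‖q' - q‖
    have hx0 := abs_nonneg (x' - x)
    have hsd : |s| ≤ D := i4.trans (by linarith)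
    have hs1 : |s| ≤ 1 := i4.trans hqq
    -- The factor `e^τ` at the first point is pulled out. This needs `‖q' - q‖ ≤ 1`, for then `e^s -
    -- 1` is `O(|s|)` with a uniform constant.
    have hexp : Real.exp q'.2.2.2 = Real.exp τ * Real.exp s := by
      rw [← Real.exp_add]; congr 1; rw [hs]; ring
    have t1 : |Real.exp s - 1| ≤ 2 * |s| := Real.abs_exp_sub_one_le hs1
    have t2 : |Real.exp s - 1 - s| ≤ |s| ^ 2 := by
      rw [sq_abs]; exact Real.abs_exp_sub_one_sub_id_le hs1
    have hD0 : 0 ≤ D := (abs_nonneg _).trans hsd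
    have t3 : Real.exp s ≤ 3 := by
      have := (abs_le.1 t1).2
      linarith
    have hes := Real.exp_pos s
    set Φ₁ := Φ (δ, overBase x' q')
    rw [hexp]
    constructor
    · have e : (Real.exp τ * Real.exp s) • Φ₁ - Real.exp τ • Φ₀ =
          Real.exp τ • (Real.exp s • (Φ₁ - Φ₀) + (Real.exp s - 1) • Φ₀) := by module
      rw [e, norm_smul, Real.norm_eq_abs, abs_of_pos hτ]
      have : ‖Real.exp s • (Φ₁ - Φ₀) + (Real.exp s - 1) • Φ₀‖ ≤ 3 * (C * D) + 2 * D * C := by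
        refine (norm_add_le _ _).trans ?_
        rw [norm_smul, norm_smul, Real.norm_eq_abs, Real.norm_eq_abs, abs_of_pos hes]
        have : |Real.exp s - 1| ≤ 2 * D := t1.trans (by linarith)
        gcongr
      calc _ ≤ Real.exp τ * (3 * (C * D) + 2 * D * C) := by gcongr
        _ = _ := by ring
    · have e : (Real.exp τ * Real.exp s) • Φ₁ - Real.exp τ • Φ₀
          - (x' - x) • (Real.exp τ • fderiv ℝ Φ (δ, overBase x q) (0, 1, 0, 0, 0, 0))
          - (Real.exp τ • l + Real.exp τ • lτ.smulRight Φ₀) (q' - q) =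
          Real.exp τ • ((Φ₁ - Φ₀ - (x' - x) • fderiv ℝ Φ (δ, overBase x q) (0, 1, 0, 0, 0, 0)
            - l (q' - q)) + ((Real.exp s - 1) • (Φ₁ - Φ₀) + (Real.exp s - 1 - s) • Φ₀)) := by
        have : (Real.exp τ • l + Real.exp τ • lτ.smulRight Φ₀) (q' - q) =
          Real.exp τ • l (q' - q) + Real.exp τ • (s • Φ₀) := rfl
        rw [this]
        module
      rw [e, norm_smul, Real.norm_eq_abs, abs_of_pos hτ]
      have : ‖(Φ₁ - Φ₀ - (x' - x) • fderiv ℝ Φ (δ, overBase x q) (0, 1, 0, 0, 0, 0)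
            - l (q' - q)) + ((Real.exp s - 1) • (Φ₁ - Φ₀) + (Real.exp s - 1 - s) • Φ₀)‖ ≤
          C * D ^ 2 + (2 * D * (C * D) + D ^ 2 * C) := by
        refine (norm_add_le _ _).trans (add_le_add b5 ((norm_add_le _ _).trans ?_))
        rw [norm_smul, norm_smul, Real.norm_eq_abs, Real.norm_eq_abs]
        have : |Real.exp s - 1| ≤ 2 * D := t1.trans (by linarith)
        have : |Real.exp s - 1 - s| ≤ D ^ 2 := t2.trans (by gcongr)
        gcongr
      calc _ ≤ Real.exp τ * (C * D ^ 2 + (2 * D * (C * D) + D ^ 2 * C)) := by gcongr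
        _ ≤ _ := by
          have : 0 ≤ Real.exp τ * (C * D ^ 2) := by positivity
          nlinarith

end

/-! ### Expansions in powers of the step size -/

/-- `f = a + h b + h² R` on `U` with smooth `a`, `b`, `R`, where `h` is the last coordinate of
`(x, r, ε, m, h)`. -/
def HasStepExpansion (U : Set (ℝ × ℝ × ℝ × ℝ × ℝ)) (f a b : ℝ × ℝ × ℝ × ℝ × ℝ → ℝ) : Prop :=
  ContDiffOn ℝ ∞ a U ∧ ContDiffOn ℝ ∞ b U ∧ ∃ R, ContDiffOn ℝ ∞ R U ∧
    ∀ w ∈ U, f w = a w + w.2.2.2.2 * b w + w.2.2.2.2 ^ 2 * R w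

namespace HasStepExpansion

variable {U : Set (ℝ × ℝ × ℝ × ℝ × ℝ)} {f a b f' a' b' : ℝ × ℝ × ℝ × ℝ × ℝ → ℝ}

theorem contDiffOn_step : ContDiffOn ℝ ∞ (fun w : ℝ × ℝ × ℝ × ℝ × ℝ => w.2.2.2.2) U := by
  fun_prop

theorem contDiffOn (hf : HasStepExpansion U f a b) : ContDiffOn ℝ ∞ f U := by
  obtain ⟨ha, hb, R, hR, h⟩ := hf
  have hh : ContDiffOn ℝ ∞ (fun w : ℝ × ℝ × ℝ × ℝ × ℝ => w.2.2.2.2) U := contDiffOn_step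
  exact ((ha.add (hh.mul hb)).add ((hh.pow 2).mul hR)).congr h

theorem congr (hf : HasStepExpansion U f a b) (h : ∀ w ∈ U, f' w = f w)
    (h₁ : ∀ w ∈ U, a' w = a w) (h₂ : ∀ w ∈ U, b' w = b w) : HasStepExpansion U f' a' b' := by
  obtain ⟨ha, hb, R, hR, hf⟩ := hf
  exact ⟨ha.congr h₁, hb.congr h₂, R, hR, fun w hw => by rw [h w hw, h₁ w hw, h₂ w hw, hf w hw]⟩

theorem of_eq (ha : ContDiffOn ℝ ∞ a U) (hb : ContDiffOn ℝ ∞ b U)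
    {R : ℝ × ℝ × ℝ × ℝ × ℝ → ℝ} (hR : ContDiffOn ℝ ∞ R U)
    (h : ∀ w, f w = a w + w.2.2.2.2 * b w + w.2.2.2.2 ^ 2 * R w) : HasStepExpansion U f a b :=
  ⟨ha, hb, R, hR, fun w _ => h w⟩

theorem add (hf : HasStepExpansion U f a b) (hf' : HasStepExpansion U f' a' b') :
    HasStepExpansion U (fun w => f w + f' w) (fun w => a w + a' w) (fun w => b w + b' w) := by
  obtain ⟨ha, hb, R, hR, h⟩ := hf
  obtain ⟨ha', hb', R', hR', h'⟩ := hf'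
  exact ⟨ha.add ha', hb.add hb', _, hR.add hR', fun w hw => by
    beta_reduce; rw [h w hw, h' w hw]; ring⟩

theorem mul (hf : HasStepExpansion U f a b) (hf' : HasStepExpansion U f' a' b') :
    HasStepExpansion U (fun w => f w * f' w) (fun w => a w * a' w)
      (fun w => a w * b' w + b w * a' w) := by
  obtain ⟨ha, hb, R, hR, h⟩ := hf
  obtain ⟨ha', hb', R', hR', h'⟩ := hf'
  have hh : ContDiffOn ℝ ∞ (fun w : ℝ × ℝ × ℝ × ℝ × ℝ => w.2.2.2.2) U := contDiffOn_step
  refine ⟨ha.mul ha', (ha.mul hb').add (hb.mul ha'), fun w => b w * b' w + a w * R' w + R w * a' w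
    + w.2.2.2.2 * (b w * R' w + R w * b' w) + w.2.2.2.2 ^ 2 * (R w * R' w), ?_, fun w hw => ?_⟩
  · exact ((((hb.mul hb').add (ha.mul hR')).add (hR.mul ha')).add
      (hh.mul ((hb.mul hR').add (hR.mul hb')))).add ((hh.pow 2).mul (hR.mul hR'))
  · beta_reduce; rw [h w hw, h' w hw]; ring

theorem inv (hf : HasStepExpansion U f (fun _ => 1) b) (h0 : ∀ w ∈ U, f w ≠ 0) :
    HasStepExpansion U (fun w => (f w)⁻¹) (fun _ => 1) (fun w => -b w) := by
  have hfs := hf.contDiffOn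
  obtain ⟨ha, hb, R, hR, h⟩ := hf
  have hh : ContDiffOn ℝ ∞ (fun w : ℝ × ℝ × ℝ × ℝ × ℝ => w.2.2.2.2) U := contDiffOn_step
  refine ⟨ha, hb.neg, fun w => -R w + (b w + w.2.2.2.2 * R w) ^ 2 * (f w)⁻¹, ?_, fun w hw => ?_⟩
  · exact hR.neg.add (((hb.add (hh.mul hR)).pow 2).mul (hfs.inv h0))
  · have := h0 w hw
    field_simp
    rw [h w hw]
    ring

theorem contDiffOn_sqrt (hf : HasStepExpansion U f a b)
    (h0 : ∀ w ∈ U, 0 < 1 + w.2.2.2.2 * f w) :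
    ContDiffOn ℝ ∞ (fun w => √(1 + w.2.2.2.2 * f w)) U :=
  (contDiffOn_const.add (contDiffOn_step.mul hf.contDiffOn)).sqrt fun w hw => (h0 w hw).ne'

/-- With `σ = √(1 + h f)` one has `h f = σ² - 1`, so the Taylor remainder of `(1 + t)^{-1/2}` is a
rational function of `σ` whose poles lie at `σ = 0, -1` only. It is written down explicitly and
checked by algebra. -/
theorem inv_sqrt (hf : HasStepExpansion U f a b) (h0 : ∀ w ∈ U, 0 < 1 + w.2.2.2.2 * f w) :
    HasStepExpansion U (fun w => (√(1 + w.2.2.2.2 * f w))⁻¹) (fun _ => 1) (fun w => -a w / 2) := by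
  have hs := hf.contDiffOn_sqrt h0
  have hfs := hf.contDiffOn
  obtain ⟨ha, hb, R, hR, h⟩ := hf
  have hh : ContDiffOn ℝ ∞ (fun w : ℝ × ℝ × ℝ × ℝ × ℝ => w.2.2.2.2) U := contDiffOn_step
  have hp : ∀ w ∈ U, 0 < √(1 + w.2.2.2.2 * f w) := fun w hw => Real.sqrt_pos.2 (h0 w hw)
  refine ⟨contDiffOn_const, ha.neg.div_const 2, fun w => -(b w + w.2.2.2.2 * R w) / 2 +
    f w ^ 2 * (2 + √(1 + w.2.2.2.2 * f w)) /
      (2 * √(1 + w.2.2.2.2 * f w) * (1 + √(1 + w.2.2.2.2 * f w)) ^ 2), ?_, fun w hw => ?_⟩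
  · refine ((hb.add (hh.mul hR)).neg.div_const 2).add (((hfs.pow 2).mul
      (contDiffOn_const.add hs)).div ((contDiffOn_const.mul hs).mul
      ((contDiffOn_const.add hs).pow 2)) fun w hw => ?_)
    have := hp w hw
    positivity
  · have h1 := hp w hw
    have h2 : √(1 + w.2.2.2.2 * f w) ^ 2 = 1 + w.2.2.2.2 * f w := Real.sq_sqrt (h0 w hw).le
    beta_reduce
    set σ := √(1 + w.2.2.2.2 * f w)
    have h4 : 1 + w.2.2.2.2 * (-a w / 2) + w.2.2.2.2 ^ 2 * (-(b w + w.2.2.2.2 * R w) / 2 +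
        f w ^ 2 * (2 + σ) / (2 * σ * (1 + σ) ^ 2)) =
        1 - (w.2.2.2.2 * f w) / 2 +
          (w.2.2.2.2 * f w) ^ 2 * (2 + σ) / (2 * σ * (1 + σ) ^ 2) := by
      linear_combination (w.2.2.2.2 / 2) * h w hw
    rw [h4]
    have h5 : w.2.2.2.2 * f w = σ ^ 2 - 1 := by linarith
    rw [h5]
    field_simp
    ring

/-- Multiplied by `h`, the function is `1 - 1/σ`: the relative change of `x` when it is divided by
`σ`. Writing it without division by `h` keeps it smooth at `h = 0`; the remainder is again rational
in `σ`. -/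
theorem sqrt_quotient (hf : HasStepExpansion U f a b) (h0 : ∀ w ∈ U, 0 < 1 + w.2.2.2.2 * f w) :
    HasStepExpansion U
      (fun w => f w / ((√(1 + w.2.2.2.2 * f w) + 1) * √(1 + w.2.2.2.2 * f w)))
      (fun w => a w / 2) (fun w => b w / 2 - 3 / 8 * a w ^ 2) := by
  have hs := hf.contDiffOn_sqrt h0
  have hfs := hf.contDiffOn
  obtain ⟨ha, hb, R, hR, h⟩ := hf
  have hh : ContDiffOn ℝ ∞ (fun w : ℝ × ℝ × ℝ × ℝ × ℝ => w.2.2.2.2) U := contDiffOn_step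
  have hp : ∀ w ∈ U, 0 < √(1 + w.2.2.2.2 * f w) := fun w hw => Real.sqrt_pos.2 (h0 w hw)
  refine ⟨ha.div_const 2, (hb.div_const 2).sub (contDiffOn_const.mul (ha.pow 2)), fun w =>
    R w / 2 - 3 / 8 * ((b w + w.2.2.2.2 * R w) * (f w + a w)) +
    f w ^ 3 * (3 * √(1 + w.2.2.2.2 * f w) ^ 2 + 9 * √(1 + w.2.2.2.2 * f w) + 8) /
      (8 * √(1 + w.2.2.2.2 * f w) * (1 + √(1 + w.2.2.2.2 * f w)) ^ 3), ?_, fun w hw => ?_⟩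
  · refine ((hR.div_const 2).sub (contDiffOn_const.mul ((hb.add (hh.mul hR)).mul
      (hfs.add ha)))).add (((hfs.pow 3).mul (((contDiffOn_const.mul (hs.pow 2)).add
      (contDiffOn_const.mul hs)).add contDiffOn_const)).div ((contDiffOn_const.mul hs).mul
      ((contDiffOn_const.add hs).pow 3)) fun w hw => ?_)
    have := hp w hw
    positivity
  · have h1 := hp w hw
    have h2 : √(1 + w.2.2.2.2 * f w) ^ 2 = 1 + w.2.2.2.2 * f w := Real.sq_sqrt (h0 w hw).le
    beta_reduce
    set σ := √(1 + w.2.2.2.2 * f w)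
    have h4 : a w / 2 + w.2.2.2.2 * (b w / 2 - 3 / 8 * a w ^ 2) + w.2.2.2.2 ^ 2 *
        (R w / 2 - 3 / 8 * ((b w + w.2.2.2.2 * R w) * (f w + a w)) +
          f w ^ 3 * (3 * σ ^ 2 + 9 * σ + 8) / (8 * σ * (1 + σ) ^ 3)) =
        f w * (1 / 2 - 3 / 8 * (w.2.2.2.2 * f w) +
          (w.2.2.2.2 * f w) ^ 2 * (3 * σ ^ 2 + 9 * σ + 8) / (8 * σ * (1 + σ) ^ 3)) := by
      linear_combination (-1 / 2 + 3 / 8 * w.2.2.2.2 * (f w + a w)) * h w hw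
    rw [h4]
    have h5 : w.2.2.2.2 * f w = σ ^ 2 - 1 := by linarith
    rw [h5]
    field_simp
    ring

end HasStepExpansion

theorem analyticAt_dslope {f : ℝ → ℝ} {a b : ℝ} (hb : AnalyticAt ℝ f b) :
    AnalyticAt ℝ (dslope f a) b := by
  rcases eq_or_ne b a with rfl | hne
  · obtain ⟨p, hp⟩ := hb
    exact hp.has_fpower_series_dslope_fslope.analyticAt
  · have h1 : AnalyticAt ℝ (fun y => (y - a)⁻¹ * (f y - f a)) b :=
      ((analyticAt_id.sub analyticAt_const).inv (sub_ne_zero.2 hne)).mul (hb.sub analyticAt_const)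
    refine h1.congr ?_
    filter_upwards [isOpen_ne.mem_nhds hne] with y hy
    rw [dslope_of_ne _ hy, slope_def_field]
    ring

/-- The function `log y / (y - 1)`, extended to `y = 1`. -/
noncomputable def logQuot : ℝ → ℝ := dslope Real.log 1

theorem log_eq_mul_logQuot (y : ℝ) : Real.log y = (y - 1) * logQuot y := by
  have := sub_smul_dslope Real.log 1 y
  rw [Real.log_one, sub_zero, smul_eq_mul] at this
  exact this.symm

theorem analyticAt_logQuot {y : ℝ} (hy : 0 < y) : AnalyticAt ℝ logQuot y :=
  analyticAt_dslope (analyticAt_log hy)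

theorem logQuot_one : logQuot 1 = 1 := by simp [logQuot, dslope_same]

/-- Third order Taylor expansion of the logarithm with analytic remainder. -/
theorem exists_log_expansion : ∃ L : ℝ → ℝ, (∀ y, 0 < y → AnalyticAt ℝ L y) ∧
    ∀ y, logQuot y = 1 - (y - 1) / 2 + (y - 1) ^ 2 * L y := by
  set L₂ := dslope logQuot 1 with hL₂
  have h2 : ∀ y, 0 < y → AnalyticAt ℝ L₂ y := fun y hy => analyticAt_dslope (analyticAt_logQuot hy)
  have e1 : ∀ y, logQuot y = 1 + (y - 1) * L₂ y := fun y => by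
    have := sub_smul_dslope logQuot 1 y
    rw [logQuot_one, smul_eq_mul] at this
    linarith
  have e2 : ∀ y, L₂ y = L₂ 1 + (y - 1) * dslope L₂ 1 y := fun y => by
    have := sub_smul_dslope L₂ 1 y
    rw [smul_eq_mul] at this
    linarith
  -- Differentiating `log y = (y - 1)(1 + (y - 1) L₂ y)` and letting `y → 1` gives the coefficient
  -- `L₂ 1 = -1/2`.
  have hd : ∀ y, 0 < y → y ≠ 1 → -y⁻¹ = 2 * L₂ y + (y - 1) * deriv L₂ y := by
    intro y hy hy1
    have a1 := (h2 y hy).differentiableAt.hasDerivAt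
    have a2 : HasDerivAt (fun y : ℝ => (y - 1) * (1 + (y - 1) * L₂ y))
        (1 * (1 + (y - 1) * L₂ y) + (y - 1) * (1 * L₂ y + (y - 1) * deriv L₂ y)) y := by
      have b := (hasDerivAt_id y).sub_const 1
      exact b.mul ((b.mul a1).const_add 1)
    have a3 : HasDerivAt Real.log
        (1 * (1 + (y - 1) * L₂ y) + (y - 1) * (1 * L₂ y + (y - 1) * deriv L₂ y)) y :=
      a2.congr_of_eventuallyEq (Filter.Eventually.of_forall fun t => by
        rw [log_eq_mul_logQuot, e1])
    have a4 := (Real.hasDerivAt_log hy.ne').unique a3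
    have a5 : y - 1 ≠ 0 := sub_ne_zero.2 hy1
    have a6 : (y - 1) * (-y⁻¹) = (y - 1) * (2 * L₂ y + (y - 1) * deriv L₂ y) := by
      have : y * y⁻¹ = 1 := mul_inv_cancel₀ hy.ne'
      linarith
    exact mul_left_cancel₀ a5 a6
  have hc : (2 * L₂ 1 + (1 - 1) * deriv L₂ 1 : ℝ) = -(1 : ℝ)⁻¹ := by
    have c1 : ContinuousAt (fun y : ℝ => 2 * L₂ y + (y - 1) * deriv L₂ y) 1 :=
      (continuousAt_const.mul (h2 1 one_pos).continuousAt).add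
        ((continuousAt_id.sub continuousAt_const).mul (h2 1 one_pos).deriv.continuousAt)
    have c2 : ContinuousAt (fun y : ℝ => -y⁻¹) 1 := (continuousAt_inv₀ one_ne_zero).neg
    refine tendsto_nhds_unique (c1.tendsto.mono_left (nhdsWithin_le_nhds (s := {1}ᶜ))) ?_
    refine (c2.tendsto.mono_left nhdsWithin_le_nhds).congr' ?_
    filter_upwards [self_mem_nhdsWithin, nhdsWithin_le_nhds (lt_mem_nhds one_pos)] with y hy hy0
    exact hd y hy0 hy
  refine ⟨dslope L₂ 1, fun y hy => analyticAt_dslope (h2 y hy), fun y => ?_⟩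
  rw [e1, e2]
  have : L₂ 1 = -1 / 2 := by norm_num at hc; linarith
  rw [this]
  ring

theorem HasStepExpansion.mul_logQuot {U : Set (ℝ × ℝ × ℝ × ℝ × ℝ)}
    {f a b : ℝ × ℝ × ℝ × ℝ × ℝ → ℝ} (hf : HasStepExpansion U f a b)
    (h0 : ∀ w ∈ U, 0 < 1 + w.2.2.2.2 * f w) :
    HasStepExpansion U (fun w => f w * logQuot (1 + w.2.2.2.2 * f w)) a
      (fun w => b w - a w ^ 2 / 2) := by
  have hfs := hf.contDiffOn
  obtain ⟨ha, hb, R, hR, h⟩ := hf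
  obtain ⟨L, hL, hlog⟩ := exists_log_expansion
  have hh : ContDiffOn ℝ ∞ (fun w : ℝ × ℝ × ℝ × ℝ × ℝ => w.2.2.2.2) U := contDiffOn_step
  refine ⟨ha, hb.sub ((ha.pow 2).div_const 2), fun w => R w - (b w + w.2.2.2.2 * R w) *
    (f w + a w) / 2 + f w ^ 3 * L (1 + w.2.2.2.2 * f w), ?_, fun w hw => ?_⟩
  · have hLc : ContDiffOn ℝ ∞ (fun w => L (1 + w.2.2.2.2 * f w)) U := by
      intro w hw
      exact (hL _ (h0 w hw)).contDiffAt.comp_contDiffWithinAt w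
        ((contDiffOn_const.add (hh.mul hfs)) w hw)
    exact (hR.sub (((hb.add (hh.mul hR)).mul (hfs.add ha)).div_const 2)).add
      ((hfs.pow 3).mul hLc)
  · beta_reduce
    rw [hlog]
    linear_combination (1 - w.2.2.2.2 * (f w + a w) / 2) * h w hw

/-! ### Rates of the backward Kahan step in the chart `K₁` -/

section

variable (a : Coeffs)

/-- The second component of the field at `(x, 1)`, divided by `ε`. -/
def driftHat (r m x : ℝ) : ℝ := x - m + r * (a.a₅ + a.a₄ * x ^ 2)

/-- Determinant of the backward Kahan step at `(x, r, ε, m, h)`. -/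
noncomputable def backDet (w : ℝ × ℝ × ℝ × ℝ × ℝ) : ℝ :=
  kahanDet a w.2.1 w.2.2.1 (-w.2.2.2.2) w.1 1

/-- Numerator of the fibre component of the backward Kahan step. -/
noncomputable def backNum (w : ℝ × ℝ × ℝ × ℝ × ℝ) : ℝ :=
  (1 + w.2.2.2.2 / 2 * jac₂₂ a w.2.1 w.2.2.1) * field₁ a w.2.1 w.2.2.1 w.1 1
    - w.2.2.2.2 / 2 * jac₁₂ a w.2.1 w.1 * (w.2.2.1 * driftHat a w.2.1 w.2.2.2.1 w.1)

/-- Numerator of the second component of the backward Kahan step, divided by `ε`. -/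
noncomputable def backNumHat (w : ℝ × ℝ × ℝ × ℝ × ℝ) : ℝ :=
  (1 + w.2.2.2.2 / 2 * jac₁₁ a w.2.1 w.2.2.1 w.1 1) * driftHat a w.2.1 w.2.2.2.1 w.1
    - w.2.2.2.2 / 2 * (1 + 2 * w.2.1 * a.a₄ * w.1) * field₁ a w.2.1 w.2.2.1 w.1 1

/-- Increment of `y` in the backward Kahan step, divided by `h ε`. -/
noncomputable def backRate (w : ℝ × ℝ × ℝ × ℝ × ℝ) : ℝ := -(backNumHat a w * (backDet a w)⁻¹)

/-- The value of `y` after the backward Kahan step from `(x, 1)`. -/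
noncomputable def backQuot (w : ℝ × ℝ × ℝ × ℝ × ℝ) : ℝ :=
  1 + w.2.2.2.2 * (w.2.2.1 * backRate a w)

/-- Increment of `x₁` in the backward Kahan step, divided by `h`. -/
noncomputable def fibreRate (w : ℝ × ℝ × ℝ × ℝ × ℝ) : ℝ :=
  -(backNum a w * (backDet a w)⁻¹ * (√(backQuot a w))⁻¹
    + w.1 * (w.2.2.1 * backRate a w / ((√(backQuot a w) + 1) * √(backQuot a w))))

/-- Increment of `log r₁` in the backward Kahan step, divided by `h ε`. -/
noncomputable def scaleRate (w : ℝ × ℝ × ℝ × ℝ × ℝ) : ℝ :=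
  backRate a w * logQuot (backQuot a w) / 2

/-- The set on which the backward Kahan step is defined in the chart. -/
def backDomain : Set (ℝ × ℝ × ℝ × ℝ × ℝ) := {w | 0 < backDet a w ∧ 0 < backQuot a w}

theorem contDiff_driftHat : ContDiff ℝ ∞ fun w : ℝ × ℝ × ℝ × ℝ × ℝ =>
    driftHat a w.2.1 w.2.2.2.1 w.1 := by unfold driftHat; fun_prop

theorem contDiff_field₁ : ContDiff ℝ ∞ fun w : ℝ × ℝ × ℝ × ℝ × ℝ =>
    field₁ a w.2.1 w.2.2.1 w.1 1 := by unfold field₁; fun_prop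

theorem contDiff_jac₁₁ : ContDiff ℝ ∞ fun w : ℝ × ℝ × ℝ × ℝ × ℝ =>
    jac₁₁ a w.2.1 w.2.2.1 w.1 1 := by unfold jac₁₁; fun_prop

theorem contDiff_jac₁₂ : ContDiff ℝ ∞ fun w : ℝ × ℝ × ℝ × ℝ × ℝ => jac₁₂ a w.2.1 w.1 := by
  unfold jac₁₂; fun_prop

theorem contDiff_jac₂₂ : ContDiff ℝ ∞ fun w : ℝ × ℝ × ℝ × ℝ × ℝ => jac₂₂ a w.2.1 w.2.2.1 := by
  unfold jac₂₂; fun_prop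

theorem contDiff_backDet : ContDiff ℝ ∞ (backDet a) := by
  unfold backDet kahanDet jac₁₁ jac₁₂ jac₂₁ jac₂₂; fun_prop

theorem contDiff_backNumHat : ContDiff ℝ ∞ (backNumHat a) := by
  unfold backNumHat jac₁₁ driftHat field₁; fun_prop

theorem isOpen_backDomain : IsOpen (backDomain a) := by
  have h1 : IsOpen {w | 0 < backDet a w} :=
    isOpen_lt continuous_const (contDiff_backDet a).continuous
  have h2 : ContinuousOn (backQuot a) {w | 0 < backDet a w} := by
    unfold backQuot backRate
    have c1 := (contDiff_backDet a).continuous.continuousOn (s := {w | 0 < backDet a w})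
    have c2 := (contDiff_backNumHat a).continuous.continuousOn (s := {w | 0 < backDet a w})
    have c3 : ContinuousOn (fun w => (backDet a w)⁻¹) {w | 0 < backDet a w} :=
      c1.inv₀ fun w hw => ne_of_gt hw
    fun_prop
  exact h2.isOpen_inter_preimage h1 isOpen_Ioi

variable {U : Set (ℝ × ℝ × ℝ × ℝ × ℝ)}

theorem hasStepExpansion_backNum : HasStepExpansion U (backNum a)
    (fun w => field₁ a w.2.1 w.2.2.1 w.1 1)
    (fun w => (jac₂₂ a w.2.1 w.2.2.1 * field₁ a w.2.1 w.2.2.1 w.1 1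
      - jac₁₂ a w.2.1 w.1 * (w.2.2.1 * driftHat a w.2.1 w.2.2.2.1 w.1)) / 2) := by
  have h1 := contDiff_field₁ a
  have h2 := contDiff_jac₂₂ a
  have h3 := contDiff_jac₁₂ a
  have h4 := contDiff_driftHat a
  refine HasStepExpansion.of_eq h1.contDiffOn (by fun_prop) (R := fun _ => 0)
    contDiffOn_const fun w => ?_
  simp only [backNum]
  ring

theorem hasStepExpansion_backNumHat : HasStepExpansion U (backNumHat a)
    (fun w => driftHat a w.2.1 w.2.2.2.1 w.1)
    (fun w => (jac₁₁ a w.2.1 w.2.2.1 w.1 1 * driftHat a w.2.1 w.2.2.2.1 w.1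
      - (1 + 2 * w.2.1 * a.a₄ * w.1) * field₁ a w.2.1 w.2.2.1 w.1 1) / 2) := by
  have h1 := contDiff_field₁ a
  have h2 := contDiff_jac₁₁ a
  have h4 := contDiff_driftHat a
  refine HasStepExpansion.of_eq h4.contDiffOn (by fun_prop) (R := fun _ => 0)
    contDiffOn_const fun w => ?_
  simp only [backNumHat]
  ring

theorem hasStepExpansion_backDet : HasStepExpansion U (backDet a) (fun _ => 1)
    (fun w => (jac₁₁ a w.2.1 w.2.2.1 w.1 1 + jac₂₂ a w.2.1 w.2.2.1) / 2) := by
  have h2 := contDiff_jac₁₁ a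
  have h4 := contDiff_jac₂₂ a
  refine HasStepExpansion.of_eq contDiffOn_const (by fun_prop) (R := fun w =>
    (jac₁₁ a w.2.1 w.2.2.1 w.1 1 * jac₂₂ a w.2.1 w.2.2.1
      - jac₁₂ a w.2.1 w.1 * jac₂₁ a w.2.1 w.2.2.1 w.1) / 4)
    (by unfold jac₂₁ jac₁₂; fun_prop) fun w => ?_
  simp only [backDet, kahanDet]
  ring

theorem hasStepExpansion_inv_backDet (hU : U ⊆ backDomain a) :
    HasStepExpansion U (fun w => (backDet a w)⁻¹) (fun _ => 1)
    (fun w => -((jac₁₁ a w.2.1 w.2.2.1 w.1 1 + jac₂₂ a w.2.1 w.2.2.1) / 2)) :=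
  (hasStepExpansion_backDet a).inv fun _ hw => ne_of_gt (hU hw).1

theorem hasStepExpansion_const_mul {c f u v : ℝ × ℝ × ℝ × ℝ × ℝ → ℝ}
    (hc : ContDiffOn ℝ ∞ c U) (hf : HasStepExpansion U f u v) :
    HasStepExpansion U (fun w => c w * f w) (fun w => c w * u w) (fun w => c w * v w) :=
  ((HasStepExpansion.of_eq hc contDiffOn_const contDiffOn_const (R := fun _ => 0)
    (b := fun _ => 0) (fun w => by ring)).mul hf).congr (fun _ _ => rfl) (fun _ _ => rfl)
    (fun w _ => by ring)

theorem hasStepExpansion_backRate (hU : U ⊆ backDomain a) :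
    HasStepExpansion U (backRate a)
    (fun w => -driftHat a w.2.1 w.2.2.2.1 w.1)
    (fun w => -((jac₁₁ a w.2.1 w.2.2.1 w.1 1 * driftHat a w.2.1 w.2.2.2.1 w.1
      - (1 + 2 * w.2.1 * a.a₄ * w.1) * field₁ a w.2.1 w.2.2.1 w.1 1) / 2
      - driftHat a w.2.1 w.2.2.2.1 w.1 *
        (jac₁₁ a w.2.1 w.2.2.1 w.1 1 + jac₂₂ a w.2.1 w.2.2.1) / 2)) := by
  refine (hasStepExpansion_const_mul (contDiffOn_const (c := (-1 : ℝ)))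
    ((hasStepExpansion_backNumHat a).mul (hasStepExpansion_inv_backDet a hU))).congr
    (fun w _ => ?_) (fun w _ => ?_) (fun w _ => ?_)
  · simp only [backRate]; ring
  · ring
  · ring

theorem hasStepExpansion_scaleRate (hU : U ⊆ backDomain a) :
    HasStepExpansion U (fun w => w.2.2.1 * scaleRate a w)
    (fun w => -(w.2.2.1 * driftHat a w.2.1 w.2.2.2.1 w.1) / 2)
    (fun w => -(w.2.2.1 * (jac₁₁ a w.2.1 w.2.2.1 w.1 1 * driftHat a w.2.1 w.2.2.2.1 w.1
      - (1 + 2 * w.2.1 * a.a₄ * w.1) * field₁ a w.2.1 w.2.2.1 w.1 1) / 2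
      - w.2.2.1 * driftHat a w.2.1 w.2.2.2.1 w.1 *
        (jac₁₁ a w.2.1 w.2.2.1 w.1 1 + jac₂₂ a w.2.1 w.2.2.1) / 2) / 2
      - (w.2.2.1 * driftHat a w.2.1 w.2.2.2.1 w.1) ^ 2 / 4) := by
  have h1 := hasStepExpansion_const_mul (U := U) (c := fun w => w.2.2.1) (by fun_prop)
    (hasStepExpansion_backRate a hU)
  refine (hasStepExpansion_const_mul (contDiffOn_const (c := (1 / 2 : ℝ)))
    (h1.mul_logQuot fun w hw => (hU hw).2)).congr
    (fun w _ => ?_) (fun w _ => ?_) (fun w _ => ?_)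
  · simp only [scaleRate, backQuot]; ring
  · ring
  · ring

/-- The two leading coefficients are made explicit because they will be compared with the field and
with half its derivative along itself; this comparison expresses the second order of the Kahan
scheme. -/
theorem hasStepExpansion_fibreRate (hU : U ⊆ backDomain a) :
    HasStepExpansion U (fibreRate a)
    (fun w => -(field₁ a w.2.1 w.2.2.1 w.1 1
      - w.1 * (w.2.2.1 * driftHat a w.2.1 w.2.2.2.1 w.1) / 2))
    (fun w => -((jac₂₂ a w.2.1 w.2.2.1 * field₁ a w.2.1 w.2.2.1 w.1 1
      - jac₁₂ a w.2.1 w.1 * (w.2.2.1 * driftHat a w.2.1 w.2.2.2.1 w.1)) / 2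
      - field₁ a w.2.1 w.2.2.1 w.1 1 *
        (jac₁₁ a w.2.1 w.2.2.1 w.1 1 + jac₂₂ a w.2.1 w.2.2.1) / 2
      + field₁ a w.2.1 w.2.2.1 w.1 1 * (w.2.2.1 * driftHat a w.2.1 w.2.2.2.1 w.1) / 2
      - w.1 * (w.2.2.1 * (jac₁₁ a w.2.1 w.2.2.1 w.1 1 * driftHat a w.2.1 w.2.2.2.1 w.1
      - (1 + 2 * w.2.1 * a.a₄ * w.1) * field₁ a w.2.1 w.2.2.1 w.1 1) / 4
      - w.2.2.1 * driftHat a w.2.1 w.2.2.2.1 w.1 *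
        (jac₁₁ a w.2.1 w.2.2.1 w.1 1 + jac₂₂ a w.2.1 w.2.2.1) / 4
      + 3 / 8 * (w.2.2.1 * driftHat a w.2.1 w.2.2.2.1 w.1) ^ 2))) := by
  have h1 := hasStepExpansion_const_mul (U := U) (c := fun w => w.2.2.1) (by fun_prop)
    (hasStepExpansion_backRate a hU)
  have hp : ∀ w ∈ U, 0 < 1 + w.2.2.2.2 * (w.2.2.1 * backRate a w) := fun w hw => (hU hw).2
  have h2 := ((hasStepExpansion_backNum a).mul (hasStepExpansion_inv_backDet a hU)).mul
    (h1.inv_sqrt hp)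
  have h3 := hasStepExpansion_const_mul (U := U) (c := fun w => w.1) (by fun_prop)
    (h1.sqrt_quotient hp)
  refine (hasStepExpansion_const_mul (contDiffOn_const (c := (-1 : ℝ))) (h2.add h3)).congr
    (fun w _ => ?_) (fun w _ => ?_) (fun w _ => ?_)
  · simp only [fibreRate, backQuot]; ring
  · ring
  · ring

end

/-! ### The cut-off vector field and its scheme -/

section

variable (a : Coeffs) (χ : ℝ → ℝ) (δ : ℝ)

/-- Replace `e` by the cut-off value `ε = δ χ(r) e` in `(x, r, e, m, h)`. -/
def cutPoint (w : ℝ × ℝ × ℝ × ℝ × ℝ) : ℝ × ℝ × ℝ × ℝ × ℝ :=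
  (w.1, w.2.1, δ * (χ w.2.1 * w.2.2.1), w.2.2.2.1, w.2.2.2.2)

/-- Scaling component of the cut-off field in the chart. -/
noncomputable def scaleField (w : ℝ × ℝ × ℝ × ℝ) : ℝ :=
  δ * (χ w.2.1 * w.2.2.1) * driftHat a w.2.1 w.2.2.2 w.1 / 2

/-- Fibre component of the cut-off field in the chart. -/
noncomputable def fibreField (w : ℝ × ℝ × ℝ × ℝ) : ℝ :=
  field₁ a w.2.1 (δ * (χ w.2.1 * w.2.2.1)) w.1 1 - w.1 * scaleField a χ δ w

/-- Correction of the scaling rate which accounts for the dependence of the cut-off on `r`. -/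
noncomputable def scaleCorr (w : ℝ × ℝ × ℝ × ℝ × ℝ) : ℝ :=
  w.2.2.2.2 * δ * (w.2.2.1 * (w.2.1 * deriv χ w.2.1)) * driftHat a w.2.1 w.2.2.2.1 w.1 ^ 2 / 8

/-- Correction of the fibre rate which accounts for the dependence of the cut-off on `r`. -/
noncomputable def fibreCorr (w : ℝ × ℝ × ℝ × ℝ × ℝ) : ℝ :=
  w.2.2.2.2 * (δ ^ 2 * χ w.2.1 * w.2.2.1 ^ 2 * (w.2.1 * deriv χ w.2.1)) *
    driftHat a w.2.1 w.2.2.2.1 w.1 *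
    (w.2.1 * a.a₁ * w.1 - w.1 * driftHat a w.2.1 w.2.2.2.1 w.1 / 2) / 4

variable {χ}

theorem contDiff_scaleField (hχ : ContDiff ℝ ∞ χ) : ContDiff ℝ ∞ (scaleField a χ δ) := by
  unfold scaleField driftHat; fun_prop

theorem contDiff_fibreField (hχ : ContDiff ℝ ∞ χ) : ContDiff ℝ ∞ (fibreField a χ δ) := by
  have := contDiff_scaleField a δ hχ
  unfold fibreField field₁; fun_prop

theorem fderiv_eq_of_hasDerivAt {E : Type*} [NormedAddCommGroup E] [NormedSpace ℝ E] {f : E → ℝ}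
    {w v : E} {d : ℝ} (hf : DifferentiableAt ℝ f w)
    (h : HasDerivAt (fun t : ℝ => f (w + t • v)) d 0) : fderiv ℝ f w v = d := by
  have h1 : HasDerivAt (fun t : ℝ => w + t • v) v 0 := by
    simpa using ((hasDerivAt_id (0 : ℝ)).smul_const v).const_add w
  have h2 : HasFDerivAt f (fderiv ℝ f w) (w + (0 : ℝ) • v) := by simpa using hf.hasFDerivAt
  exact (h2.comp_hasDerivAt 0 h1).unique h

theorem fderiv_scaleField (hχ : ContDiff ℝ ∞ χ) (w v : ℝ × ℝ × ℝ × ℝ) :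
    fderiv ℝ (scaleField a χ δ) w v =
      δ * (v.2.1 * deriv χ w.2.1 * w.2.2.1 + χ w.2.1 * v.2.2.1) *
        driftHat a w.2.1 w.2.2.2 w.1 / 2 + δ * (χ w.2.1 * w.2.2.1) *
        (v.1 - v.2.2.2 + v.2.1 * (a.a₅ + a.a₄ * w.1 ^ 2) + w.2.1 * (a.a₄ * (2 * w.1 * v.1))) / 2 := by
  refine fderiv_eq_of_hasDerivAt ((contDiff_scaleField a δ hχ).differentiable (by simp) w) ?_
  have c : ∀ p q : ℝ, HasDerivAt (fun t : ℝ => p + t * q) q 0 := fun p q => by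
    simpa using ((hasDerivAt_id (0 : ℝ)).mul_const q).const_add p
  have hx := c w.1 v.1
  have hr := c w.2.1 v.2.1
  have he := c w.2.2.1 v.2.2.1
  have hm := c w.2.2.2 v.2.2.2
  have hχ' : HasDerivAt (fun t : ℝ => χ (w.2.1 + t * v.2.1)) (deriv χ w.2.1 * v.2.1) 0 := by
    have : HasDerivAt χ (deriv χ w.2.1) (w.2.1 + 0 * v.2.1) := by
      simpa using (hχ.differentiable (by simp) w.2.1).hasDerivAt
    exact this.comp 0 hr
  have hd := (hx.sub hm).add (hr.mul (((hx.pow 2).const_mul a.a₄).const_add a.a₅))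
  refine ((((hχ'.mul he).const_mul δ).mul hd).div_const 2).congr_deriv ?_
  simp only [driftHat, Pi.mul_apply, Pi.pow_apply, Pi.add_apply, Pi.sub_apply, zero_mul, add_zero]
  push_cast
  ring

theorem fderiv_fibreField (hχ : ContDiff ℝ ∞ χ) (w v : ℝ × ℝ × ℝ × ℝ) :
    fderiv ℝ (fibreField a χ δ) w v =
      2 * w.1 * v.1 + v.2.1 * (δ * (χ w.2.1 * w.2.2.1) * a.a₁ * w.1 - a.a₂ * w.1)
      + w.2.1 * (δ * (v.2.1 * deriv χ w.2.1 * w.2.2.1 + χ w.2.1 * v.2.2.1) * a.a₁ * w.1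
        + δ * (χ w.2.1 * w.2.2.1) * a.a₁ * v.1 - a.a₂ * v.1)
      - v.1 * scaleField a χ δ w - w.1 * fderiv ℝ (scaleField a χ δ) w v := by
  refine fderiv_eq_of_hasDerivAt ((contDiff_fibreField a δ hχ).differentiable (by simp) w) ?_
  have c : ∀ p q : ℝ, HasDerivAt (fun t : ℝ => p + t * q) q 0 := fun p q => by
    simpa using ((hasDerivAt_id (0 : ℝ)).mul_const q).const_add p
  have hx := c w.1 v.1
  have hr := c w.2.1 v.2.1
  have he := c w.2.2.1 v.2.2.1
  have hχ' : HasDerivAt (fun t : ℝ => χ (w.2.1 + t * v.2.1)) (deriv χ w.2.1 * v.2.1) 0 := by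
    have : HasDerivAt χ (deriv χ w.2.1) (w.2.1 + 0 * v.2.1) := by
      simpa using (hχ.differentiable (by simp) w.2.1).hasDerivAt
    exact this.comp 0 hr
  have hs : HasDerivAt (fun t : ℝ => scaleField a χ δ (w + t • v))
      (fderiv ℝ (scaleField a χ δ) w v) 0 := by
    have h1 : HasDerivAt (fun t : ℝ => w + t • v) v 0 := by
      simpa using ((hasDerivAt_id (0 : ℝ)).smul_const v).const_add w
    have h2 : HasFDerivAt (scaleField a χ δ) (fderiv ℝ (scaleField a χ δ) w) (w + (0 : ℝ) • v) := by
      simpa using ((contDiff_scaleField a δ hχ).differentiable (by simp) w).hasFDerivAt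
    exact h2.comp_hasDerivAt 0 h1
  have hE := (hχ'.mul he).const_mul δ
  have h1 := ((hx.pow 2).const_add (-1)).add
    (hr.mul (((hE.mul_const a.a₁).mul hx).sub (((hx.const_mul a.a₂).mul_const 1))))
  refine (h1.sub (hx.mul hs)).congr_deriv ?_
  simp only [Pi.mul_apply, Pi.sub_apply, zero_mul, add_zero, zero_smul]
  push_cast
  ring

theorem contDiff_cutPoint (hχ : ContDiff ℝ ∞ χ) : ContDiff ℝ ∞ (cutPoint χ δ) := by
  unfold cutPoint; fun_prop

/-- The corrected fibre increment is a scheme of second order for the cut-off field. -/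
theorem exists_fibre_scheme (hχ : ContDiff ℝ ∞ χ) :
    ∃ R : ℝ × ℝ × ℝ × ℝ × ℝ → ℝ,
      ContDiffOn ℝ ∞ R (cutPoint χ δ ⁻¹' backDomain a) ∧
      ∀ w ∈ cutPoint χ δ ⁻¹' backDomain a,
        w.2.2.2.2 * (fibreRate a (cutPoint χ δ w) + fibreCorr a χ δ w) =
          schemeFun (fibreField a χ δ) (scaleField a χ δ) (fibreField a χ δ) R w := by
  obtain ⟨-, -, R, hR, h⟩ := hasStepExpansion_fibreRate a (subset_refl (backDomain a))
  refine ⟨fun w => R (cutPoint χ δ w),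
    hR.comp (contDiff_cutPoint δ hχ).contDiffOn fun _ hw => hw, fun w hw => ?_⟩
  -- The coefficients of the Kahan step agree with those of a second order scheme except for terms
  -- with `deriv χ`: the step sees the cut-off as a frozen parameter, the field differentiates it.
  -- `fibreCorr` supplies exactly these terms.
  rw [h _ hw]
  simp only [schemeFun, fieldDeriv, dX, dU, fderiv_fibreField a δ hχ, fderiv_scaleField a δ hχ]
  simp only [fibreCorr, fibreField, scaleField, forgetStep, cutPoint, field₁, driftHat,
    jac₁₁, jac₁₂, jac₂₂]
  ring

/-- The corrected scaling increment is a scheme of second order for the cut-off field. -/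
theorem exists_scale_scheme (hχ : ContDiff ℝ ∞ χ) :
    ∃ R : ℝ × ℝ × ℝ × ℝ × ℝ → ℝ,
      ContDiffOn ℝ ∞ R (cutPoint χ δ ⁻¹' backDomain a) ∧
      ∀ w ∈ cutPoint χ δ ⁻¹' backDomain a,
        w.2.2.2.2 * (δ * (χ w.2.1 * w.2.2.1) *
          (scaleRate a (cutPoint χ δ w) + scaleCorr a χ δ w)) =
          schemeFun (fibreField a χ δ) (scaleField a χ δ) (scaleField a χ δ) R w := by
  obtain ⟨-, -, R, hR, h⟩ := hasStepExpansion_scaleRate a (subset_refl (backDomain a))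
  refine ⟨fun w => R (cutPoint χ δ w),
    hR.comp (contDiff_cutPoint δ hχ).contDiffOn fun _ hw => hw, fun w hw => ?_⟩
  have h' := h _ hw
  have e : (cutPoint χ δ w).2.2.1 = δ * (χ w.2.1 * w.2.2.1) := rfl
  beta_reduce at h'
  rw [e] at h'
  -- As for the fibre, the terms with `deriv χ` are matched by `scaleCorr`.
  rw [mul_add, h']
  simp only [schemeFun, fieldDeriv, dX, dU, fderiv_scaleField a δ hχ]
  simp only [scaleCorr, fibreField, scaleField, forgetStep, cutPoint, field₁, driftHat,
    jac₁₁, jac₂₂]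
  ring

end

/-! ### Self-adjointness and reversal of the Kahan map -/

/-- The Kahan scheme determines the Kahan map. -/
theorem kahan_unique (a : Coeffs) {r ε lam h x y X Y : ℝ} (hd : kahanDet a r ε h x y ≠ 0)
    (h₁ : X - x = h * (-(y + Y) / 2 + x * X
        + r * (ε * a.a₁ * ((x + X) / 2) - a.a₂ * ((x * Y + X * y) / 2))))
    (h₂ : Y - y = h * (ε * ((x + X) / 2 - lam)
        + r * ε * (a.a₅ * ((y + Y) / 2) + a.a₄ * (x * X)))) :
    kahanX a r ε lam h x y = X ∧ kahanY a r ε lam h x y = Y := by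
  -- The scheme is linear in `(X, Y)`; this identity and the next are Cramer's rule.
  have e1 : h * ((1 - h / 2 * jac₂₂ a r ε) * field₁ a r ε x y
      + h / 2 * jac₁₂ a r x * field₂ a r ε lam x y) = (X - x) * kahanDet a r ε h x y := by
    simp only [kahanDet, jac₁₁, jac₁₂, jac₂₁, jac₂₂, field₁, field₂]
    linear_combination (-(1 - h / 2 * (r * ε * a.a₅))) * h₁ - (h / 2 * (-1 - r * a.a₂ * x)) * h₂
  have e2 : h * (h / 2 * jac₂₁ a r ε x * field₁ a r ε x y
      + (1 - h / 2 * jac₁₁ a r ε x y) * field₂ a r ε lam x y) =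
      (Y - y) * kahanDet a r ε h x y := by
    simp only [kahanDet, jac₁₁, jac₁₂, jac₂₁, jac₂₂, field₁, field₂]
    linear_combination (-(1 - h / 2 * (2 * x + r * (ε * a.a₁ - a.a₂ * y)))) * h₂
      - (h / 2 * (ε + 2 * r * ε * a.a₄ * x)) * h₁
  constructor
  · rw [kahanX, e1, mul_div_cancel_right₀ _ hd]; ring
  · rw [kahanY, e2, mul_div_cancel_right₀ _ hd]; ring

/-- The backward Kahan step in the chart `K₁`. -/
noncomputable def backK1 (a : Coeffs) (z : K1) : K1 :=
  (kahanX a z.2.1 z.2.2.1 z.2.2.2.1 (-z.2.2.2.2) z.1 1 /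
      √(kahanY a z.2.1 z.2.2.1 z.2.2.2.1 (-z.2.2.2.2) z.1 1),
    (z.2.1 * √(kahanY a z.2.1 z.2.2.1 z.2.2.2.1 (-z.2.2.2.2) z.1 1),
      z.2.2.1 / kahanY a z.2.1 z.2.2.1 z.2.2.2.1 (-z.2.2.2.2) z.1 1,
      z.2.2.2.1 / √(kahanY a z.2.1 z.2.2.1 z.2.2.2.1 (-z.2.2.2.2) z.1 1),
      z.2.2.2.2 * √(kahanY a z.2.1 z.2.2.1 z.2.2.2.1 (-z.2.2.2.2) z.1 1)))

/-- The Kahan scheme is unchanged when the two points are exchanged and `h` is replaced by `-h`. In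
the chart the image is rescaled by `s = √Y` to `y = 1`; the rescaled old point solves the scheme
with step `-(h s)`, and uniqueness identifies it. -/
theorem backK1_mapK1 (a : Coeffs) {z : K1} (hd : detK1 a z ≠ 0) (hG : 0 < G a z)
    (hb : backDet a (mapK1 a z) ≠ 0) : backK1 a (mapK1 a z) = z := by
  obtain ⟨x, r, ε, lam, h⟩ := z
  obtain ⟨s1, s2⟩ := kahan_scheme a r ε lam h x 1 hd
  have hY : G a (x, r, ε, lam, h) = kahanY a r ε lam h x 1 := rfl
  have hm : mapK1 a (x, r, ε, lam, h) = (kahanX a r ε lam h x 1 / √(G a (x, r, ε, lam, h)),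
    (r * √(G a (x, r, ε, lam, h)), ε / G a (x, r, ε, lam, h), lam / √(G a (x, r, ε, lam, h)),
      h * √(G a (x, r, ε, lam, h)))) := rfl
  rw [hm] at hb ⊢
  rw [← hY] at s1 s2
  set X := kahanX a r ε lam h x 1
  set Y := G a (x, r, ε, lam, h)
  have hs : 0 < √Y := Real.sqrt_pos.2 hG
  have hs2 : √Y ^ 2 = Y := Real.sq_sqrt hG.le
  set s := √Y
  rw [← hs2] at hb s1 s2 ⊢
  have hs0 : s ≠ 0 := hs.ne'
  obtain ⟨u1, u2⟩ := kahan_unique a (r := r * s) (ε := ε / s ^ 2) (lam := lam / s)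
    (h := -(h * s)) (x := X / s) (y := 1) (X := x / s) (Y := 1 / s ^ 2) hb (by
      field_simp
      linear_combination (-2) * s1) (by
      field_simp
      linear_combination (-2) * s2)
  have hq : √(1 / s ^ 2) = 1 / s := by
    rw [Real.sqrt_div zero_le_one, Real.sqrt_one, Real.sqrt_sq hs.le]
  simp only [backK1, u1, u2, hq, Prod.mk.injEq]
  refine ⟨?_, ?_, ?_, ?_, ?_⟩ <;> field_simp

theorem kahanY_back (a : Coeffs) {w : ℝ × ℝ × ℝ × ℝ × ℝ} (hd : backDet a w ≠ 0) :
    kahanY a w.2.1 w.2.2.1 w.2.2.2.1 (-w.2.2.2.2) w.1 1 = backQuot a w := by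
  simp only [kahanY, backQuot, backRate, backNumHat]
  change _ + _ / backDet a w = _
  field_simp
  simp only [jac₂₁, field₂, driftHat]
  ring

theorem kahanX_back (a : Coeffs) {w : ℝ × ℝ × ℝ × ℝ × ℝ} (hw : w ∈ backDomain a) :
    kahanX a w.2.1 w.2.2.1 w.2.2.2.1 (-w.2.2.2.2) w.1 1 / √(backQuot a w) =
      w.1 + w.2.2.2.2 * fibreRate a w := by
  have hs : 0 < √(backQuot a w) := Real.sqrt_pos.2 hw.2
  have hs2 : √(backQuot a w) ^ 2 = 1 + w.2.2.2.2 * (w.2.2.1 * backRate a w) :=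
    Real.sq_sqrt hw.2.le
  have hd := hw.1.ne'
  have e : kahanX a w.2.1 w.2.2.1 w.2.2.2.1 (-w.2.2.2.2) w.1 1 =
      w.1 - w.2.2.2.2 * (backNum a w * (backDet a w)⁻¹) := by
    simp only [kahanX, backNum]
    change _ + _ / backDet a w = _
    field_simp
    simp only [field₂, driftHat]
    ring
  rw [e, fibreRate]
  set σ := √(backQuot a w)
  field_simp
  linear_combination (-w.1 * backDet a w) * hs2

theorem sqrt_backQuot (a : Coeffs) {w : ℝ × ℝ × ℝ × ℝ × ℝ} (hw : w ∈ backDomain a) :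
    √(backQuot a w) = Real.exp (w.2.2.2.2 * (w.2.2.1 * scaleRate a w)) := by
  have e : w.2.2.2.2 * (w.2.2.1 * scaleRate a w) = Real.log (backQuot a w) / 2 := by
    rw [log_eq_mul_logQuot, scaleRate]
    have : backQuot a w - 1 = w.2.2.2.2 * (w.2.2.1 * backRate a w) := by rw [backQuot]; ring
    rw [this]; ring
  rw [e, ← Real.log_sqrt hw.2.le, Real.exp_log (Real.sqrt_pos.2 hw.2)]

/-- The backward step in the chart in terms of its rates. -/
theorem backK1_eq (a : Coeffs) {x r ε m h : ℝ} (hw : (x, r, ε, m, h) ∈ backDomain a) :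
    backK1 a (x, r, ε, m, h) = (x + h * fibreRate a (x, r, ε, m, h),
      (Real.exp (h * (ε * scaleRate a (x, r, ε, m, h))) * r,
      Real.exp (-2 * (h * (ε * scaleRate a (x, r, ε, m, h)))) * ε,
      Real.exp (-(h * (ε * scaleRate a (x, r, ε, m, h)))) * m,
      Real.exp (h * (ε * scaleRate a (x, r, ε, m, h))) * h)) := by
  have h1 := kahanY_back a hw.1.ne'
  have h2 := kahanX_back a hw
  have h3 := sqrt_backQuot a hw
  have h4 : Real.exp (-2 * (h * (ε * scaleRate a (x, r, ε, m, h)))) =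
      (backQuot a (x, r, ε, m, h))⁻¹ := by
    rw [← Real.sq_sqrt hw.2.le, h3, ← Real.exp_nat_mul, ← Real.exp_neg]
    congr 1
    push_cast
    ring
  simp only at h1 h2 h3
  simp only [backK1, h1, h2, h4, Real.exp_neg, ← h3, Prod.mk.injEq]
  refine ⟨trivial, mul_comm _ _, ?_, ?_, mul_comm _ _⟩
  · rw [div_eq_mul_inv, mul_comm]
  · rw [div_eq_mul_inv, mul_comm]

/-- The coefficients of the reversed system. -/
def Coeffs.neg (a : Coeffs) : Coeffs := ⟨-a.a₁, -a.a₂, -a.a₄, -a.a₅⟩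

/-- The reversal of the system in the chart `K₁`. -/
def reverse (z : K1) : K1 := (-z.1, (z.2.1, z.2.2.1, -z.2.2.2.1, z.2.2.2.2))

/-- Negating `x`, `lam`, `h` and all coefficients is a symmetry of the scheme that fixes `y`, `r`
and `ε`. It exchanges forward and backward steps as well as the two fixed points `x = ∓1`. -/
theorem kahanDet_neg (a : Coeffs) (r ε h x y : ℝ) :
    kahanDet a.neg r ε h x y = kahanDet a r ε (-h) (-x) y := by
  simp only [kahanDet, jac₁₁, jac₁₂, jac₂₁, jac₂₂, Coeffs.neg]
  ring

theorem kahanX_neg (a : Coeffs) (r ε lam h x y : ℝ) :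
    kahanX a.neg r ε lam h x y = -kahanX a r ε (-lam) (-h) (-x) y := by
  have : ∀ u v w : ℝ, u = -v → x + u / w = -(-x + v / w) := by
    intro u v w h; rw [h]; ring
  rw [kahanX, kahanX, kahanDet_neg]
  refine this _ _ _ ?_
  simp only [jac₁₂, jac₂₂, field₁, field₂, Coeffs.neg]
  ring

theorem kahanY_neg (a : Coeffs) (r ε lam h x y : ℝ) :
    kahanY a.neg r ε lam h x y = kahanY a r ε (-lam) (-h) (-x) y := by
  rw [kahanY, kahanY, kahanDet_neg]
  congr 2
  simp only [jac₁₁, jac₂₁, field₁, field₂, Coeffs.neg]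
  ring

theorem mapK1_reverse (a : Coeffs) (z : K1) : mapK1 a (reverse z) = reverse (backK1 a.neg z) := by
  simp only [mapK1, reverse, backK1, G, kahanX_neg, kahanY_neg, neg_neg, neg_div]

theorem reverse_reverse (z : K1) : reverse (reverse z) = z := by simp [reverse]

/-! ### Regularity of the steps near `r = ε = h = 0` -/

section

variable (a : Coeffs)

theorem contDiffOn_fibreRate : ContDiffOn ℝ ∞ (fibreRate a) (backDomain a) :=
  (hasStepExpansion_fibreRate a subset_rfl).contDiffOn

theorem contDiffAt_fibreRate {w : ℝ × ℝ × ℝ × ℝ × ℝ} (hw : w ∈ backDomain a) :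
    ContDiffAt ℝ ∞ (fibreRate a) w :=
  (contDiffOn_fibreRate a).contDiffAt ((isOpen_backDomain a).mem_nhds hw)

theorem contDiffAt_scaleRate {w : ℝ × ℝ × ℝ × ℝ × ℝ} (hw : w ∈ backDomain a) :
    ContDiffAt ℝ ∞ (scaleRate a) w := by
  have h1 : ContDiffAt ℝ ∞ (backRate a) w := ((hasStepExpansion_backRate a
    subset_rfl).contDiffOn).contDiffAt ((isOpen_backDomain a).mem_nhds hw)
  have h2 : ContDiffAt ℝ ∞ (backQuot a) w := by unfold backQuot; fun_prop
  have h3 : ContDiffAt ℝ ∞ (fun w => logQuot (backQuot a w)) w :=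
    (analyticAt_logQuot hw.2).contDiffAt.comp w h2
  exact (h1.mul h3).div_const 2

theorem backDomain_of_zero (x m : ℝ) : (x, 0, 0, m, 0) ∈ backDomain a := by
  simp [backDomain, backDet, backQuot, kahanDet]

/-- Here the backward fibre field is `1 - x²`, with slope `-2x > 0` near `x = -1`: the fibre expands
backward. The scaling rate `(m - x) / 2` is positive there, so `r` and `h` do not decrease. -/
theorem fibreRate_of_zero (x m : ℝ) : fibreRate a (x, 0, 0, m, 0) = 1 - x ^ 2 := by
  simp [fibreRate, backNum, backDet, backQuot, kahanDet, field₁]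
  ring

theorem scaleRate_of_zero (x m : ℝ) : scaleRate a (x, 0, 0, m, 0) = (m - x) / 2 := by
  simp [scaleRate, backRate, backNumHat, backDet, backQuot, kahanDet, logQuot_one, driftHat]

theorem fderiv_fibreRate_of_zero (x m : ℝ) :
    fderiv ℝ (fibreRate a) (x, 0, 0, m, 0) (1, 0, 0, 0, 0) = -(2 * x) := by
  refine fderiv_eq_of_hasDerivAt
    ((contDiffAt_fibreRate a (backDomain_of_zero a x m)).differentiableAt (by simp)) ?_
  have h1 : HasDerivAt (fun t : ℝ => 1 - (x + t) ^ 2) (-(2 * x)) 0 := by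
    have := (((hasDerivAt_id (0 : ℝ)).const_add x).pow 2).const_sub 1
    simpa using this
  refine h1.congr_of_eventuallyEq (Filter.Eventually.of_forall fun t => ?_)
  simp [fibreRate_of_zero]

/-- Near `r = ε = h = 0` the backward and the forward step are defined and regular. -/
theorem exists_regular_radius : ∃ η : ℝ, 0 < η ∧ η < 1 ∧ ∀ x ∈ Icc (-7 / 4 : ℝ) (-1 / 4),
    ∀ r ∈ Icc 0 η, ∀ ε ∈ Icc 0 η, ∀ m ∈ Icc (-1 / 8 : ℝ) (1 / 8), ∀ h ∈ Icc 0 η,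
      (x, r, ε, m, h) ∈ backDomain a ∧
      1 / 4 < fderiv ℝ (fibreRate a) (x, r, ε, m, h) (1, 0, 0, 0, 0) ∧
      h * fderiv ℝ (fibreRate a) (x, r, ε, m, h) (1, 0, 0, 0, 0) < 1 / 2 ∧
      1 / 2 < fibreRate a (-1 / 2, r, ε, m, h) ∧ fibreRate a (-3 / 2, r, ε, m, h) < -1 / 2 ∧
      1 / 32 < scaleRate a (x, r, ε, m, h) ∧
      0 < detK1 a (x, (r, ε, m, h)) ∧ 0 < G a (x, (r, ε, m, h)) ∧
      |(mapK1 a (x, (r, ε, m, h))).1 - x| < 1 / 4 := by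
  -- All the inequalities are strict on this compact set, hence persist on a thickening of it.
  set K₀ : Set (ℝ × ℝ × ℝ × ℝ × ℝ) :=
    Icc (-7 / 4 : ℝ) (-1 / 4) ×ˢ {0} ×ˢ {0} ×ˢ Icc (-1 / 8 : ℝ) (1 / 8) ×ˢ {0} with hK₀
  have hK : IsCompact K₀ := isCompact_Icc.prod (isCompact_singleton.prod (isCompact_singleton.prod
    (isCompact_Icc.prod isCompact_singleton)))
  have key : ∀ w₀ ∈ K₀, ∀ᶠ w in 𝓝 w₀, w ∈ backDomain a ∧
      1 / 4 < fderiv ℝ (fibreRate a) w (1, 0, 0, 0, 0) ∧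
      w.2.2.2.2 * fderiv ℝ (fibreRate a) w (1, 0, 0, 0, 0) < 1 / 2 ∧
      1 / 2 < fibreRate a (-1 / 2, w.2) ∧ fibreRate a (-3 / 2, w.2) < -1 / 2 ∧
      1 / 32 < scaleRate a w ∧ 0 < detK1 a w ∧ 0 < G a w ∧ |(mapK1 a w).1 - w.1| < 1 / 4 := by
    rintro ⟨x, r, ε, m, h⟩ ⟨hx, hr, hε, hm, hh⟩
    simp only [mem_singleton_iff] at hr hε hh
    subst hr hε hh
    have hw := backDomain_of_zero a x m
    have c1 : ContinuousAt (fun w => fderiv ℝ (fibreRate a) w (1, 0, 0, 0, 0)) (x, 0, 0, m, 0) :=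
      ((contDiffAt_fibreRate a hw).fderiv_right (m := ∞) (by simp)).continuousAt.clm_apply
        continuousAt_const
    have c2 : ∀ y : ℝ, ContinuousAt (fun w : ℝ × ℝ × ℝ × ℝ × ℝ => fibreRate a (y, w.2))
        (x, 0, 0, m, 0) := fun y =>
      ContinuousAt.comp_of_eq (f := fun w : ℝ × ℝ × ℝ × ℝ × ℝ => (y, w.2)) (y := (y, 0, 0, m, 0))
        (contDiffAt_fibreRate a (backDomain_of_zero a y m)).continuousAt (by fun_prop) rfl
    have c3 : ContinuousAt (fun w : ℝ × ℝ × ℝ × ℝ × ℝ => detK1 a w) (x, 0, 0, m, 0) := by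
      unfold detK1 kahanDet jac₁₁ jac₁₂ jac₂₁ jac₂₂; fun_prop
    have hd : detK1 a (x, 0, 0, m, 0) = 1 := by simp [detK1, kahanDet]
    have c4 : ContinuousAt (fun w : ℝ × ℝ × ℝ × ℝ × ℝ => G a w) (x, 0, 0, m, 0) := by
      unfold G kahanY
      refine continuousAt_const.add (ContinuousAt.div ?_ c3 (hd.trans_ne one_ne_zero))
      unfold jac₁₁ jac₂₁ field₁ field₂; fun_prop
    have hG : G a (x, 0, 0, m, 0) = 1 := by simp [G, kahanY]
    have c5 : ContinuousAt (fun w : ℝ × ℝ × ℝ × ℝ × ℝ => (mapK1 a w).1) (x, 0, 0, m, 0) := by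
      unfold mapK1
      refine ContinuousAt.div ?_ c4.sqrt (by rw [hG]; simp)
      unfold kahanX
      refine continuousAt_fst.add (ContinuousAt.div ?_ c3 (hd.trans_ne one_ne_zero))
      unfold jac₂₂ jac₁₂ field₁ field₂; fun_prop
    have hM : (mapK1 a (x, 0, 0, m, 0)).1 = x := by
      simp only [mapK1, hG]
      simp [kahanX]
    have hx2 := hx.2
    have hm1 := hm.1
    refine Filter.Eventually.and ((isOpen_backDomain a).mem_nhds hw) ?_
    refine (c1.eventually (lt_mem_nhds ?_)).and ?_
    · simp only [fderiv_fibreRate_of_zero]; linarith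
    refine (((show ContinuousAt (fun w : ℝ × ℝ × ℝ × ℝ × ℝ => w.2.2.2.2) (x, 0, 0, m, 0) by
      fun_prop).mul c1).eventually (gt_mem_nhds ?_)).and ?_
    · simp only [Pi.mul_apply, zero_mul]; norm_num
    refine ((c2 (-1 / 2)).eventually (lt_mem_nhds ?_)).and ?_
    · simp only [fibreRate_of_zero]; norm_num
    refine ((c2 (-3 / 2)).eventually (gt_mem_nhds ?_)).and ?_
    · simp only [fibreRate_of_zero]; norm_num
    refine ((contDiffAt_scaleRate a hw).continuousAt.eventually (lt_mem_nhds ?_)).and ?_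
    · rw [scaleRate_of_zero]; linarith
    refine (c3.eventually (lt_mem_nhds ?_)).and ((c4.eventually (lt_mem_nhds ?_)).and
      ((c5.sub continuousAt_fst).abs.eventually (gt_mem_nhds ?_)))
    · exact one_pos.trans_eq hd.symm
    · exact one_pos.trans_eq hG.symm
    · change |(mapK1 a (x, 0, 0, m, 0)).1 - x| < _
      rw [hM]; norm_num
  obtain ⟨V, hVo, hKV, hV⟩ := mem_nhdsSet_iff_exists.1 (mem_nhdsSet_iff_forall.2 key)
  obtain ⟨η, hη, hηV⟩ := hK.exists_cthickening_subset_open hVo hKV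
  refine ⟨min η (1 / 2), by positivity, (min_le_right _ _).trans_lt (by norm_num),
    fun x hx r hr ε hε m hm h hh => ?_⟩
  have hmem : (x, r, ε, m, h) ∈ V := by
    refine hηV (Metric.mem_cthickening_of_dist_le _ (x, 0, 0, m, 0) _ _
      ⟨hx, rfl, rfl, hm, rfl⟩ ?_)
    have i : ∀ y ∈ Icc 0 (min η (1 / 2)), |y| ≤ η := fun y hy => by
      rw [abs_of_nonneg hy.1]; exact hy.2.trans (min_le_left _ _)
    simp [Prod.dist_eq, i r hr, i ε hε, i h hh]
  exact hV hmem

end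

/-! ### Cut-off functions and the choice of scale -/

theorem exists_cutoff {p q : ℝ} (h : p < q) : ∃ χ : ℝ → ℝ, ContDiff ℝ ∞ χ ∧
    (∀ t, χ t ∈ Icc (0 : ℝ) 1) ∧ (∀ t ≤ p, χ t = 1) ∧ ∀ t, q ≤ t → χ t = 0 := by
  have hpq : 0 < q - p := sub_pos.2 h
  refine ⟨fun t => Real.smoothTransition ((q - t) / (q - p)),
    Real.smoothTransition.contDiff.comp ((contDiff_const.sub contDiff_id).div_const _),
    fun t => ⟨Real.smoothTransition.nonneg _, Real.smoothTransition.le_one _⟩,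
    fun t ht => Real.smoothTransition.one_of_one_le ?_,
    fun t ht => Real.smoothTransition.zero_of_nonpos ?_⟩
  · rw [le_div_iff₀ hpq]; linarith
  · exact div_nonpos_of_nonpos_of_nonneg (by linarith) hpq.le

/-- Cut-off functions of `r` and `h` on the scale `η`. -/
structure IsCutoff (η : ℝ) (χ χ₁ θ : ℝ → ℝ) : Prop where
  smooth : ContDiff ℝ ∞ χ
  smooth₁ : ContDiff ℝ ∞ χ₁
  smoothθ : ContDiff ℝ ∞ θ
  range : ∀ t, χ t ∈ Icc (0 : ℝ) 1
  range₁ : ∀ t, χ₁ t ∈ Icc (0 : ℝ) 1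
  one : ∀ t ≤ η / 4, χ t = 1
  zero : ∀ t, η / 2 ≤ t → χ t = 0
  one₁ : ∀ t ≤ η / 3, χ₁ t = 1
  zero₁ : ∀ t, η / 2 ≤ t → χ₁ t = 0
  zeroθ : ∀ t ≤ η / 6, θ t = 0
  oneθ : ∀ t, η / 3 ≤ t → t * θ t = 1

/-- `θ` has to be `1/t` for large `t` and `0` for small `t`; the summand `ζ` in the denominator
removes the singularity without affecting the region where `ζ = 0`. -/
theorem exists_isCutoff {η : ℝ} (hη : 0 < η) : ∃ χ χ₁ θ, IsCutoff η χ χ₁ θ := by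
  obtain ⟨χ, h1, h2, h3, h4⟩ := exists_cutoff (show η / 4 < η / 2 by linarith)
  obtain ⟨χ₁, k1, k2, k3, k4⟩ := exists_cutoff (show η / 3 < η / 2 by linarith)
  obtain ⟨ζ, l1, l2, l3, l4⟩ := exists_cutoff (show η / 6 < η / 3 by linarith)
  have hpos : ∀ t, 0 < t ^ 2 + ζ t := fun t => by
    rcases le_or_gt t (η / 6) with ht | ht
    · rw [l3 t ht]; positivity
    · have h5 := (l2 t).1
      have h6 : 0 < t := by linarith
      positivity
  refine ⟨χ, χ₁, fun t => (1 - ζ t) * t / (t ^ 2 + ζ t), h1, k1, ?_, h2, k2, h3, h4, k3, k4,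
    fun t ht => ?_, fun t ht => ?_⟩
  · exact ((contDiff_const.sub l1).mul contDiff_id).div ((contDiff_id.pow 2).add l1)
      fun t => (hpos t).ne'
  · simp [l3 t ht]
  · have : 0 < t := by linarith
    rw [l4 t ht]
    field_simp
    ring

/-- A radius on which the forward and the backward step are regular. -/
structure IsRegularRadius (a : Coeffs) (η : ℝ) : Prop where
  pos : 0 < η
  le : η ≤ 1 / 4
  shift : |a.a₂| * η ≤ 1 / 4
  regular : ∀ x ∈ Icc (-7 / 4 : ℝ) (-1 / 4),
    ∀ r ∈ Icc 0 η, ∀ ε ∈ Icc 0 η, ∀ m ∈ Icc (-1 / 8 : ℝ) (1 / 8), ∀ h ∈ Icc 0 η,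
      (x, r, ε, m, h) ∈ backDomain a ∧
      1 / 4 < fderiv ℝ (fibreRate a) (x, r, ε, m, h) (1, 0, 0, 0, 0) ∧
      h * fderiv ℝ (fibreRate a) (x, r, ε, m, h) (1, 0, 0, 0, 0) < 1 / 2 ∧
      1 / 2 < fibreRate a (-1 / 2, r, ε, m, h) ∧ fibreRate a (-3 / 2, r, ε, m, h) < -1 / 2 ∧
      1 / 32 < scaleRate a (x, r, ε, m, h) ∧
      0 < detK1 a (x, (r, ε, m, h)) ∧ 0 < G a (x, (r, ε, m, h)) ∧
      |(mapK1 a (x, (r, ε, m, h))).1 - x| < 1 / 4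

theorem exists_isRegularRadius (a : Coeffs) : ∃ η, IsRegularRadius a η := by
  obtain ⟨η, h0, h1, h2⟩ := exists_regular_radius a
  have ha : 0 < 4 * (|a.a₂| + 1) := by positivity
  refine ⟨min η (min (1 / 4) (1 / (4 * (|a.a₂| + 1)))), by positivity,
    (min_le_right _ _).trans (min_le_left _ _), ?_, fun x hx r hr ε hε m hm h hh => ?_⟩
  · have h3 : min η (min (1 / 4) (1 / (4 * (|a.a₂| + 1)))) ≤ 1 / (4 * (|a.a₂| + 1)) :=
      (min_le_right _ _).trans (min_le_right _ _)
    calc _ ≤ |a.a₂| * (1 / (4 * (|a.a₂| + 1))) := by gcongr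
      _ ≤ 1 / 4 := by
        rw [mul_one_div, div_le_iff₀ ha]; linarith
  · have hs : Icc 0 (min η (min (1 / 4) (1 / (4 * (|a.a₂| + 1))))) ⊆ Icc 0 η :=
      Icc_subset_Icc_right (min_le_left _ _)
    exact h2 x hx r (hs hr) ε (hs hε) m hm h (hs hh)

/-! ### The modified backward step and the initial graph -/

section

variable (a : Coeffs) (χ χ₁ θ : ℝ → ℝ)

/-- Increment of `log r₁` in the cut-off backward step at `(δ, x, r, e, m, h)`, divided
by `h δ`. -/
noncomputable def scaleStep (z : ℝ × ℝ × ℝ × ℝ × ℝ × ℝ) : ℝ :=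
  χ₁ z.2.2.2.2.2 * (χ z.2.2.1 * z.2.2.2.1 *
    (scaleRate a (cutPoint χ z.1 z.2) + scaleCorr a χ z.1 z.2))

/-- Increment of `log r₁` in the cut-off backward step. -/
noncomputable def scaleLog (z : ℝ × ℝ × ℝ × ℝ × ℝ × ℝ) : ℝ :=
  z.2.2.2.2.2 * (z.1 * scaleStep a χ χ₁ z)

/-- A graph which contains the curves of fixed points and the special curve. -/
noncomputable def startX (z : ℝ × ℝ × ℝ × ℝ × ℝ × ℝ) : ℝ :=
  (a.a₂ * z.2.2.1 - √((a.a₂ * z.2.2.1) ^ 2 + 4 + 2 * (z.1 * z.2.2.2.1)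
    + (z.1 * z.2.2.2.1) ^ 2 * z.2.2.2.2.2 ^ 2 / 2)) / 2

/-- The point of the graph `startX` over the base point of `z`. -/
noncomputable def onStart (z : ℝ × ℝ × ℝ × ℝ × ℝ × ℝ) : ℝ × ℝ × ℝ × ℝ × ℝ × ℝ :=
  (z.1, startX a z, z.2.2)

/-- Scale the base point by `e^s`. -/
noncomputable def moveBase (s : ℝ) (z : ℝ × ℝ × ℝ × ℝ × ℝ × ℝ) : ℝ × ℝ × ℝ × ℝ × ℝ × ℝ :=
  (z.1, z.2.1, Real.exp s * z.2.2.1, Real.exp (-2 * s) * z.2.2.2.1,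
    Real.exp (-s) * z.2.2.2.2.1, Real.exp s * z.2.2.2.2.2)

/-- The defect of invariance of the graph `startX`. -/
noncomputable def defect (z : ℝ × ℝ × ℝ × ℝ × ℝ × ℝ) : ℝ :=
  startX a (moveBase (scaleLog a χ χ₁ (onStart a z)) z) - startX a z
    - z.2.2.2.2.2 * fibreRate a (cutPoint χ z.1 (onStart a z).2)

/-- The part of the fibre increment which vanishes with `δ`. -/
noncomputable def fibreError (z : ℝ × ℝ × ℝ × ℝ × ℝ × ℝ) : ℝ :=
  fibreCorr a χ z.1 z.2 + θ z.2.2.2.2.2 * defect a χ χ₁ z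

/-- Increment of `x₁` in the cut-off backward step, divided by `h`. -/
noncomputable def fibreStep (z : ℝ × ℝ × ℝ × ℝ × ℝ × ℝ) : ℝ :=
  fibreRate a (cutPoint χ z.1 z.2) + fibreError a χ χ₁ θ z

variable {a χ χ₁ θ} {η : ℝ}

theorem startX_arg_pos {z : ℝ × ℝ × ℝ × ℝ × ℝ × ℝ} (hz : 0 ≤ z.1 * z.2.2.2.1) :
    0 < (a.a₂ * z.2.2.1) ^ 2 + 4 + 2 * (z.1 * z.2.2.2.1)
      + (z.1 * z.2.2.2.1) ^ 2 * z.2.2.2.2.2 ^ 2 / 2 := by positivity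

theorem contDiffAt_startX {z : ℝ × ℝ × ℝ × ℝ × ℝ × ℝ} (hz : 0 ≤ z.1 * z.2.2.2.1) :
    ContDiffAt ℝ ∞ (startX a) z := by
  unfold startX
  refine (ContDiffAt.sub (by fun_prop) (ContDiffAt.sqrt (by fun_prop) ?_)).div_const 2
  exact (startX_arg_pos hz).ne'

theorem startX_mem (hη : IsRegularRadius a η) {z : ℝ × ℝ × ℝ × ℝ × ℝ × ℝ}
    (hr : z.2.2.1 ∈ Icc 0 η) (hz : z.1 * z.2.2.2.1 ∈ Icc 0 η) (hh : z.2.2.2.2.2 ∈ Icc 0 η) :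
    startX a z ∈ Icc (-3 / 2 : ℝ) (-1 / 2) := by
  have h1 : |a.a₂ * z.2.2.1| ≤ 1 / 4 := by
    rw [abs_mul, abs_of_nonneg hr.1]
    exact (mul_le_mul_of_nonneg_left hr.2 (abs_nonneg _)).trans hη.shift
  have h2 := hη.le
  have h3 : (a.a₂ * z.2.2.1) ^ 2 ≤ 1 / 16 := by
    rw [← sq_abs]; nlinarith [abs_nonneg (a.a₂ * z.2.2.1)]
  have h4 : (z.1 * z.2.2.2.1) ^ 2 * z.2.2.2.2.2 ^ 2 ≤ 1 := by
    have i1 : (z.1 * z.2.2.2.1) ^ 2 ≤ 1 := pow_le_one₀ hz.1 (by linarith [hz.2])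
    have i2 : z.2.2.2.2.2 ^ 2 ≤ 1 := pow_le_one₀ hh.1 (by linarith [hh.2])
    exact mul_le_one₀ i1 (by positivity) i2
  have h5 := startX_arg_pos (a := a) hz.1
  have hz2 := hz.2
  have hz1 := hz.1
  -- With `|a₂ r| ≤ 1/4`, a root between `2` and `11/4` places `startX` in `[-3/2, -1/2]`; the lower
  -- end is attained by these bounds exactly.
  have h6 : √((a.a₂ * z.2.2.1) ^ 2 + 4 + 2 * (z.1 * z.2.2.2.1)
      + (z.1 * z.2.2.2.1) ^ 2 * z.2.2.2.2.2 ^ 2 / 2) ≤ 11 / 4 := by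
    rw [Real.sqrt_le_left (by norm_num)]; linarith
  have h7 : 2 ≤ √((a.a₂ * z.2.2.1) ^ 2 + 4 + 2 * (z.1 * z.2.2.2.1)
      + (z.1 * z.2.2.2.1) ^ 2 * z.2.2.2.2.2 ^ 2 / 2) := by
    have : 0 ≤ (z.1 * z.2.2.2.1) ^ 2 * z.2.2.2.2.2 ^ 2 := by positivity
    exact Real.le_sqrt_of_sq_le (by nlinarith [sq_nonneg (a.a₂ * z.2.2.1)])
  rw [abs_le] at h1
  unfold startX
  constructor <;> linarith [h1.1, h1.2]

theorem contDiffAt_cutPoint (hχ : ContDiff ℝ ∞ χ) (z : ℝ × ℝ × ℝ × ℝ × ℝ × ℝ) :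
    ContDiffAt ℝ ∞ (fun z : ℝ × ℝ × ℝ × ℝ × ℝ × ℝ => cutPoint χ z.1 z.2) z := by
  unfold cutPoint; fun_prop

theorem contDiff_deriv_cutoff (hχ : ContDiff ℝ ∞ χ) : ContDiff ℝ ∞ (deriv χ) :=
  (contDiff_infty_iff_deriv.1 hχ).2

theorem contDiffAt_scaleStep (hc : IsCutoff η χ χ₁ θ) {z : ℝ × ℝ × ℝ × ℝ × ℝ × ℝ}
    (hz : cutPoint χ z.1 z.2 ∈ backDomain a) : ContDiffAt ℝ ∞ (scaleStep a χ χ₁) z := by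
  have h1 := hc.smooth
  have h2 := hc.smooth₁
  have h3 := contDiff_deriv_cutoff hc.smooth
  have h4 : ContDiffAt ℝ ∞ (fun z : ℝ × ℝ × ℝ × ℝ × ℝ × ℝ => scaleRate a (cutPoint χ z.1 z.2)) z :=
    (contDiffAt_scaleRate a hz).comp (f := fun z : ℝ × ℝ × ℝ × ℝ × ℝ × ℝ => cutPoint χ z.1 z.2) z
      (contDiffAt_cutPoint h1 z)
  unfold scaleStep scaleCorr driftHat
  fun_prop

theorem contDiffAt_fibreError (hc : IsCutoff η χ χ₁ θ) {z : ℝ × ℝ × ℝ × ℝ × ℝ × ℝ}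
    (hz0 : 0 ≤ z.1 * z.2.2.2.1)
    (hz : cutPoint χ z.1 (onStart a z).2 ∈ backDomain a) :
    ContDiffAt ℝ ∞ (fibreError a χ χ₁ θ) z := by
  have h1 := hc.smooth
  have h2 := hc.smoothθ
  have h3 := contDiff_deriv_cutoff hc.smooth
  have h4 := contDiffAt_startX (a := a) hz0
  have h5 : ContDiffAt ℝ ∞ (onStart a) z := by unfold onStart; fun_prop
  have h6 : ContDiffAt ℝ ∞ (fun z => scaleStep a χ χ₁ (onStart a z)) z :=
    (contDiffAt_scaleStep hc hz).comp z h5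
  have h7 : ContDiffAt ℝ ∞ (fun z => scaleLog a χ χ₁ (onStart a z)) z := by
    unfold scaleLog
    change ContDiffAt ℝ ∞ (fun z : ℝ × ℝ × ℝ × ℝ × ℝ × ℝ =>
      z.2.2.2.2.2 * (z.1 * scaleStep a χ χ₁ (onStart a z))) z
    fun_prop
  have h8 : ContDiffAt ℝ ∞ (fun z => moveBase (scaleLog a χ χ₁ (onStart a z)) z) z := by
    unfold moveBase; fun_prop
  have h9 : ContDiffAt ℝ ∞ (fun z => startX a (moveBase (scaleLog a χ χ₁ (onStart a z)) z)) z := by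
    refine (contDiffAt_startX ?_).comp z h8
    have : 0 ≤ Real.exp (-2 * scaleLog a χ χ₁ (onStart a z)) * (z.1 * z.2.2.2.1) := by positivity
    simp only [moveBase]
    linarith
  have h10 : ContDiffAt ℝ ∞ (fun z => fibreRate a (cutPoint χ z.1 (onStart a z).2)) z :=
    (contDiffAt_fibreRate a hz).comp (f := fun z => cutPoint χ z.1 (onStart a z).2) z
      ((contDiffAt_cutPoint h1 (onStart a z)).comp z h5)
  have h11 : ContDiffAt ℝ ∞ (defect a χ χ₁) z := by unfold defect; fun_prop
  unfold fibreError fibreCorr driftHat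
  fun_prop

theorem fibreRate_of_field_zero {x r m h : ℝ} (hf : field₁ a r 0 x 1 = 0) :
    fibreRate a (x, r, 0, m, h) = 0 := by
  simp [fibreRate, backNum, hf]

theorem field₁_startX {z : ℝ × ℝ × ℝ × ℝ × ℝ × ℝ} (hz : z.1 * z.2.2.2.1 = 0) :
    field₁ a z.2.2.1 0 (startX a z) 1 = 0 := by
  have h4 : √((a.a₂ * z.2.2.1) ^ 2 + 4) ^ 2 = (a.a₂ * z.2.2.1) ^ 2 + 4 :=
    Real.sq_sqrt (by positivity)
  rw [startX, hz]
  simp only [mul_zero, add_zero, ne_eq, OfNat.ofNat_ne_zero, not_false_eq_true, zero_pow,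
    zero_mul, zero_div, field₁]
  linear_combination (1 / 4) * h4

/-- For `ε = 0` the base is at rest and `startX` is the root of `x² - a₂ r x - 1`, where the fibre
rate vanishes. -/
theorem defect_of_eps_zero {z : ℝ × ℝ × ℝ × ℝ × ℝ × ℝ} (hz : z.1 * z.2.2.2.1 = 0) :
    defect a χ χ₁ z = 0 := by
  have hs : scaleLog a χ χ₁ (onStart a z) = 0 := by
    simp only [scaleLog, scaleStep, onStart]
    linear_combination z.2.2.2.2.2 * χ₁ z.2.2.2.2.2 * χ z.2.2.1 *
      (scaleRate a (cutPoint χ z.1 (startX a z, z.2.2)) + scaleCorr a χ z.1 (startX a z, z.2.2)) *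
      hz
  have hc : z.1 * (χ z.2.2.1 * z.2.2.2.1) = 0 := by linear_combination χ z.2.2.1 * hz
  have hf : fibreRate a (cutPoint χ z.1 (onStart a z).2) = 0 := by
    simp only [cutPoint, onStart, hc]
    exact fibreRate_of_field_zero (field₁_startX hz)
  rw [defect, hs, hf]
  simp [moveBase]

/-- All modifications of the fibre rate disappear with `δ`; hence for small `δ` they spoil neither
its expansion nor its signs at the ends of the fibre. -/
theorem fibreError_of_delta_zero (w : ℝ × ℝ × ℝ × ℝ × ℝ) : fibreError a χ χ₁ θ (0, w) = 0 := by
  rw [fibreError, defect_of_eps_zero (by simp)]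
  simp [fibreCorr]

/-- Since `E` vanishes identically at `δ = 0`, so does its derivative in `x`; both are then at most
a constant times `δ` by the mean value inequality on the compact box. -/
theorem exists_small_bound {E : ℝ × ℝ × ℝ × ℝ × ℝ × ℝ → ℝ} {d b c R κ T : ℝ} (hd : 0 ≤ d)
    (hE : ∀ z ∈ stepBox d (Icc b c) R κ T, ContDiffAt ℝ ∞ E z) (h0 : ∀ w, E (0, w) = 0) :
    ∃ C, 0 ≤ C ∧ ∀ z ∈ stepBox d (Icc b c) R κ T, |E z| ≤ C * z.1 ∧
      |fderiv ℝ E z (0, 1, 0, 0, 0, 0)| ≤ C * z.1 := by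
  have hE' : ∀ z ∈ stepBox d (Icc b c) R κ T,
      ContDiffAt ℝ ∞ (fun z => fderiv ℝ E z (0, 1, 0, 0, 0, 0)) z := fun z hz =>
    ((hE z hz).fderiv_right (m := ∞) (by simp)).clm_apply contDiffAt_const
  obtain ⟨C₁, h1, hC₁⟩ := exists_taylor_bound isCompact_stepBox convex_stepBox
    fun z hz => (hE z hz).of_le (by norm_cast)
  obtain ⟨C₂, h2, hC₂⟩ := exists_taylor_bound isCompact_stepBox convex_stepBox
    fun z hz => (hE' z hz).of_le (by norm_cast)
  refine ⟨max C₁ C₂, le_max_of_le_left h1, fun z hz => ?_⟩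
  have hz0 : (0, z.2) ∈ stepBox d (Icc b c) R κ T := ⟨⟨le_rfl, hd⟩, hz.2⟩
  have hz1 : 0 ≤ z.1 := hz.1.1
  have hn : ‖z - (0, z.2)‖ = z.1 := by
    have : z - (0, z.2) = (z.1, 0) := by ext <;> simp
    rw [this, Prod.norm_mk, norm_zero, max_eq_left (norm_nonneg _), Real.norm_eq_abs,
      abs_of_nonneg hz1]
  have i1 := ((hC₁ _ hz0).2.2 z hz).1
  have i2 := ((hC₂ _ hz0).2.2 z hz).1
  have e : fderiv ℝ E (0, z.2) (0, 1, 0, 0, 0, 0) = 0 := by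
    refine fderiv_eq_of_hasDerivAt ((hE _ hz0).differentiableAt (by simp)) ?_
    refine (hasDerivAt_const (0 : ℝ) (0 : ℝ)).congr_of_eventuallyEq
      (Filter.Eventually.of_forall fun t => ?_)
    have : ((0, z.2) + t • (0, 1, 0, 0, 0, 0) : ℝ × ℝ × ℝ × ℝ × ℝ × ℝ) =
      (0, z.2 + t • (1, 0, 0, 0, 0)) := by simp
    beta_reduce
    rw [this, h0]
  rw [hn, h0, sub_zero] at i1
  rw [hn, e, sub_zero] at i2
  exact ⟨i1.trans (by gcongr; exact le_max_left _ _), i2.trans (by gcongr; exact le_max_right _ _)⟩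

end

/-! ### The modified backward step as a graph system -/

/-- The function `(e^t - 1) / t`, extended to `t = 0`. -/
noncomputable def expQuot : ℝ → ℝ := dslope Real.exp 0

theorem exp_eq_add_mul_expQuot (t : ℝ) : Real.exp t = 1 + t * expQuot t := by
  have := sub_smul_dslope Real.exp 0 t
  rw [sub_zero, Real.exp_zero, smul_eq_mul] at this
  change t * expQuot t = _ at this
  linarith

theorem contDiff_expQuot : ContDiff ℝ ∞ expQuot := contDiff_iff_contDiffAt.2 fun _ =>
  (analyticAt_dslope analyticAt_rexp).contDiffAt

/-- The set of all `(δ, x, r, e, m, h)` on the scale `η`. -/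
def stepDom (η : ℝ) : Set (ℝ × ℝ × ℝ × ℝ × ℝ × ℝ) :=
  stepBox η (Icc (-7 / 4) (-1 / 4)) η (1 / 8) (Real.log η)

/-- The base of the graphs on the scale `η`, in the coordinates `(r, e, m, log h)`. -/
def baseDom (η : ℝ) : Set (ℝ × ℝ × ℝ × ℝ) := logBox η (1 / 8) (Real.log η)

section

variable (a : Coeffs) (χ χ₁ θ : ℝ → ℝ)

/-- Increment of the base point in the cut-off backward step, divided by `h δ`. -/
noncomputable def baseStep (z : ℝ × ℝ × ℝ × ℝ × ℝ × ℝ) : ℝ × ℝ × ℝ × ℝ :=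
  (z.2.2.1 * (scaleStep a χ χ₁ z * expQuot (scaleLog a χ χ₁ z)),
    -2 * z.2.2.2.1 * (scaleStep a χ χ₁ z * expQuot (-2 * scaleLog a χ χ₁ z)),
    -(z.2.2.2.2.1 * (scaleStep a χ χ₁ z * expQuot (-scaleLog a χ χ₁ z))),
    scaleStep a χ χ₁ z)

/-- Fibre increment of the cut-off backward step. -/
noncomputable def backA (δ x : ℝ) (q : ℝ × ℝ × ℝ × ℝ) : ℝ :=
  Real.exp q.2.2.2 * fibreStep a χ χ₁ θ (δ, overBase x q)

/-- Base increment of the cut-off backward step. -/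
noncomputable def backB (δ x : ℝ) (q : ℝ × ℝ × ℝ × ℝ) : ℝ × ℝ × ℝ × ℝ :=
  δ • (Real.exp q.2.2.2 • baseStep a χ χ₁ (δ, overBase x q))

theorem add_backB (δ x : ℝ) (q : ℝ × ℝ × ℝ × ℝ) :
    q + backB a χ χ₁ δ x q = scaled (scaleLog a χ χ₁ (δ, overBase x q)) q := by
  have hs : scaleLog a χ χ₁ (δ, overBase x q) =
    Real.exp q.2.2.2 * (δ * scaleStep a χ χ₁ (δ, overBase x q)) := rfl
  simp only [scaled, exp_eq_add_mul_expQuot (scaleLog a χ χ₁ (δ, overBase x q)),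
    exp_eq_add_mul_expQuot (-2 * scaleLog a χ χ₁ (δ, overBase x q)),
    exp_eq_add_mul_expQuot (-scaleLog a χ χ₁ (δ, overBase x q))]
  set s := scaleLog a χ χ₁ (δ, overBase x q) with hsdef
  simp only [backB, baseStep, ← hsdef]
  set σ := scaleStep a χ χ₁ (δ, overBase x q)
  simp only [overBase]
  refine Prod.ext ?_ (Prod.ext ?_ (Prod.ext ?_ ?_))
  · simp only [Prod.fst_add, Prod.smul_fst, smul_eq_mul]
    linear_combination (-(expQuot s * q.1)) * hs
  · simp only [Prod.fst_add, Prod.snd_add, Prod.smul_fst, Prod.smul_snd, smul_eq_mul]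
    linear_combination (2 * expQuot (-2 * s) * q.2.1) * hs
  · simp only [Prod.fst_add, Prod.snd_add, Prod.smul_fst, Prod.smul_snd, smul_eq_mul]
    linear_combination (expQuot (-s) * q.2.2.1) * hs
  · simp only [Prod.snd_add, Prod.smul_snd, smul_eq_mul]
    linear_combination -hs

variable {a χ χ₁ θ} {η : ℝ}

theorem cut_mem (hc : IsCutoff η χ χ₁ θ) {z : ℝ × ℝ × ℝ × ℝ × ℝ × ℝ} (hz : z ∈ stepDom η) :
    z.1 * (χ z.2.2.1 * z.2.2.2.1) ∈ Icc 0 η ∧ z.1 * z.2.2.2.1 ∈ Icc 0 η := by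
  obtain ⟨h1, -, -, h2, -⟩ := hz
  obtain ⟨h3, h4⟩ := hc.range z.2.2.1
  have h5 := h1.1
  have h6 := h2.1
  have h7 := mul_le_one₀ h4 h6 h2.2
  exact ⟨⟨by positivity, (mul_le_of_le_one_right h5 h7).trans h1.2⟩,
    by positivity, (mul_le_of_le_one_right h5 h2.2).trans h1.2⟩

theorem step_mem (hη : IsRegularRadius a η) {z : ℝ × ℝ × ℝ × ℝ × ℝ × ℝ} (hz : z ∈ stepDom η) :
    z.2.2.2.2.2 ∈ Icc 0 η := by
  have := hz.2.2.2.2.2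
  rwa [Real.exp_log hη.pos] at this

theorem regular_cut (hη : IsRegularRadius a η) (hc : IsCutoff η χ χ₁ θ)
    {z : ℝ × ℝ × ℝ × ℝ × ℝ × ℝ} (hz : z ∈ stepDom η) :
    cutPoint χ z.1 z.2 ∈ backDomain a ∧
      1 / 4 < fderiv ℝ (fibreRate a) (cutPoint χ z.1 z.2) (1, 0, 0, 0, 0) ∧
      z.2.2.2.2.2 * fderiv ℝ (fibreRate a) (cutPoint χ z.1 z.2) (1, 0, 0, 0, 0) < 1 / 2 ∧
      1 / 2 < fibreRate a (cutPoint χ z.1 (-1 / 2, z.2.2)) ∧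
      fibreRate a (cutPoint χ z.1 (-3 / 2, z.2.2)) < -1 / 2 ∧
      1 / 32 < scaleRate a (cutPoint χ z.1 z.2) := by
  obtain ⟨h1, h2, h3, h4, h5, h6, -⟩ := hη.regular z.2.1 hz.2.1 z.2.2.1 hz.2.2.1 _ (cut_mem hc hz).1
    z.2.2.2.2.1 (by have := hz.2.2.2.2.1; constructor <;> linarith [this.1, this.2])
    z.2.2.2.2.2 (step_mem hη hz)
  exact ⟨h1, h2, h3, h4, h5, h6⟩

theorem startX_mem_of_stepDom (hη : IsRegularRadius a η) (hc : IsCutoff η χ χ₁ θ)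
    {z : ℝ × ℝ × ℝ × ℝ × ℝ × ℝ} (hz : z ∈ stepDom η) :
    startX a z ∈ Icc (-3 / 2 : ℝ) (-1 / 2) :=
  startX_mem hη hz.2.2.1 (cut_mem hc hz).2 (step_mem hη hz)

theorem onStart_mem (hη : IsRegularRadius a η) (hc : IsCutoff η χ χ₁ θ)
    {z : ℝ × ℝ × ℝ × ℝ × ℝ × ℝ} (hz : z ∈ stepDom η) : onStart a z ∈ stepDom η := by
  have := startX_mem_of_stepDom hη hc hz
  refine ⟨hz.1, Icc_subset_Icc ?_ ?_ this, hz.2.2⟩ <;> norm_num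

theorem smooth_fibreError (hη : IsRegularRadius a η) (hc : IsCutoff η χ χ₁ θ)
    {z : ℝ × ℝ × ℝ × ℝ × ℝ × ℝ} (hz : z ∈ stepDom η) :
    ContDiffAt ℝ ∞ (fibreError a χ χ₁ θ) z :=
  contDiffAt_fibreError hc (cut_mem hc hz).2.1 (regular_cut hη hc (onStart_mem hη hc hz)).1

theorem smooth_scaleStep (hη : IsRegularRadius a η) (hc : IsCutoff η χ χ₁ θ)
    {z : ℝ × ℝ × ℝ × ℝ × ℝ × ℝ} (hz : z ∈ stepDom η) : ContDiffAt ℝ ∞ (scaleStep a χ χ₁) z :=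
  contDiffAt_scaleStep hc (regular_cut hη hc hz).1

theorem smooth_fibreStep (hη : IsRegularRadius a η) (hc : IsCutoff η χ χ₁ θ)
    {z : ℝ × ℝ × ℝ × ℝ × ℝ × ℝ} (hz : z ∈ stepDom η) :
    ContDiffAt ℝ ∞ (fibreStep a χ χ₁ θ) z := by
  have h1 : ContDiffAt ℝ ∞ (fun z => fibreRate a (cutPoint χ z.1 z.2)) z :=
    (contDiffAt_fibreRate a (regular_cut hη hc hz).1).comp
      (f := fun z : ℝ × ℝ × ℝ × ℝ × ℝ × ℝ => cutPoint χ z.1 z.2) z (contDiffAt_cutPoint hc.smooth z)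
  exact h1.add (smooth_fibreError hη hc hz)

theorem smooth_baseStep (hη : IsRegularRadius a η) (hc : IsCutoff η χ χ₁ θ)
    {z : ℝ × ℝ × ℝ × ℝ × ℝ × ℝ} (hz : z ∈ stepDom η) :
    ContDiffAt ℝ ∞ (baseStep a χ χ₁) z := by
  have h1 := smooth_scaleStep hη hc hz
  have h2 := contDiff_expQuot
  have h3 : ContDiffAt ℝ ∞ (scaleLog a χ χ₁) z := by unfold scaleLog; fun_prop
  unfold baseStep
  fun_prop

theorem fderiv_fibreStep (hη : IsRegularRadius a η) (hc : IsCutoff η χ χ₁ θ)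
    {z : ℝ × ℝ × ℝ × ℝ × ℝ × ℝ} (hz : z ∈ stepDom η) :
    fderiv ℝ (fibreStep a χ χ₁ θ) z (0, 1, 0, 0, 0, 0) =
      fderiv ℝ (fibreRate a) (cutPoint χ z.1 z.2) (1, 0, 0, 0, 0) +
        fderiv ℝ (fibreError a χ χ₁ θ) z (0, 1, 0, 0, 0, 0) := by
  have h1 : ContDiffAt ℝ ∞ (fun z => fibreRate a (cutPoint χ z.1 z.2)) z :=
    (contDiffAt_fibreRate a (regular_cut hη hc hz).1).comp
      (f := fun z : ℝ × ℝ × ℝ × ℝ × ℝ × ℝ => cutPoint χ z.1 z.2) z (contDiffAt_cutPoint hc.smooth z)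
  have h2 := smooth_fibreError hη hc hz
  have h3 : fibreStep a χ χ₁ θ =
    (fun z => fibreRate a (cutPoint χ z.1 z.2)) + fibreError a χ χ₁ θ := rfl
  rw [h3, fderiv_add (h1.differentiableAt (by simp)) (h2.differentiableAt (by simp))]
  refine congrArg (· + fderiv ℝ (fibreError a χ χ₁ θ) z (0, 1, 0, 0, 0, 0)) ?_
  refine fderiv_eq_of_hasDerivAt (h1.differentiableAt (by simp)) ?_
  have h4 := ((contDiffAt_fibreRate a (regular_cut hη hc hz).1).differentiableAt
    (by simp)).hasFDerivAt
  have h5 : HasDerivAt (fun t : ℝ => cutPoint χ z.1 z.2 + t • ((1, 0, 0, 0, 0) :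
      ℝ × ℝ × ℝ × ℝ × ℝ)) (1, 0, 0, 0, 0) 0 := by
    simpa using ((hasDerivAt_id (0 : ℝ)).smul_const
      ((1, 0, 0, 0, 0) : ℝ × ℝ × ℝ × ℝ × ℝ)).const_add (cutPoint χ z.1 z.2)
  have h6 : cutPoint χ z.1 z.2 = cutPoint χ z.1 z.2 + (0 : ℝ) • ((1, 0, 0, 0, 0) :
    ℝ × ℝ × ℝ × ℝ × ℝ) := by simp
  rw [h6] at h4
  have h7 := h4.comp_hasDerivAt 0 h5
  rw [← h6] at h7
  refine h7.congr_of_eventuallyEq (Filter.Eventually.of_forall fun t => ?_)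
  refine congrArg (fibreRate a) ?_
  simp [cutPoint, Prod.ext_iff]

/-- Uniform bounds for the cut-off step when `δ` is small. -/
theorem exists_step_bounds (hη : IsRegularRadius a η) (hc : IsCutoff η χ χ₁ θ) :
    ∃ C, 1 ≤ C ∧ ∀ z ∈ stepDom η, C * z.1 ≤ 1 / 64 →
      1 / 8 ≤ fderiv ℝ (fibreStep a χ χ₁ θ) z (0, 1, 0, 0, 0, 0) ∧
      z.2.2.2.2.2 * fderiv ℝ (fibreStep a χ χ₁ θ) z (0, 1, 0, 0, 0, 0) ≤ 1 ∧
      0 ≤ fibreStep a χ χ₁ θ (z.1, -1 / 2, z.2.2) ∧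
      fibreStep a χ χ₁ θ (z.1, -3 / 2, z.2.2) ≤ 0 ∧
      0 ≤ scaleStep a χ χ₁ z ∧ scaleStep a χ χ₁ z ≤ C ∧
      |fderiv ℝ (scaleStep a χ χ₁) z (0, 1, 0, 0, 0, 0)| ≤ C := by
  obtain ⟨C₁, h1, hC₁⟩ := exists_small_bound (d := η) (b := -7 / 4) (c := -1 / 4) (R := η)
    (κ := 1 / 8) (T := Real.log η) hη.pos.le (fun z hz => smooth_fibreError hη hc hz)
    fibreError_of_delta_zero
  obtain ⟨C₂, h2, hC₂⟩ := exists_small_bound (d := η) (b := -7 / 4) (c := -1 / 4) (R := η)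
    (κ := 1 / 8) (T := Real.log η) (E := fun z => scaleCorr a χ z.1 z.2) hη.pos.le
    (fun z _ => by
      have := hc.smooth
      have := contDiff_deriv_cutoff hc.smooth
      unfold scaleCorr driftHat
      fun_prop) (fun w => by simp [scaleCorr])
  obtain ⟨C₃, h3, hC₃⟩ := exists_taylor_bound (isCompact_stepBox (d := η) (a := -7 / 4)
    (b := -1 / 4) (R := η) (κ := 1 / 8) (T := Real.log η)) convex_stepBox
    fun z hz => (smooth_scaleStep hη hc hz).of_le (by norm_cast)
  -- With `C δ ≤ 1/64` every perturbation stays within the margins of `IsRegularRadius`: `1/4`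
  -- against `1/8` for the expansion, `1/2` for the end point signs, `1/32` for the scaling rate.
  set C := C₁ + C₂ + C₃ + 1
  refine ⟨C, by linarith, fun z hz hδ => ?_⟩
  have hz0 : 0 ≤ z.1 := hz.1.1
  have k1 : C₁ * z.1 ≤ 1 / 64 := (mul_le_mul_of_nonneg_right (by linarith) hz0).trans hδ
  have k2 : C₂ * z.1 ≤ 1 / 64 := (mul_le_mul_of_nonneg_right (by linarith) hz0).trans hδ
  obtain ⟨r1, r2, r3, r4, r5, r6⟩ := regular_cut hη hc hz
  obtain ⟨e1, e2⟩ := hC₁ z hz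
  obtain ⟨f1, -⟩ := hC₂ z hz
  obtain ⟨g1, g2, -⟩ := hC₃ z hz
  have hh := step_mem hη hz
  have hη4 := hη.le
  have e2' := abs_le.1 (e2.trans k1)
  rw [fderiv_fibreStep hη hc hz]
  refine ⟨by linarith [e2'.1], ?_, ?_, ?_, ?_, ?_, ?_⟩
  · have : z.2.2.2.2.2 * fderiv ℝ (fibreError a χ χ₁ θ) z (0, 1, 0, 0, 0, 0) ≤ 1 * (1 / 64) :=
      (mul_le_mul_of_nonneg_left e2'.2 hh.1).trans
        (mul_le_mul_of_nonneg_right (by linarith [hh.2]) (by norm_num))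
    rw [mul_add]
    linarith
  · have hz' : (z.1, -1 / 2, z.2.2) ∈ stepDom η := ⟨hz.1, by norm_num, hz.2.2⟩
    have := abs_le.1 ((hC₁ _ hz').1.trans k1)
    rw [fibreStep]
    linarith [this.1]
  · have hz' : (z.1, -3 / 2, z.2.2) ∈ stepDom η := ⟨hz.1, by norm_num, hz.2.2⟩
    have := abs_le.1 ((hC₁ _ hz').1.trans k1)
    rw [fibreStep]
    linarith [this.2]
  · have := (abs_le.1 (f1.trans k2)).1
    have i1 := (hc.range₁ z.2.2.2.2.2).1
    have i2 := (hc.range z.2.2.1).1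
    have i3 := hz.2.2.2.1.1
    have i4 : 0 ≤ scaleRate a (cutPoint χ z.1 z.2) + scaleCorr a χ z.1 z.2 := by linarith
    rw [scaleStep]
    positivity
  · exact (le_abs_self _).trans (g1.trans (by linarith))
  · refine ((fderiv ℝ (scaleStep a χ χ₁) z).le_opNorm _).trans ?_
    have : ‖((0, 1, 0, 0, 0, 0) : ℝ × ℝ × ℝ × ℝ × ℝ × ℝ)‖ = 1 := by simp [Prod.norm_mk]
    rw [this, mul_one]
    linarith

end

section

variable {a : Coeffs} {χ χ₁ θ : ℝ → ℝ} {η : ℝ}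

theorem exp_le_of_baseDom (hη : 0 < η) {q : ℝ × ℝ × ℝ × ℝ} (hq : q ∈ baseDom η) :
    Real.exp q.2.2.2 ≤ η := by
  have := Real.exp_le_exp.2 hq.2.2.2
  rwa [Real.exp_log hη] at this

/-- The cut-off step keeps the base invariant. -/
theorem scaled_mem_baseDom (hη : 0 < η) (hc : IsCutoff η χ χ₁ θ) {δ x : ℝ}
    {q : ℝ × ℝ × ℝ × ℝ} (hq : q ∈ baseDom η) (h0 : 0 ≤ scaleLog a χ χ₁ (δ, overBase x q))
    (h1 : scaleLog a χ χ₁ (δ, overBase x q) ≤ Real.log 2) :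
    scaled (scaleLog a χ χ₁ (δ, overBase x q)) q ∈ baseDom η ∧
      (q.1 < η → (scaled (scaleLog a χ χ₁ (δ, overBase x q)) q).1 < η) := by
  -- The cut-offs freeze the base where `r` or `h` is at least `η/2`; elsewhere the factor `e^s ≤ 2`
  -- cannot carry these coordinates beyond `η`.
  have hr : η / 2 ≤ q.1 → scaleLog a χ χ₁ (δ, overBase x q) = 0 := fun h => by
    have : χ (overBase x q).2.1 = 0 := hc.zero _ h
    simp [scaleLog, scaleStep, this]
  have hh : η / 2 ≤ Real.exp q.2.2.2 → scaleLog a χ χ₁ (δ, overBase x q) = 0 := fun h => by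
    have : χ₁ (overBase x q).2.2.2.2 = 0 := hc.zero₁ _ h
    simp [scaleLog, scaleStep, this]
  set s := scaleLog a χ χ₁ (δ, overBase x q)
  obtain ⟨⟨q1, q2⟩, ⟨q3, q4⟩, ⟨q5, q6⟩, q7⟩ := hq
  have e1 : 1 ≤ Real.exp s := Real.one_le_exp h0
  have e2 : Real.exp s ≤ 2 := by
    have := Real.exp_le_exp.2 h1
    rwa [Real.exp_log two_pos] at this
  have e3 : Real.exp (-2 * s) ≤ 1 := Real.exp_le_one_iff.2 (by linarith)
  have e4 : Real.exp (-s) ≤ 1 := Real.exp_le_one_iff.2 (by linarith)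
  have e5 := Real.exp_pos (-2 * s)
  have e6 := Real.exp_pos (-s)
  have hr' : Real.exp s * q.1 ≤ η ∧ (q.1 < η → Real.exp s * q.1 < η) := by
    rcases le_or_gt (η / 2) q.1 with h | h
    · rw [hr h, Real.exp_zero, one_mul]; exact ⟨q2, id⟩
    · have : Real.exp s * q.1 < η := by nlinarith
      exact ⟨this.le, fun _ => this⟩
  refine ⟨⟨⟨by simp only [scaled]; positivity, hr'.1⟩, ⟨by simp only [scaled]; positivity, ?_⟩,
    ⟨?_, ?_⟩, ?_⟩, hr'.2⟩
  · simp only [scaled]; nlinarith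
  · simp only [scaled]; nlinarith
  · simp only [scaled]; nlinarith
  · change q.2.2.2 + s ≤ Real.log η
    rcases le_or_gt (η / 2) (Real.exp q.2.2.2) with h | h
    · rw [hh h, add_zero]; exact q7
    · rw [Real.le_log_iff_exp_le hη, Real.exp_add]
      have := Real.exp_pos q.2.2.2
      nlinarith

theorem hasDerivAt_backA (hη : IsRegularRadius a η) (hc : IsCutoff η χ χ₁ θ) {δ x : ℝ}
    {q : ℝ × ℝ × ℝ × ℝ} (hz : (δ, overBase x q) ∈ stepDom η) :
    HasDerivAt (fun x => backA a χ χ₁ θ δ x q) (Real.exp q.2.2.2 *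
      fderiv ℝ (fibreStep a χ χ₁ θ) (δ, overBase x q) (0, 1, 0, 0, 0, 0)) x := by
  have h1 := ((smooth_fibreStep hη hc hz).differentiableAt (by simp)).hasFDerivAt
  have h2 : HasDerivAt (fun x => (δ, overBase x q)) ((0, 1, 0, 0, 0, 0) :
      ℝ × ℝ × ℝ × ℝ × ℝ × ℝ) x :=
    (hasDerivAt_const _ _).prodMk ((hasDerivAt_id x).prodMk (hasDerivAt_const x (q.1, q.2.1,
      q.2.2.1, Real.exp q.2.2.2)))
  exact (h1.comp_hasDerivAt x h2).const_mul _

/-- For small `δ` the cut-off backward step is a graph system. -/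
theorem exists_isGraphSystem (hη : IsRegularRadius a η) (hc : IsCutoff η χ χ₁ θ) :
    ∃ C, 1 ≤ C ∧ ∀ δ, 0 < δ → δ ≤ η → C * δ ≤ 1 / 64 →
      IsGraphSystem (baseDom η) (Icc (-7 / 4) (-1 / 4)) (-3 / 2) (-1 / 2)
        (fun q => Real.exp q.2.2.2) (backA a χ χ₁ θ δ) (backB a χ χ₁ δ) (1 / 8) C (C * δ) ∧
      ∀ x ∈ Icc (-7 / 4 : ℝ) (-1 / 4), ∀ q ∈ baseDom η,
        0 ≤ scaleLog a χ χ₁ (δ, overBase x q) ∧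
        scaleLog a χ χ₁ (δ, overBase x q) ≤ C * δ * Real.exp q.2.2.2 ∧
        |fderiv ℝ (scaleStep a χ χ₁) (δ, overBase x q) (0, 1, 0, 0, 0, 0)| ≤ C ∧
        1 / 8 ≤ fderiv ℝ (fibreStep a χ χ₁ θ) (δ, overBase x q) (0, 1, 0, 0, 0, 0) ∧
        (q.1 < η → (scaled (scaleLog a χ χ₁ (δ, overBase x q)) q).1 < η) := by
  obtain ⟨C₁, h1, hC₁⟩ := exists_step_bounds (θ := θ) hη hc
  obtain ⟨C₂, h2, hC₂⟩ := exists_weighted_taylor_bound (d := η) (a := -7 / 4) (b := -1 / 4)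
    (R := η) (κ := 1 / 8) (T := Real.log η)
    fun z hz => (smooth_fibreStep (θ := θ) hη hc hz).of_le (by norm_cast)
  obtain ⟨C₃, h3, hC₃⟩ := exists_weighted_taylor_bound (d := η) (a := -7 / 4) (b := -1 / 4)
    (R := η) (κ := 1 / 8) (T := Real.log η)
    fun z hz => (smooth_baseStep hη hc hz).of_le (by norm_cast)
  set C := C₁ + C₂ + C₃ with hC
  refine ⟨C, by linarith, fun δ hδ0 hδ hCδ => ?_⟩
  have hδI : δ ∈ Icc 0 η := ⟨hδ0.le, hδ⟩
  have hδ1 : δ ≤ 1 := by linarith [hη.le]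
  have hmem : ∀ x ∈ Icc (-7 / 4 : ℝ) (-1 / 4), ∀ q ∈ baseDom η, (δ, overBase x q) ∈ stepDom η :=
    fun x hx q hq => overBase_mem_stepBox hδI hx hq
  have hC₁δ : C₁ * δ ≤ 1 / 64 := (mul_le_mul_of_nonneg_right (by linarith) hδ0.le).trans hCδ
  have hb := fun x hx q hq => hC₁ _ (hmem x hx q hq) hC₁δ
  have hexp : ∀ q ∈ baseDom η, Real.exp q.2.2.2 ≤ 1 / 4 := fun q hq =>
    (exp_le_of_baseDom hη.pos hq).trans hη.le
  have hs : ∀ x ∈ Icc (-7 / 4 : ℝ) (-1 / 4), ∀ q ∈ baseDom η,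
      0 ≤ scaleLog a χ χ₁ (δ, overBase x q) ∧
      scaleLog a χ χ₁ (δ, overBase x q) ≤ C * δ * Real.exp q.2.2.2 := by
    intro x hx q hq
    obtain ⟨-, -, -, -, b1, b2, -⟩ := hb x hx q hq
    have := Real.exp_pos q.2.2.2
    constructor
    · exact mul_nonneg this.le (mul_nonneg hδ0.le b1)
    · change Real.exp q.2.2.2 * (δ * _) ≤ _
      calc _ ≤ Real.exp q.2.2.2 * (δ * C) := by gcongr; linarith
        _ = _ := by ring
  have hs2 : ∀ x ∈ Icc (-7 / 4 : ℝ) (-1 / 4), ∀ q ∈ baseDom η,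
      scaleLog a χ χ₁ (δ, overBase x q) ≤ Real.log 2 := by
    intro x hx q hq
    have i1 := (hs x hx q hq).2
    have i2 := hexp q hq
    have i3 := Real.log_two_gt_d9
    have i4 := Real.exp_pos q.2.2.2
    nlinarith
  have hJ : ∀ x ∈ Icc (-3 / 2 : ℝ) (-1 / 2), x ∈ Icc (-7 / 4 : ℝ) (-1 / 4) := fun x hx =>
    Icc_subset_Icc (by norm_num) (by norm_num) hx
  have hjets : ∀ q : ℝ × ℝ × ℝ × ℝ, 0 < Real.exp q.2.2.2 := fun q => Real.exp_pos _
  have lift : ∀ q : ℝ × ℝ × ℝ × ℝ, ∀ y : ℝ, 0 ≤ y → C₂ * Real.exp q.2.2.2 * y ≤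
      C * Real.exp q.2.2.2 * y := fun q y hy => by
    have := hjets q
    gcongr
    linarith
  -- The increment of the base has the additional factor `δ`, whence the constant `η = C δ` of the
  -- graph system.
  have lift₃ : ∀ q : ℝ × ℝ × ℝ × ℝ, ∀ y : ℝ, 0 ≤ y → δ * (C₃ * Real.exp q.2.2.2 * y) ≤
      C * δ * Real.exp q.2.2.2 * y := fun q y hy => by
    have := hjets q
    have h4 : C₃ ≤ C := by linarith
    calc _ = C₃ * (δ * Real.exp q.2.2.2 * y) := by ring
      _ ≤ C * (δ * Real.exp q.2.2.2 * y) := by gcongr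
      _ = _ := by ring
  refine ⟨⟨hJ, fun q _ => hjets q, fun q hq => by linarith [hexp q hq], ?_, ?_, ?_, ?_, ?_, ?_,
    ?_, ?_, ?_⟩, fun x hx q hq => ⟨(hs x hx q hq).1, (hs x hx q hq).2, ?_, (hb x hx q hq).1,
    (scaled_mem_baseDom hη.pos hc hq (hs x hx q hq).1 (hs2 x hx q hq)).2⟩⟩
  · intro x hx q hq
    rw [add_backB]
    exact (scaled_mem_baseDom hη.pos hc hq (hs x hx q hq).1 (hs2 x hx q hq)).1
  · intro x hx q hq
    rw [add_backB]
    have := (hs x hx q hq).1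
    exact Real.exp_le_exp.2 (by simp only [scaled]; linarith)
  · intro q hq x hx x' hx' hxx
    have hd : ∀ y ∈ Icc (-7 / 4 : ℝ) (-1 / 4), HasDerivAt (fun x => backA a χ χ₁ θ δ x q)
        (Real.exp q.2.2.2 *
          fderiv ℝ (fibreStep a χ χ₁ θ) (δ, overBase y q) (0, 1, 0, 0, 0, 0)) y :=
      fun y hy => hasDerivAt_backA hη hc (hmem y hy q hq)
    have hcont : ContinuousOn (fun x => backA a χ χ₁ θ δ x q) (Icc (-7 / 4 : ℝ) (-1 / 4)) :=
      fun y hy => (hd y hy).continuousAt.continuousWithinAt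
    have hdiff : DifferentiableOn ℝ (fun x => backA a χ χ₁ θ δ x q)
        (interior (Icc (-7 / 4 : ℝ) (-1 / 4))) := fun y hy =>
      (hd y (interior_subset hy)).differentiableAt.differentiableWithinAt
    have hp := hjets q
    constructor
    · refine (convex_Icc _ _).mul_sub_le_image_sub_of_le_deriv hcont hdiff (fun y hy => ?_)
        x' hx' x hx hxx
      rw [(hd y (interior_subset hy)).deriv, mul_comm]
      have := (hb y (interior_subset hy) q hq).1
      gcongr
    · have := (convex_Icc _ _).image_sub_le_mul_sub_of_deriv_le hcont hdiff (C := 1) (fun y hy => ?_)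
        x' hx' x hx hxx
      · rwa [one_mul] at this
      rw [(hd y (interior_subset hy)).deriv]
      exact (hb y (interior_subset hy) q hq).2.1
  · intro q hq
    have := (hb (-3 / 2) (by norm_num) q hq).2.2.2.1
    exact mul_nonpos_of_nonneg_of_nonpos (hjets q).le this
  · intro q hq
    have := (hb (-1 / 2) (by norm_num) q hq).2.2.1
    exact mul_nonneg (hjets q).le this
  · intro x hx q hq q' hq' hqq
    obtain ⟨-, -, l, -, h5⟩ := hC₂ δ hδI x hx q hq
    have := (h5 x hx q' hq' hqq).1
    rw [sub_self, abs_zero, zero_add] at this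
    exact this.trans (lift q _ (norm_nonneg _))
  · intro x hx x' hx' q hq q' hq' hqq
    obtain ⟨-, -, l, -, h5⟩ := hC₃ δ hδI x hx q hq
    have := (h5 x' hx' q' hq' hqq).1
    simp only [backB]
    rw [← smul_sub, norm_smul, Real.norm_eq_abs, abs_of_pos hδ0]
    exact (mul_le_mul_of_nonneg_left this hδ0.le).trans (lift₃ q _ (by positivity))
  · intro x hx q hq
    obtain ⟨-, -, l, hl, h5⟩ := hC₂ δ hδI x hx q hq
    obtain ⟨b1, b2, -⟩ := hb x hx q hq
    have hp := hjets q
    refine ⟨Real.exp q.2.2.2 * fderiv ℝ (fibreStep a χ χ₁ θ) (δ, overBase x q) (0, 1, 0, 0, 0, 0),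
      l, ?_, b2, ?_, fun x' hx' q' hq' hqq => ?_⟩
    · rw [mul_comm]; gcongr
    · have := lift q 1 zero_le_one
      linarith
    · have := (h5 x' hx' q' hq' hqq).2
      rw [smul_eq_mul, smul_eq_mul, smul_eq_mul, smul_eq_mul, mul_comm (x' - x)] at this
      exact this.trans (lift q _ (by positivity))
  · intro x hx q hq
    obtain ⟨-, b0, l, hl, h5⟩ := hC₃ δ hδI x hx q hq
    have hp := hjets q
    refine ⟨δ • (Real.exp q.2.2.2 • fderiv ℝ (baseStep a χ χ₁) (δ, overBase x q)
      (0, 1, 0, 0, 0, 0)), δ • l, ?_, ?_, fun x' hx' q' hq' hqq => ?_⟩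
    · rw [norm_smul, norm_smul, Real.norm_eq_abs, Real.norm_eq_abs, abs_of_pos hδ0, abs_of_pos hp]
      have := lift₃ q 1 zero_le_one
      calc _ ≤ δ * (Real.exp q.2.2.2 * C₃) := by gcongr
        _ ≤ _ := by linarith
    · rw [norm_smul, Real.norm_eq_abs, abs_of_pos hδ0]
      have := lift₃ q 1 zero_le_one
      calc _ ≤ δ * (C₃ * Real.exp q.2.2.2) := by gcongr
        _ ≤ _ := by linarith
    · have := (h5 x' hx' q' hq' hqq).2
      have e : backB a χ χ₁ δ x' q' - backB a χ χ₁ δ x q - (x' - x) • δ • (Real.exp q.2.2.2 •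
          fderiv ℝ (baseStep a χ χ₁) (δ, overBase x q) (0, 1, 0, 0, 0, 0)) - (δ • l) (q' - q) =
          δ • (Real.exp q'.2.2.2 • baseStep a χ χ₁ (δ, overBase x' q')
            - Real.exp q.2.2.2 • baseStep a χ χ₁ (δ, overBase x q)
            - (x' - x) • (Real.exp q.2.2.2 • fderiv ℝ (baseStep a χ χ₁) (δ, overBase x q)
              (0, 1, 0, 0, 0, 0)) - l (q' - q)) := by
        rw [_root_.smul_apply]
        simp only [backB]
        module
      rw [e, norm_smul, Real.norm_eq_abs, abs_of_pos hδ0]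
      refine (mul_le_mul_of_nonneg_left this hδ0.le).trans ((lift₃ q _ (by positivity)).trans ?_)
      have h6 : C * δ ≤ C := by
        have : 0 ≤ C := by linarith
        nlinarith
      gcongr
  · exact (hb x hx q hq).2.2.2.2.2.2.trans (by linarith)

end

/-! ### Invariance of the initial graph over the special curve and the fixed points -/

/-- The special curve `x = -√(1 + ε/2 + ε² h²/8)` is invariant under the backward step on
`r = m = 0`. -/
theorem special_invariant (a : Coeffs) {x ε h : ℝ} (hε : 0 ≤ ε) (hh : 0 ≤ h)
    (hx : x = -√(1 + ε / 2 + ε ^ 2 * h ^ 2 / 8)) (hw : (x, 0, ε, 0, h) ∈ backDomain a) :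
    -√(1 + Real.exp (-2 * (h * (ε * scaleRate a (x, 0, ε, 0, h)))) * ε / 2
        + (Real.exp (-2 * (h * (ε * scaleRate a (x, 0, ε, 0, h)))) * ε) ^ 2
          * (Real.exp (h * (ε * scaleRate a (x, 0, ε, 0, h))) * h) ^ 2 / 8) =
      x + h * fibreRate a (x, 0, ε, 0, h) := by
  have hx0 : x < 0 := by rw [hx]; exact neg_neg_of_pos (Real.sqrt_pos.2 (by positivity))
  have hx2 : x ^ 2 = 1 + ε / 2 + ε ^ 2 * h ^ 2 / 8 := by
    rw [hx, neg_sq]; exact Real.sq_sqrt (by positivity)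
  have h1 := kahanY_back a hw.1.ne'
  have h2 := kahanX_back a hw
  have h3 := sqrt_backQuot a hw
  -- Before rescaling, the step with `-h` moves along the parabola `y = x² - ε/2 - ε²h²/8` and
  -- changes `x` by `-hε/2`.
  obtain ⟨u1, u2⟩ := kahan_unique a (r := 0) (ε := ε) (lam := 0) (h := -h) (x := x) (y := 1)
    (X := x - h * ε / 2) (Y := (x - h * ε / 2) ^ 2 - ε / 2 - ε ^ 2 * h ^ 2 / 8) hw.1.ne'
    (by linear_combination (h / 2) * hx2) (by linear_combination hx2)
  simp only at h1 h2 h3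
  rw [u2] at h1
  rw [u1] at h2
  have h4 : Real.exp (-2 * (h * (ε * scaleRate a (x, 0, ε, 0, h)))) =
      (√(backQuot a (x, 0, ε, 0, h)) ^ 2)⁻¹ := by
    rw [h3, ← Real.exp_nat_mul, ← Real.exp_neg]
    congr 1
    push_cast
    ring
  have h5 : √(backQuot a (x, 0, ε, 0, h)) ^ 2 =
    (x - h * ε / 2) ^ 2 - ε / 2 - ε ^ 2 * h ^ 2 / 8 := (Real.sq_sqrt hw.2.le).trans h1.symm
  have h6 : 0 < √(backQuot a (x, 0, ε, 0, h)) := Real.sqrt_pos.2 hw.2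
  rw [h4, ← h3, ← h2]
  set σ := √(backQuot a (x, 0, ε, 0, h))
  -- The equation of the parabola at the image point, divided by `y = σ²`, is the equation of the
  -- special curve in the rescaled variables.
  have h7 : 1 + (σ ^ 2)⁻¹ * ε / 2 + ((σ ^ 2)⁻¹ * ε) ^ 2 * (σ * h) ^ 2 / 8 =
      (-((x - h * ε / 2) / σ)) ^ 2 := by
    field_simp
    linear_combination 32 * h5
  rw [h7, Real.sqrt_sq, neg_neg]
  rw [neg_nonneg]
  exact div_nonpos_of_nonpos_of_nonneg (by nlinarith [mul_nonneg hh hε]) h6.le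

section

variable {a : Coeffs} {χ χ₁ θ : ℝ → ℝ} {η : ℝ}

theorem startX_of_zero {z : ℝ × ℝ × ℝ × ℝ × ℝ × ℝ} (hr : z.2.2.1 = 0) :
    startX a z = -√(1 + z.1 * z.2.2.2.1 / 2 + (z.1 * z.2.2.2.1) ^ 2 * z.2.2.2.2.2 ^ 2 / 8) := by
  have h1 : (a.a₂ * 0) ^ 2 + 4 + 2 * (z.1 * z.2.2.2.1)
      + (z.1 * z.2.2.2.1) ^ 2 * z.2.2.2.2.2 ^ 2 / 2 =
      2 ^ 2 * (1 + z.1 * z.2.2.2.1 / 2 + (z.1 * z.2.2.2.1) ^ 2 * z.2.2.2.2.2 ^ 2 / 8) := by ring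
  rw [startX, hr, h1, Real.sqrt_mul (by norm_num), Real.sqrt_sq (by norm_num)]
  ring

/-- The graph `startX` is invariant over `{r = m = 0} ∪ {e = 0}`. -/
theorem startX_invariant (hη : IsRegularRadius a η) (hc : IsCutoff η χ χ₁ θ) {δ : ℝ}
    (hδ : δ ∈ Icc 0 η) {q : ℝ × ℝ × ℝ × ℝ} (hq : q ∈ baseDom η)
    (hZ : (q.1 = 0 ∧ q.2.2.1 = 0) ∨ q.2.1 = 0) {y y' : ℝ} :
    startX a (δ, overBase y' (q + backB a χ χ₁ δ (startX a (δ, overBase y q)) q)) =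
      startX a (δ, overBase y q) + backA a χ χ₁ θ δ (startX a (δ, overBase y q)) q := by
  set u := startX a (δ, overBase y q) with hu
  -- `startX` does not depend on the fibre coordinate, so `y`, `y'` and the value `-1` used
  -- elsewhere are placeholders.
  have hu' : startX a (δ, overBase u q) = u := rfl
  set z : ℝ × ℝ × ℝ × ℝ × ℝ × ℝ := (δ, overBase u q) with hz
  have hon : onStart a z = z := rfl
  set S := scaleLog a χ χ₁ z with hS
  have hmove : startX a (δ, overBase y' (scaled S q)) = startX a (moveBase S z) := by
    simp only [startX, overBase, scaled, moveBase, hz, Real.exp_add, mul_comm (Real.exp q.2.2.2)]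
  have hdef : defect a χ χ₁ z = startX a (moveBase S z) - u
    - Real.exp q.2.2.2 * fibreRate a (cutPoint χ δ (overBase u q)) := rfl
  have hfib : backA a χ χ₁ θ δ u q = Real.exp q.2.2.2 *
    (fibreRate a (cutPoint χ δ (overBase u q)) + (fibreCorr a χ δ (overBase u q) +
      θ (Real.exp q.2.2.2) * defect a χ χ₁ z)) := rfl
  rw [add_backB, ← hz, ← hS, hmove, hfib]
  have hstart : startX a (moveBase S z) = u + Real.exp q.2.2.2 *
      fibreRate a (cutPoint χ δ (overBase u q)) + defect a χ χ₁ z := by rw [hdef]; ring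
  rcases hZ with ⟨hr, hm⟩ | he
  · have hcorr : fibreCorr a χ δ (overBase u q) = 0 := by simp [fibreCorr, overBase, hr]
    -- For `h ≥ η/3` the base is altered by `χ₁`, but `h θ(h) = 1`, so the added defect restores
    -- invariance. For `h < η/3` one has `χ₁ = 1`, the step over `r = m = 0` is the true backward
    -- step, and the defect vanishes by `special_invariant`.
    rcases le_or_gt (η / 3) (Real.exp q.2.2.2) with hh | hh
    · have h1 := hc.oneθ _ hh
      rw [hstart, hcorr]
      linear_combination (-(defect a χ χ₁ z)) * h1
    · have hcut : cutPoint χ δ (overBase u q) = (u, 0, δ * q.2.1, 0, Real.exp q.2.2.2) := by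
        simp [cutPoint, overBase, hr, hm, hc.one 0 (by linarith [hη.pos])]
      have hSk : S = Real.exp q.2.2.2 * (δ * q.2.1 *
          scaleRate a (u, 0, δ * q.2.1, 0, Real.exp q.2.2.2)) := by
        have h1 : χ₁ (Real.exp q.2.2.2) = 1 := hc.one₁ _ hh.le
        have h2 : scaleCorr a χ δ (overBase u q) = 0 := by simp [scaleCorr, overBase, hr]
        have h3 : χ q.1 = 1 := hc.one _ (by rw [hr]; linarith [hη.pos])
        change Real.exp q.2.2.2 * (δ * (χ₁ (Real.exp q.2.2.2) * (χ q.1 * q.2.1 *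
          (scaleRate a (cutPoint χ δ (overBase u q)) + scaleCorr a χ δ (overBase u q))))) = _
        rw [h1, h2, h3, hcut]
        ring
      have hux : u = -√(1 + δ * q.2.1 / 2 + (δ * q.2.1) ^ 2 * Real.exp q.2.2.2 ^ 2 / 8) := by
        rw [← hu', startX_of_zero (by exact hr)]
        rfl
      have humem : z ∈ stepDom η := by
        have h1 : (δ, overBase (-1) q) ∈ stepDom η :=
          overBase_mem_stepBox hδ (by norm_num) hq
        exact onStart_mem hη hc h1
      have hdom := (regular_cut hη hc humem).1
      rw [show cutPoint χ z.1 z.2 = _ from hcut] at hdom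
      have hsp := special_invariant a (mul_nonneg hδ.1 hq.2.1.1) (Real.exp_pos q.2.2.2).le hux hdom
      rw [← hcut] at hsp
      rw [hcut, ← hSk, ← hcut] at hsp
      have hst : startX a (moveBase S z) = -√(1 + Real.exp (-2 * S) * (δ * q.2.1) / 2 +
          (Real.exp (-2 * S) * (δ * q.2.1)) ^ 2 * (Real.exp S * Real.exp q.2.2.2) ^ 2 / 8) := by
        rw [startX_of_zero (by simp [moveBase, hz, overBase, hr])]
        simp only [moveBase, hz, overBase]
        ring_nf
      have hd0 : defect a χ χ₁ z = 0 := by rw [hdef, hst, hsp]; ring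
      rw [hst, hsp, hcorr, hd0]
      ring
  · have hd0 : defect a χ χ₁ z = 0 := defect_of_eps_zero (by simp [hz, overBase, he])
    have hcorr : fibreCorr a χ δ (overBase u q) = 0 := by simp [fibreCorr, overBase, he]
    rw [hstart, hd0, hcorr]
    ring

theorem graphClass_startX (hη : IsRegularRadius a η) (hc : IsCutoff η χ χ₁ θ) :
    ∃ C, 0 ≤ C ∧ ∀ δ ∈ Icc 0 η, ∀ L K, C ≤ L → C ≤ K →
      GraphClass (baseDom η) (-3 / 2) (-1 / 2) L K fun q => startX a (δ, overBase (-1) q) := by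
  obtain ⟨C, hC0, hC⟩ := exists_log_taylor_bound (d := η) (a := -7 / 4) (b := -1 / 4)
    (R := η) (κ := 1 / 8) (T := Real.log η) (Φ := startX a)
    fun z hz => (contDiffAt_startX (cut_mem hc hz).2.1).of_le (by norm_cast)
  have h1 : (-1 : ℝ) ∈ Icc (-7 / 4 : ℝ) (-1 / 4) := by norm_num
  refine ⟨C, hC0, fun δ hδ L K hL hK => ⟨fun q hq => ?_, fun q hq q' hq' => ?_, fun q hq => ?_⟩⟩
  · exact startX_mem_of_stepDom hη hc (overBase_mem_stepBox hδ h1 hq)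
  · obtain ⟨-, -, l, hl, h2⟩ := hC δ hδ (-1) h1 q hq
    have := (h2 (-1) h1 q' hq').1
    rw [sub_self, abs_zero, zero_add] at this
    exact this.trans (by gcongr)
  · obtain ⟨-, -, l, hl, h2⟩ := hC δ hδ (-1) h1 q hq
    refine ⟨l, hl.trans hL, fun q' hq' => ?_⟩
    have := (h2 (-1) h1 q' hq').2
    rw [sub_self, abs_zero, zero_add, zero_smul, sub_zero] at this
    exact this.trans (by gcongr)

end

/-! ### The invariant graph of the modified step -/

section

variable {a : Coeffs} {χ χ₁ θ : ℝ → ℝ} {η : ℝ}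

theorem fderiv_step_mul {Φ : ℝ × ℝ × ℝ × ℝ × ℝ × ℝ → ℝ} {δ : ℝ} {w : ℝ × ℝ × ℝ × ℝ × ℝ}
    (h : DifferentiableAt ℝ Φ (δ, w)) :
    fderiv ℝ (fun w => w.2.2.2.2 * Φ (δ, w)) w (1, 0, 0, 0, 0) =
      w.2.2.2.2 * fderiv ℝ Φ (δ, w) (0, 1, 0, 0, 0, 0) := by
  have h1 : DifferentiableAt ℝ (fun w => Φ (δ, w)) w :=
    h.comp (f := fun w : ℝ × ℝ × ℝ × ℝ × ℝ => (δ, w)) w (by fun_prop)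
  refine fderiv_eq_of_hasDerivAt (by fun_prop) ?_
  have h2 : HasDerivAt (fun t : ℝ => (δ, w) + t • ((0, 1, 0, 0, 0, 0) :
      ℝ × ℝ × ℝ × ℝ × ℝ × ℝ)) (0, 1, 0, 0, 0, 0) 0 := by
    simpa using ((hasDerivAt_id (0 : ℝ)).smul_const
      ((0, 1, 0, 0, 0, 0) : ℝ × ℝ × ℝ × ℝ × ℝ × ℝ)).const_add (δ, w)
  have h3 : HasFDerivAt Φ (fderiv ℝ Φ (δ, w)) ((δ, w) + (0 : ℝ) • ((0, 1, 0, 0, 0, 0) :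
      ℝ × ℝ × ℝ × ℝ × ℝ × ℝ)) := by simpa using h.hasFDerivAt
  refine ((h3.comp_hasDerivAt 0 h2).const_mul w.2.2.2.2).congr_of_eventuallyEq
    (Filter.Eventually.of_forall fun t => ?_)
  simp

/-- For small `h` the cut-off step is a scheme of second order for the cut-off field. -/
theorem exists_step_scheme (hη : IsRegularRadius a η) (hc : IsCutoff η χ χ₁ θ) (δ : ℝ) :
    ∃ RP RS : ℝ × ℝ × ℝ × ℝ × ℝ → ℝ, ∀ w, (δ, w) ∈ stepDom η →
      ContDiffAt ℝ 1 RP w ∧ ContDiffAt ℝ 1 RS w ∧ (w.2.2.2.2 < η / 6 →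
        (fun w => w.2.2.2.2 * fibreStep a χ χ₁ θ (δ, w)) =ᶠ[𝓝 w]
          schemeFun (fibreField a χ δ) (scaleField a χ δ) (fibreField a χ δ) RP ∧
        (fun w => scaleLog a χ χ₁ (δ, w)) =ᶠ[𝓝 w]
          schemeFun (fibreField a χ δ) (scaleField a χ δ) (scaleField a χ δ) RS) := by
  obtain ⟨RP, hP, hP'⟩ := exists_fibre_scheme a δ hc.smooth
  obtain ⟨RS, hS, hS'⟩ := exists_scale_scheme a δ hc.smooth
  have ho : IsOpen (cutPoint χ δ ⁻¹' backDomain a) :=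
    (isOpen_backDomain a).preimage (contDiff_cutPoint δ hc.smooth).continuous
  refine ⟨RP, RS, fun w hw => ?_⟩
  have hn : cutPoint χ δ ⁻¹' backDomain a ∈ 𝓝 w := ho.mem_nhds (regular_cut hη hc hw).1
  refine ⟨(hP.contDiffAt hn).of_le (by norm_cast), (hS.contDiffAt hn).of_le (by norm_cast),
    fun hh => ?_⟩
  have hn2 : ∀ᶠ w' : ℝ × ℝ × ℝ × ℝ × ℝ in 𝓝 w, w'.2.2.2.2 < η / 6 :=
    (Continuous.tendsto (by fun_prop) w).eventually (gt_mem_nhds hh)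
  have hpos := hη.pos
  constructor
  · filter_upwards [hn, hn2] with w' h1 h2
    rw [← hP' w' h1, fibreStep, fibreError, hc.zeroθ w'.2.2.2.2 h2.le]
    ring
  · filter_upwards [hn, hn2] with w' h1 h2
    rw [← hS' w' h1, scaleLog, scaleStep, hc.one₁ w'.2.2.2.2 (by linarith)]
    ring

theorem logBox_subset {R R' κ T : ℝ} (h : R' ≤ R) : logBox R' κ T ⊆ logBox R κ T :=
  prod_mono (Icc_subset_Icc_right h) subset_rfl

/-- An invariant graph of the cut-off step, which contains the curves of fixed points and the
special curve and is of class `C¹` up to `h = 0`. -/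
theorem exists_cut_graph (hη : IsRegularRadius a η) (hc : IsCutoff η χ χ₁ θ) :
    ∃ δ, 0 < δ ∧ δ ≤ η ∧ ∃ g : ℝ × ℝ × ℝ × ℝ → ℝ,
      (∀ q ∈ baseDom η, g q ∈ Icc (-3 / 2 : ℝ) (-1 / 2)) ∧
      (∀ q ∈ baseDom η, (q.1 = 0 ∧ q.2.2.1 = 0) ∨ q.2.1 = 0 →
        g q = startX a (δ, overBase (-1) q)) ∧
      (∀ q ∈ baseDom η, g (q + backB a χ χ₁ δ (g q) q) = g q + backA a χ χ₁ θ δ (g q) q) ∧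
      (∀ q ∈ baseDom η, ∀ x ∈ Icc (-7 / 4 : ℝ) (-1 / 4),
        g (q + backB a χ χ₁ δ x q) = x + backA a χ χ₁ θ δ x q → x = g q) ∧
      ∃ f : ℝ × ℝ × ℝ × ℝ → ℝ,
        ContDiffOn ℝ 1 f
          (Icc 0 (η / 2) ×ˢ Icc 0 1 ×ˢ Icc (-(1 / 8)) (1 / 8) ×ˢ Icc 0 (η / 6)) ∧
        ∀ r ∈ Icc 0 (η / 2), ∀ e ∈ Icc (0 : ℝ) 1, ∀ m ∈ Icc (-(1 / 8) : ℝ) (1 / 8),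
          ∀ h ∈ Ioc 0 (η / 6), f (r, e, m, h) = g (r, e, m, Real.log h) := by
  obtain ⟨C, hC1, hC⟩ := exists_isGraphSystem (θ := θ) hη hc
  obtain ⟨Cu, hCu0, hCu⟩ := graphClass_startX hη hc
  have hη0 := hη.pos
  have hη4 := hη.le
  -- With `c = 1/8` the condition `2 C ≤ c L` asks for `L ≥ 16 C`; likewise for `K` below. The
  -- summand `Cu` admits the initial graph.
  set L := 16 * C + Cu + 1 with hLdef
  have hL : 0 ≤ L := by positivity
  set K := 1 + L + 16 * (C * (L + 1) ^ 3) + Cu with hKdef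
  have hK : 0 ≤ K := by positivity
  -- `δ` is chosen after `L`: all remaining smallness conditions bound `C δ (L + 1)`, the strictest
  -- being `2 C δ (4 L + 3) ≤ 1/8`.
  obtain ⟨δ, hδ0, hδη, hδ⟩ : ∃ δ, 0 < δ ∧ δ ≤ η ∧ C * δ * (L + 1) ≤ 1 / 200 := by
    have hp : 0 < 200 * (C * (L + 1)) := by positivity
    refine ⟨min η (1 / (200 * (C * (L + 1)))), by positivity, min_le_left _ _, ?_⟩
    calc _ ≤ C * (1 / (200 * (C * (L + 1)))) * (L + 1) := by gcongr; exact min_le_right _ _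
      _ = 1 / 200 := by field_simp
  have hCδ0 : 0 ≤ C * δ := by positivity
  have hCδL : 0 ≤ C * δ * L := by positivity
  have hCδ : C * δ ≤ 1 / 200 := by linarith
  obtain ⟨hS, hb⟩ := hC δ hδ0 hδη (by linarith)
  have hJ : ∀ x ∈ Icc (-3 / 2 : ℝ) (-1 / 2), x ∈ Icc (-7 / 4 : ℝ) (-1 / 4) := hS.sub
  have hδI : δ ∈ Icc 0 η := ⟨hδ0.le, hδη⟩
  set Z : Set (ℝ × ℝ × ℝ × ℝ) := {q | q ∈ baseDom η ∧ ((q.1 = 0 ∧ q.2.2.1 = 0) ∨ q.2.1 = 0)}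
  have hpow : 0 ≤ C * (L + 1) ^ 3 := by positivity
  have hstart := hCu δ hδI L K (by linarith) (by linarith)
  obtain ⟨g, hg, hgZ, hinv⟩ := hS.exists_invariant (L := L) (K := K) (by norm_num)
    (by linarith) hCδ0 hL hK (by norm_num; linarith) (by linarith) (by linarith) (by linarith)
    (by linarith) (by norm_num; linarith) (by linarith) hstart Z (fun q hq => hq.1) (by
      rintro q ⟨hq, hqZ⟩
      refine ⟨⟨hS.maps _ (hJ _ (hstart.range q hq)) q hq, ?_⟩,
        startX_invariant hη hc hδI hq hqZ⟩
      rw [add_backB]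
      rcases hqZ with ⟨h1, h2⟩ | h1
      · left; simp [scaled, h1, h2]
      · right; simp [scaled, h1])
  have hgJ : ∀ q ∈ baseDom η, g q ∈ Icc (-7 / 4 : ℝ) (-1 / 4) := fun q hq => hJ _ (hg.range q hq)
  have hdom : ∀ q ∈ baseDom η, (δ, overBase (g q) q) ∈ stepDom η := fun q hq =>
    overBase_mem_stepBox hδI (hgJ q hq) hq
  refine ⟨δ, hδ0, hδη, g, hg.range, fun q hq hZ => hgZ q ⟨hq, hZ⟩, hinv,
    fun q hq x hx h => hS.eq_of_back hCδ0 (by norm_num) hL (by linarith) hg hinv hq hx h, ?_⟩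
  choose! l hl hlj using hg.jets
  obtain ⟨RP, RS, hR⟩ := exists_step_scheme hη hc δ
  have hmem : ∀ w ∈ Icc (-3 / 2 : ℝ) (-1 / 2) ×ˢ Icc 0 η ×ˢ Icc (0 : ℝ) 1 ×ˢ
      Icc (-(1 / 8) : ℝ) (1 / 8) ×ˢ Icc 0 (η / 6), (δ, w) ∈ stepDom η := by
    rintro ⟨x, r, e, m, h⟩ ⟨h1, h2, h3, h4, h5⟩
    refine ⟨hδI, hJ x h1, h2, h3, h4, h5.1, ?_⟩
    rw [Real.exp_log hη0]
    have := h5.2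
    linarith
  have hsc : ∀ q ∈ baseDom η, scaled (scaleLog a χ χ₁ (δ, overBase (g q) q)) q ∈ baseDom η := by
    intro q hq
    rw [← add_backB]
    exact hS.maps _ (hgJ q hq) q hq
  obtain ⟨B, hB0, hB⟩ := exists_step_deriv_bound (R := η) (κ := 1 / 8) (T := Real.log η)
    (ν := η / 6) (g := g) (l := l) (lo := -3 / 2) (hi := -1 / 2) (L := L) (K := K) (c := 1 / 8)
    (η := C * δ) (P := fun w => w.2.2.2.2 * fibreStep a χ χ₁ θ (δ, w))
    (S := fun w => scaleLog a χ χ₁ (δ, w)) (RP := RP) (RS := RS)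
    (by linarith) (by norm_num) (by linarith) (by linarith)
    (Real.log_le_log (by linarith) (by linarith)) (contDiff_fibreField a δ hc.smooth)
    (contDiff_scaleField a δ hc.smooth)
    (isCompact_Icc.prod (isCompact_Icc.prod (isCompact_Icc.prod (isCompact_Icc.prod
      isCompact_Icc))))
    (fun w hw => ⟨hw.2.2.2.2.1, hw.2.2.2.2.2.trans (by linarith)⟩)
    (fun w hw => (hR w (hmem w hw)).1) (fun w hw => (hR w (hmem w hw)).2.1) hg.range
    (fun q hq hh => ⟨hg.range q hq, hq.1, hq.2.1, hq.2.2.1, (Real.exp_pos _).le, hh.le⟩)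
    (fun q hq hh => ((hR _ (hdom q hq)).2.2 hh).1)
    (fun q hq hh => ((hR _ (hdom q hq)).2.2 hh).2) hsc
    (fun q hq hr => (hb _ (hgJ q hq) q hq).2.2.2.2 hr)
    (fun q hq => (hb _ (hgJ q hq) q hq).1)
    (fun q hq => by rw [← add_backB]; exact hinv q hq) hL hl hlj (by norm_num) (by norm_num)
    (by linarith)
    (fun q hq _ => by
      rw [fderiv_step_mul ((smooth_fibreStep hη hc (hdom q hq)).differentiableAt (by simp)),
        mul_comm]
      exact mul_le_mul_of_nonneg_left (hb _ (hgJ q hq) q hq).2.2.2.1 (Real.exp_pos _).le)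
    (fun q hq _ => by
      have h1 := (smooth_scaleStep hη hc (hdom q hq)).differentiableAt (by simp)
      have h2 : DifferentiableAt ℝ (fun z => z.1 * scaleStep a χ χ₁ z) (δ, overBase (g q) q) := by
        fun_prop
      have h3 : fderiv ℝ (fun z => z.1 * scaleStep a χ χ₁ z) (δ, overBase (g q) q)
          (0, 1, 0, 0, 0, 0) =
          δ * fderiv ℝ (scaleStep a χ χ₁) (δ, overBase (g q) q) (0, 1, 0, 0, 0, 0) := by
        rw [fderiv_fun_mul (by fun_prop) h1]
        simp [fderiv_fst]
      have h4 := (hb _ (hgJ q hq) q hq).2.2.1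
      have h5 := Real.exp_pos q.2.2.2
      change |fderiv ℝ (fun w : ℝ × ℝ × ℝ × ℝ × ℝ => w.2.2.2.2 *
        (fun z => z.1 * scaleStep a χ χ₁ z) (δ, w)) _ _| ≤ _
      rw [fderiv_step_mul h2, h3, abs_mul, abs_mul, abs_of_pos hδ0]
      change |Real.exp q.2.2.2| * _ ≤ _
      rw [abs_of_pos h5]
      calc _ ≤ Real.exp q.2.2.2 * (δ * C) := by gcongr
        _ = _ := by ring)
    (fun q hq _ => by
      obtain ⟨h1, h2, -⟩ := hb _ (hgJ q hq) q hq
      have h5 := Real.exp_pos q.2.2.2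
      have h6 : Real.exp q.2.2.2 ≤ 1 := (exp_le_of_baseDom hη0 hq).trans (by linarith)
      set s := scaleLog a χ χ₁ (δ, overBase (g q) q)
      have h7 : s ≤ 1 / 200 * Real.exp q.2.2.2 := h2.trans (by gcongr)
      change Real.exp s ^ 3 ≤ _
      rw [← Real.exp_nat_mul]
      have h8 := Real.abs_exp_sub_one_sub_id_le (x := ((3 : ℕ) : ℝ) * s) (by
        rw [abs_of_nonneg (by positivity)]; push_cast; linarith)
      have h9 := (abs_le.1 h8).2
      push_cast at h9 ⊢
      nlinarith)
  -- The derivative bound was obtained for `r < η` only; on `r ≤ η/2` it holds up to the boundary.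
  have hsub : logBox (η / 2) (1 / 8) (Real.log η) ⊆ baseDom η := logBox_subset (by linarith)
  obtain ⟨f, hf, hfg⟩ := exists_contDiffOn_extension (R := η / 2) (κ := 1 / 8)
    (T := Real.log η) (ν := η / 6) (g := g) (l := l) (L := L) (K := K) (C := B) (by linarith)
    (by norm_num) (by linarith) (Real.log_lt_log (by linarith) (by linarith)) hB0 hK hL
    (fun q hq q' hq' => hg.lip q (hsub hq) q' (hsub hq'))
    (fun q hq q' hq' => hlj q (hsub hq) q' (hsub hq'))
    (fun q hq _ => hB q (hsub hq) (hq.1.2.trans_lt (by linarith)))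
  exact ⟨f, hf, hfg⟩

end

/-! ### The attracting center manifold of the Kahan map -/

/-- `g` is an attracting center manifold which is invariant under the forward and the backward
step and contains the curves of fixed points and the special curve. -/
structure IsAttractingGraph (a : Coeffs) (ρ δ κ ν : ℝ) (g : ℝ × ℝ × ℝ × ℝ → ℝ) : Prop where
  contDiffOn : ContDiffOn ℝ 1 g (box ρ δ κ ν)
  forward_regular : ∀ p ∈ box ρ δ κ ν, 0 < detK1 a (g p, p) ∧ 0 < G a (g p, p)
  back_regular : ∀ p ∈ box ρ δ κ ν, (g p, p) ∈ backDomain a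
  forward : ∀ p ∈ box ρ δ κ ν, mapK1 a (g p, p) ∈ D1 ρ δ κ ν →
    (mapK1 a (g p, p)).1 = g (mapK1 a (g p, p)).2
  back : ∀ p ∈ box ρ δ κ ν, backK1 a (g p, p) ∈ D1 ρ δ κ ν →
    (backK1 a (g p, p)).1 = g (backK1 a (g p, p)).2
  fixed : ∀ r h, (r, 0, 0, h) ∈ box ρ δ κ ν → g (r, 0, 0, h) = fixX a (-1) r
  special : ∀ ε h, 0 < h → (0, ε, 0, h) ∈ box ρ δ κ ν →
    g (0, ε, 0, h) = -√(1 + ε / 2 + ε ^ 2 * h ^ 2 / 8)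

theorem box_mono {ρ δ κ ν ρ' δ' κ' ν' : ℝ} (hρ : ρ' ≤ ρ) (hδ : δ' ≤ δ) (hκ : κ' ≤ κ)
    (hν : ν' ≤ ν) : box ρ' δ' κ' ν' ⊆ box ρ δ κ ν :=
  prod_mono (Icc_subset_Icc_right hρ) (prod_mono (Icc_subset_Icc_right hδ)
    (prod_mono (Icc_subset_Icc (neg_le_neg hκ) hκ) (Icc_subset_Icc_right hν)))

theorem IsAttractingGraph.mono {a : Coeffs} {ρ δ κ ν ρ' δ' κ' ν' : ℝ}
    {g : ℝ × ℝ × ℝ × ℝ → ℝ} (h : IsAttractingGraph a ρ δ κ ν g) (hρ : ρ' ≤ ρ) (hδ : δ' ≤ δ)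
    (hκ : κ' ≤ κ) (hν : ν' ≤ ν) : IsAttractingGraph a ρ' δ' κ' ν' g := by
  have hs : box ρ' δ' κ' ν' ⊆ box ρ δ κ ν := box_mono hρ hδ hκ hν
  exact ⟨h.contDiffOn.mono hs, fun p hp => h.forward_regular p (hs hp),
    fun p hp => h.back_regular p (hs hp), fun p hp hm => h.forward p (hs hp) (hs hm),
    fun p hp hm => h.back p (hs hp) (hs hm), fun r k hk => h.fixed r k (hs hk),
    fun ε k hk0 hk => h.special ε k hk0 (hs hk)⟩

theorem detK1_of_step_zero (a : Coeffs) {z : K1} (hz : z.2.2.2.2 = 0) : detK1 a z = 1 := by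
  simp [detK1, kahanDet, hz]

theorem G_of_step_zero (a : Coeffs) {z : K1} (hz : z.2.2.2.2 = 0) : G a z = 1 := by
  simp [G, kahanY, hz]

theorem mapK1_of_step_zero (a : Coeffs) {z : K1} (hz : z.2.2.2.2 = 0) : mapK1 a z = z := by
  simp [mapK1, G_of_step_zero a hz, kahanX, hz, Prod.ext_iff]

theorem mem_backDomain_of_step_zero (a : Coeffs) {z : K1} (hz : z.2.2.2.2 = 0) :
    z ∈ backDomain a := by
  simp [backDomain, backDet, backQuot, kahanDet, hz]

theorem backK1_of_step_zero (a : Coeffs) {z : K1} (hz : z.2.2.2.2 = 0) : backK1 a z = z := by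
  obtain ⟨x, r, ε, m, h⟩ := z
  rw [backK1_eq a (mem_backDomain_of_step_zero a hz)]
  simp only at hz
  simp [hz]

section

variable {a : Coeffs} {χ χ₁ θ : ℝ → ℝ} {η : ℝ}

theorem IsCutoff.deriv_eq_zero (hc : IsCutoff η χ χ₁ θ) {r : ℝ} (hr : r < η / 4) :
    deriv χ r = 0 := by
  have h : χ =ᶠ[𝓝 r] fun _ => 1 := by
    filter_upwards [gt_mem_nhds hr] with t ht using hc.one t ht.le
  rw [h.deriv_eq, deriv_const]

/-- Coordinates `(r, e, m, log h)` of `(r, ε, m, h)`. -/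
noncomputable def logCoord (δ : ℝ) (p : ℝ × ℝ × ℝ × ℝ) : ℝ × ℝ × ℝ × ℝ :=
  (p.1, p.2.1 / δ, p.2.2.1, Real.log p.2.2.2)

theorem logCoord_mem (hη : 0 < η) {δ : ℝ} (hδ : 0 < δ) {p : ℝ × ℝ × ℝ × ℝ}
    (hp : p ∈ box (η / 8) δ (1 / 8) (η / 6)) (hh : 0 < p.2.2.2) : logCoord δ p ∈ baseDom η := by
  obtain ⟨h1, h2, h3, h4⟩ := hp
  refine ⟨⟨h1.1, h1.2.trans (by linarith)⟩, ⟨div_nonneg h2.1 hδ.le, ?_⟩, h3,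
    Real.log_le_log hh (h4.2.trans (by linarith))⟩
  exact (div_le_one hδ).2 h2.2

/-- In the box the cut-off step is the backward step. -/
theorem backK1_eq_step (hη : IsRegularRadius a η) (hc : IsCutoff η χ χ₁ θ) {δ : ℝ} (hδ : 0 < δ)
    (hδη : δ ≤ η) {x : ℝ} (hx : x ∈ Icc (-7 / 4 : ℝ) (-1 / 4)) {p : ℝ × ℝ × ℝ × ℝ}
    (hp : p ∈ box (η / 8) δ (1 / 8) (η / 6)) (hh : 0 < p.2.2.2) :
    (backK1 a (x, p)).1 = x + backA a χ χ₁ θ δ x (logCoord δ p) ∧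
      logCoord δ (backK1 a (x, p)).2 = logCoord δ p + backB a χ χ₁ δ x (logCoord δ p) ∧
      0 < (backK1 a (x, p)).2.2.2.2 := by
  have hη0 := hη.pos
  have hq := logCoord_mem hη0 hδ hp hh
  have hov : overBase x (logCoord δ p) = (x, p.1, p.2.1 / δ, p.2.2.1, p.2.2.2) := by
    simp [overBase, logCoord, Real.exp_log hh]
  obtain ⟨r, ε, m, h⟩ := p
  obtain ⟨h1, h2, h3, h4⟩ := hp
  simp only at hh h1 h2 h3 h4 hov
  -- In the box `r ≤ η/8` and `h ≤ η/6`, so both cut-offs are `1` and all corrections vanish.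
  have hχ : χ r = 1 := hc.one r (by linarith [h1.2])
  have hχd : deriv χ r = 0 := hc.deriv_eq_zero (by linarith [h1.2])
  have hχ₁ : χ₁ h = 1 := hc.one₁ h (by linarith [h4.2])
  have hθ : θ h = 0 := hc.zeroθ h h4.2
  have hcut : cutPoint χ δ (x, r, ε / δ, m, h) = (x, r, ε, m, h) := by
    simp only [cutPoint, hχ, one_mul, mul_div_cancel₀ ε hδ.ne']
  have hdom : (x, r, ε, m, h) ∈ backDomain a := by
    have := (regular_cut hη hc (overBase_mem_stepBox ⟨hδ.le, hδη⟩ hx hq)).1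
    simp only [hov] at this
    rwa [hcut] at this
  have hA : backA a χ χ₁ θ δ x (logCoord δ (r, ε, m, h)) = h * fibreRate a (x, r, ε, m, h) := by
    rw [backA, hov, fibreStep, fibreError, hcut]
    simp only [fibreCorr, hχd, hθ, logCoord, Real.exp_log hh]
    ring
  have hS : scaleLog a χ χ₁ (δ, overBase x (logCoord δ (r, ε, m, h))) =
      h * (ε * scaleRate a (x, r, ε, m, h)) := by
    rw [hov, scaleLog, scaleStep, hcut]
    simp only [scaleCorr, hχd, hχ, hχ₁]
    field_simp
    ring
  rw [add_backB, hS, hA, backK1_eq a hdom]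
  refine ⟨rfl, ?_, by positivity⟩
  simp only [logCoord, scaled, Prod.mk.injEq, true_and]
  refine ⟨by ring, ?_⟩
  rw [Real.log_mul (Real.exp_pos _).ne' hh.ne', Real.log_exp, add_comm]

end

/-- Existence of the attracting center manifold. -/
theorem exists_isAttractingGraph (a : Coeffs) : ∃ ρ δ κ ν, 0 < ρ ∧ 0 < δ ∧ 0 < κ ∧ 0 < ν ∧ ν < 1 ∧
    ∃ g, IsAttractingGraph a ρ δ κ ν g := by
  obtain ⟨η, hη⟩ := exists_isRegularRadius a
  have hη0 := hη.pos
  have hη4 := hη.le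
  obtain ⟨χ, χ₁, θ, hc⟩ := exists_isCutoff hη0
  obtain ⟨δ, hδ, hδη, g, hran, hstart, hinv, hback, f, hf, hfg⟩ := exists_cut_graph hη hc
  -- The manifold is taken from the extension `f`, which is defined at `h = 0` too; `e = ε/δ` undoes
  -- the normalisation of `ε`.
  set F : ℝ × ℝ × ℝ × ℝ → ℝ := fun p => f (p.1, p.2.1 / δ, p.2.2.1, p.2.2.2) with hF
  have hmaps : ∀ p ∈ box (η / 8) δ (1 / 8) (η / 6), (p.1, p.2.1 / δ, p.2.2.1, p.2.2.2) ∈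
      Icc 0 (η / 2) ×ˢ Icc (0 : ℝ) 1 ×ˢ Icc (-(1 / 8) : ℝ) (1 / 8) ×ˢ Icc 0 (η / 6) := by
    rintro p ⟨h1, h2, h3, h4⟩
    exact ⟨⟨h1.1, h1.2.trans (by linarith)⟩,
      ⟨div_nonneg h2.1 hδ.le, (div_le_one hδ).2 h2.2⟩, h3, h4⟩
  have hFc : ContDiffOn ℝ 1 F (box (η / 8) δ (1 / 8) (η / 6)) :=
    hf.comp (f := fun p : ℝ × ℝ × ℝ × ℝ => (p.1, p.2.1 / δ, p.2.2.1, p.2.2.2))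
      (by fun_prop) hmaps
  have hFg : ∀ p ∈ box (η / 8) δ (1 / 8) (η / 6), 0 < p.2.2.2 → F p = g (logCoord δ p) := by
    intro p hp hh
    obtain ⟨h1, h2, h3, h4⟩ := hmaps p hp
    exact hfg _ h1 _ h2 _ h3 _ ⟨hh, h4.2⟩
  have hFr : ∀ p ∈ box (η / 8) δ (1 / 8) (η / 6), 0 < p.2.2.2 →
      F p ∈ Icc (-3 / 2 : ℝ) (-1 / 2) := fun p hp hh => by
    rw [hFg p hp hh]; exact hran _ (logCoord_mem hη0 hδ hp hh)
  have hJ : Icc (-3 / 2 : ℝ) (-1 / 2) ⊆ Icc (-7 / 4 : ℝ) (-1 / 4) :=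
    Icc_subset_Icc (by norm_num) (by norm_num)
  have hreg : ∀ x ∈ Icc (-7 / 4 : ℝ) (-1 / 4), ∀ p ∈ box (η / 8) δ (1 / 8) (η / 6),
      (x, p) ∈ backDomain a ∧ 0 < detK1 a (x, p) ∧ 0 < G a (x, p) ∧
        |(mapK1 a (x, p)).1 - x| < 1 / 4 := by
    rintro x hx ⟨r, ε, m, h⟩ ⟨h1, h2, h3, h4⟩
    obtain ⟨i1, -, -, -, -, -, i2, i3, i4⟩ := hη.regular x hx r ⟨h1.1, h1.2.trans (by linarith)⟩ ε
      ⟨h2.1, h2.2.trans hδη⟩ m ⟨by linarith [h3.1], h3.2⟩ h ⟨h4.1, h4.2.trans (by linarith)⟩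
    exact ⟨i1, i2, i3, i4⟩
  -- At `h = 0` both steps are the identity and invariance is trivial; for `h > 0` logarithmic
  -- coordinates are available.
  have hh0 : ∀ p ∈ box (η / 8) δ (1 / 8) (η / 6), p.2.2.2 = 0 ∨ 0 < p.2.2.2 := fun p hp =>
    hp.2.2.2.1.eq_or_lt.imp Eq.symm id
  have hspec : ∀ p ∈ box (η / 8) δ (1 / 8) (η / 6), 0 < p.2.2.2 →
      (p.1 = 0 ∧ p.2.2.1 = 0) ∨ p.2.1 = 0 →
      F p = startX a (δ, -1, p.1, p.2.1 / δ, p.2.2.1, p.2.2.2) := by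
    intro p hp hh hZ
    rw [hFg p hp hh, hstart _ (logCoord_mem hη0 hδ hp hh)
      (hZ.imp id fun h => by simp [logCoord, h])]
    simp [overBase, logCoord, Real.exp_log hh]
  refine ⟨η / 8, δ, 1 / 8, η / 6, by positivity, hδ, by norm_num, by positivity, by linarith, F,
    hFc, fun p hp => ?_, fun p hp => ?_, fun p hp hm => ?_, fun p hp hm => ?_, fun r h hp => ?_,
    fun ε h hh hp => ?_⟩
  · rcases hh0 p hp with h | h
    · rw [detK1_of_step_zero a h, G_of_step_zero a h]; norm_num
    · have := hreg _ (hJ (hFr p hp h)) p hp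
      exact ⟨this.2.1, this.2.2.1⟩
  · rcases hh0 p hp with h | h
    · exact mem_backDomain_of_step_zero a h
    · exact (hreg _ (hJ (hFr p hp h)) p hp).1
  · rcases hh0 p hp with h | h
    · rw [mapK1_of_step_zero a h]
    · have hx := hFr p hp h
      obtain ⟨-, i1, i2, i3⟩ := hreg _ (hJ hx) p hp
      set z := mapK1 a (F p, p) with hz
      -- The forward image may leave `[-3/2, -1/2]`, but not the larger fibre interval. Its backward
      -- image lies on the graph, so `hback` puts the image itself on the graph.
      have hx' : z.1 ∈ Icc (-7 / 4 : ℝ) (-1 / 4) := by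
        rw [abs_lt] at i3
        constructor <;> linarith [hx.1, hx.2, i3.1, i3.2]
      have hh' : 0 < z.2.2.2.2 := mul_pos h (Real.sqrt_pos.2 i2)
      have hb : backK1 a z = (F p, p) := backK1_mapK1 a i1.ne' i2 (hreg _ hx' _ hm).1.1.ne'
      obtain ⟨j1, j2, -⟩ := backK1_eq_step hη hc hδ hδη hx' hm hh'
      change (backK1 a z).1 = _ at j1
      change logCoord δ (backK1 a z).2 = _ at j2
      rw [hb] at j1 j2
      rw [hFg _ hm hh']
      refine hback _ (logCoord_mem hη0 hδ hm hh') _ hx' ?_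
      rw [← j2, ← j1, hFg p hp h]
  · rcases hh0 p hp with h | h
    · rw [backK1_of_step_zero a h]
    · have hx := hFr p hp h
      obtain ⟨j1, j2, j3⟩ := backK1_eq_step hη hc hδ hδη (hJ hx) hp h
      rw [hFg _ hm j3, j1, j2, hFg p hp h, hinv _ (logCoord_mem hη0 hδ hp h)]
  · have hbox : ∀ k ∈ Icc 0 (η / 6), (r, 0, 0, k) ∈ box (η / 8) δ (1 / 8) (η / 6) := fun k hk =>
      ⟨hp.1, hp.2.1, hp.2.2.1, hk⟩
    -- The values on the curves of fixed points are prescribed for `h > 0` and extend to `h = 0` by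
    -- continuity.
    have h1 : EqOn (fun k => F (r, 0, 0, k)) (fun _ => fixX a (-1) r) (Ioc 0 (η / 6)) := by
      intro k hk
      beta_reduce
      rw [hspec _ (hbox k ⟨hk.1.le, hk.2⟩) hk.1 (Or.inr rfl)]
      simp only [startX, fixX, zero_div, mul_zero]
      ring_nf
    have h2 : ContinuousOn (fun k => F (r, 0, 0, k)) (Icc 0 (η / 6)) :=
      hFc.continuousOn.comp (f := fun k : ℝ => (r, (0 : ℝ), (0 : ℝ), k)) (by fun_prop) hbox
    refine h1.of_subset_closure h2 continuousOn_const Ioc_subset_Icc_self ?_ hp.2.2.2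
    rw [closure_Ioc (by linarith)]
  · rw [hspec _ hp hh (Or.inl ⟨rfl, rfl⟩), startX_of_zero rfl]
    simp only [mul_div_cancel₀ ε hδ.ne']

/-! ### The special orbit in the chart `K₁` -/

theorem gam_snd (h : ℝ) (n : ℤ) : (gam h n).1 ^ 2 = (gam h n).2 + 1 / 2 + h ^ 2 / 8 := by
  simp only [gam]; ring

/-- The parabola `x² = y + 1/2 + h²/8` divided by `y`, with `ε₁ = 1/y` and `ε₁² h₁² = h²/y`. -/
theorem abs_gam1_fst {h : ℝ} {n : ℤ} (hy : 0 < (gam h n).2) :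
    √(1 + (gam1 h n).2.2.1 / 2 + (gam1 h n).2.2.1 ^ 2 * (gam1 h n).2.2.2.2 ^ 2 / 8) =
      |(gam1 h n).1| := by
  have h1 := Real.sqrt_pos.2 hy
  have h2 := Real.sq_sqrt hy.le
  have h3 := gam_snd h n
  rw [← Real.sqrt_sq_eq_abs]
  congr 1
  simp only [gam1, kappa21]
  rw [div_pow, div_pow, mul_pow, h2, h3]
  field_simp

theorem gam1_eq (h : ℝ) (n : ℤ) : gam1 h n = ((gam1 h n).1, (0, (gam1 h n).2.2.1, 0,
    (gam1 h n).2.2.2.2)) := by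
  simp [gam1, kappa21]

theorem gam1_step_pos {h : ℝ} (hh : 0 < h) {n : ℤ} (hy : 0 < (gam h n).2) :
    0 < (gam1 h n).2.2.2.2 := mul_pos hh (Real.sqrt_pos.2 hy)

theorem gam1_fst_neg {h : ℝ} (hh : 0 < h) {n : ℤ} (hy : 0 < (gam h n).2) (hn : n < 0) :
    (gam1 h n).1 < 0 := by
  have hn' : (n : ℝ) < 0 := by exact_mod_cast hn
  refine div_neg_of_neg_of_pos ?_ (Real.sqrt_pos.2 hy)
  simp only [gam]
  nlinarith

theorem gam1_fst_pos {h : ℝ} (hh : 0 < h) {n : ℤ} (hy : 0 < (gam h n).2) (hn : 0 < n) :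
    0 < (gam1 h n).1 := by
  have hn' : (0 : ℝ) < n := by exact_mod_cast hn
  refine div_pos ?_ (Real.sqrt_pos.2 hy)
  simp only [gam]
  positivity

theorem tendsto_sq_mul_floor (c : ℝ) :
    Filter.Tendsto (fun h : ℝ => h ^ 2 * (⌊c / h ^ 2⌋ : ℝ)) (𝓝[>] 0) (𝓝 c) := by
  have h1 : Filter.Tendsto (fun h : ℝ => c - h ^ 2) (𝓝[>] 0) (𝓝 c) := by
    have : Filter.Tendsto (fun h : ℝ => c - h ^ 2) (𝓝 0) (𝓝 (c - 0 ^ 2)) :=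
      Continuous.tendsto (by fun_prop) 0
    simpa using this.mono_left nhdsWithin_le_nhds
  refine tendsto_of_tendsto_of_tendsto_of_le_of_le' h1 tendsto_const_nhds ?_ ?_
  · filter_upwards [self_mem_nhdsWithin] with h hh
    have h2 : 0 < h ^ 2 := pow_pos hh 2
    have h3 := (Int.lt_floor_add_one (c / h ^ 2)).le
    rw [div_le_iff₀ h2] at h3
    linarith
  · filter_upwards [self_mem_nhdsWithin] with h hh
    have h2 : 0 < h ^ 2 := pow_pos hh 2
    have h3 := Int.floor_le (c / h ^ 2)
    rw [le_div_iff₀ h2] at h3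
    linarith

section

variable {σ : ℤ} {k : ℝ}

/-- The index of size `2k/h²` is chosen so that `h₁ = h √y ≈ h² |n| / 2` tends to `k`. -/
theorem tendsto_sq_mul_gam (hσ : σ ^ 2 = 1) :
    Filter.Tendsto (fun h : ℝ => h ^ 2 * (gam h (σ * ⌊2 * k / h ^ 2⌋)).2) (𝓝[>] 0)
      (𝓝 (k ^ 2)) := by
  have hσ' : (σ : ℝ) ^ 2 = 1 := by exact_mod_cast hσ
  have h1 := tendsto_sq_mul_floor (2 * k)
  have h2 : Filter.Tendsto (fun h : ℝ => h) (𝓝[>] 0) (𝓝 0) := nhdsWithin_le_nhds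
  have h3 := (((h1.pow 2).div_const 4).sub ((h2.pow 2).div_const 2)).sub ((h2.pow 4).div_const 8)
  have e : (2 * k) ^ 2 / 4 - 0 ^ 2 / 2 - 0 ^ 4 / 8 = k ^ 2 := by ring
  rw [e] at h3
  refine h3.congr fun h => ?_
  simp only [gam]
  push_cast
  linear_combination (-(h ^ 4 * (⌊2 * k / h ^ 2⌋ : ℝ) ^ 2 / 4)) * hσ'

theorem mul_sqrt_gam {h : ℝ} (hh : 0 < h) (n : ℤ) :
    h * √(gam h n).2 = √(h ^ 2 * (gam h n).2) := by
  rw [Real.sqrt_mul (by positivity), Real.sqrt_sq hh.le]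

/-- Along suitable indices the special orbit converges to a fixed point in the chart `K₁`. -/
theorem tendsto_gam1 (hσ : σ ^ 2 = 1) (hk : 0 < k) :
    Filter.Tendsto (fun h : ℝ => gam1 h (σ * ⌊2 * k / h ^ 2⌋)) (𝓝[>] 0)
      (𝓝 ((σ : ℝ), (0, 0, 0, k))) := by
  have h1 := tendsto_sq_mul_gam (k := k) hσ
  have h2 : Filter.Tendsto (fun h : ℝ => h) (𝓝[>] 0) (𝓝 0) := nhdsWithin_le_nhds
  have h3 : Filter.Tendsto (fun h : ℝ => h * √(gam h (σ * ⌊2 * k / h ^ 2⌋)).2) (𝓝[>] 0)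
      (𝓝 k) := by
    have := h1.sqrt
    rw [Real.sqrt_sq hk.le] at this
    refine this.congr' ?_
    filter_upwards [self_mem_nhdsWithin] with h hh
    exact (mul_sqrt_gam hh _).symm
  have h4 : Filter.Tendsto (fun h : ℝ => 1 / (gam h (σ * ⌊2 * k / h ^ 2⌋)).2) (𝓝[>] 0)
      (𝓝 0) := by
    have := (h2.pow 2).div h1 (by positivity)
    rw [zero_pow two_ne_zero, zero_div] at this
    refine this.congr' ?_
    filter_upwards [self_mem_nhdsWithin] with h hh
    have hh' : h ≠ 0 := ne_of_gt hh
    simp only [Pi.div_apply]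
    rw [div_mul_eq_div_div, div_self (pow_ne_zero 2 hh')]
  have h5 : Filter.Tendsto (fun h : ℝ => (gam h (σ * ⌊2 * k / h ^ 2⌋)).1 /
      √(gam h (σ * ⌊2 * k / h ^ 2⌋)).2) (𝓝[>] 0) (𝓝 (σ : ℝ)) := by
    have := (((tendsto_sq_mul_floor (2 * k)).const_mul (σ : ℝ)).div_const 2).div h3 hk.ne'
    have e : (σ : ℝ) * (2 * k) / 2 / k = σ := by field_simp
    rw [e] at this
    refine this.congr' ?_
    filter_upwards [self_mem_nhdsWithin] with h hh
    have hh' : h ≠ 0 := ne_of_gt hh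
    have e2 : (σ : ℝ) * (h ^ 2 * (⌊2 * k / h ^ 2⌋ : ℝ)) / 2 =
        h * (gam h (σ * ⌊2 * k / h ^ 2⌋)).1 := by
      simp only [gam]; push_cast; ring
    simp only [Pi.div_apply]
    rw [e2, mul_div_mul_left _ _ hh']
  have h6 : ∀ h : ℝ, gam1 h (σ * ⌊2 * k / h ^ 2⌋) = ((gam h (σ * ⌊2 * k / h ^ 2⌋)).1 /
      √(gam h (σ * ⌊2 * k / h ^ 2⌋)).2, (0, 1 / (gam h (σ * ⌊2 * k / h ^ 2⌋)).2, 0,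
      h * √(gam h (σ * ⌊2 * k / h ^ 2⌋)).2)) := fun h => by simp [gam1, kappa21]
  simp only [h6]
  exact h5.prodMk_nhds (tendsto_const_nhds.prodMk_nhds (h4.prodMk_nhds
    (tendsto_const_nhds.prodMk_nhds h3)))

/-- The special orbit enters every neighbourhood of the end points of the curves of fixed
points. -/
theorem exists_gam1_mem (hσ : σ ^ 2 = 1) {ρ δ κ ν : ℝ} (hρ : 0 < ρ) (hδ : 0 < δ) (hκ : 0 < κ)
    (hν : 0 < ν) {h₁ : ℝ} (hh₁ : h₁ ∈ Icc 0 ν) {U : Set K1}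
    (hU : U ∈ 𝓝 (((σ : ℝ), (0, 0, 0, h₁)) : K1)) :
    ∃ h₀ : ℝ, 0 < h₀ ∧ ∀ h : ℝ, 0 < h → h < h₀ → ∃ n : ℤ, 0 < σ * n ∧ 0 < (gam h n).2 ∧
      gam1 h n ∈ D1 ρ δ κ ν ∩ U := by
  obtain ⟨V, hVU, hVo, hV⟩ := mem_nhds_iff.1 hU
  -- For `h₁ = 0` the index formula with `k = 0` would give `n = 0`; a small positive `k` inside the
  -- neighbourhood is used instead.
  obtain ⟨k, hk0, hkν, hkV⟩ : ∃ k, 0 < k ∧ k ≤ ν ∧ ((σ : ℝ), ((0 : ℝ), (0 : ℝ), (0 : ℝ), k)) ∈ V := by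
    rcases hh₁.1.eq_or_lt with h0 | h0
    · subst h0
      have h1 : ∀ᶠ k : ℝ in 𝓝[>] 0, ((σ : ℝ), ((0 : ℝ), (0 : ℝ), (0 : ℝ), k)) ∈ V := by
        have : Continuous fun k : ℝ => ((σ : ℝ), ((0 : ℝ), (0 : ℝ), (0 : ℝ), k)) := by fun_prop
        exact nhdsWithin_le_nhds ((hVo.preimage this).mem_nhds hV)
      obtain ⟨k, hk, hk'⟩ := (h1.and (Ioo_mem_nhdsGT hν)).exists
      exact ⟨k, hk'.1, hk'.2.le, hk⟩
    · exact ⟨h₁, h0, hh₁.2, hV⟩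
  have ht := tendsto_gam1 hσ hk0
  have e1 : ∀ᶠ h : ℝ in 𝓝[>] 0, gam1 h (σ * ⌊2 * k / h ^ 2⌋) ∈ V :=
    ht.eventually (hVo.mem_nhds hkV)
  have e2 : ∀ᶠ h : ℝ in 𝓝[>] 0, (gam1 h (σ * ⌊2 * k / h ^ 2⌋)).2.2.1 < δ :=
    ((Continuous.tendsto (f := fun z : K1 => z.2.2.1) (by fun_prop) _).comp ht).eventually
      (gt_mem_nhds hδ)
  have e3 : ∀ᶠ h : ℝ in 𝓝[>] 0, 0 < h ^ 2 * (gam h (σ * ⌊2 * k / h ^ 2⌋)).2 :=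
    (tendsto_sq_mul_gam hσ).eventually (lt_mem_nhds (by positivity))
  have e4 : ∀ᶠ h : ℝ in 𝓝[>] 0, 0 < h ^ 2 * (⌊2 * k / h ^ 2⌋ : ℝ) :=
    (tendsto_sq_mul_floor (2 * k)).eventually (lt_mem_nhds (by positivity))
  obtain ⟨h₀, hh₀, hsub⟩ := mem_nhdsGT_iff_exists_Ioo_subset.1
    (Filter.inter_mem (Filter.inter_mem e1 e2) (Filter.inter_mem e3 e4))
  refine ⟨h₀, hh₀, fun h hh hlt => ⟨σ * ⌊2 * k / h ^ 2⌋, ?_, ?_, ?_, ?_⟩⟩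
  all_goals obtain ⟨⟨i1, i2⟩, i3, i4⟩ := hsub ⟨hh, hlt⟩
  all_goals simp only [mem_ofPred_eq] at i1 i2 i3 i4
  all_goals have hh2 : 0 < h ^ 2 := by positivity
  · have := (mul_pos_iff_of_pos_left hh2).1 i4
    rw [← mul_assoc, ← pow_two, hσ, one_mul]
    exact_mod_cast this
  · exact (mul_pos_iff_of_pos_left hh2).1 i3
  · have hy : 0 < (gam h (σ * ⌊2 * k / h ^ 2⌋)).2 := (mul_pos_iff_of_pos_left hh2).1 i3
    change (gam1 h (σ * ⌊2 * k / h ^ 2⌋)).2 ∈ box ρ δ κ ν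
    rw [gam1_eq]
    refine ⟨⟨le_rfl, hρ.le⟩, ⟨?_, i2.le⟩, ⟨by linarith, hκ.le⟩, (gam1_step_pos hh hy).le, ?_⟩
    · exact (one_div_pos.2 hy).le
    · refine le_trans ?_ hkν
      change h * √(gam h (σ * ⌊2 * k / h ^ 2⌋)).2 ≤ k
      -- Convergence to `k` is not enough when `k = ν`. Because the index is rounded down and `y <
      -- h²n²/4`, the value `h √y` never exceeds `k`.
      rw [mul_sqrt_gam hh, Real.sqrt_le_left hk0.le]
      have hσ' : (σ : ℝ) ^ 2 = 1 := by exact_mod_cast hσ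
      have h3 := Int.floor_le (2 * k / h ^ 2)
      rw [le_div_iff₀ hh2] at h3
      have h4 : (⌊2 * k / h ^ 2⌋ * h ^ 2 : ℝ) ^ 2 ≤ (2 * k) ^ 2 := by
        have : (0 : ℝ) ≤ ⌊2 * k / h ^ 2⌋ * h ^ 2 := by linarith
        gcongr
      have h5 : h ^ 2 * (gam h (σ * ⌊2 * k / h ^ 2⌋)).2 =
          (⌊2 * k / h ^ 2⌋ * h ^ 2 : ℝ) ^ 2 / 4 - h ^ 2 / 2 - h ^ 4 / 8 := by
        simp only [gam]
        push_cast
        linear_combination (h ^ 4 * (⌊2 * k / h ^ 2⌋ : ℝ) ^ 2 / 4) * hσ'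
      rw [h5]
      have : 0 ≤ h ^ 4 := by positivity
      linarith
  · exact hVU i1

end

/-! ### Multipliers, the repelling manifold by reversal, and the special orbit on both manifolds -/

theorem fixX_neg (a : Coeffs) (r : ℝ) : fixX a 1 r = -fixX a.neg (-1) r := by
  simp only [fixX, Coeffs.neg, neg_mul, neg_sq]
  ring

/-- The multiplier of the map at the fixed points. -/
theorem hasDerivAt_mapK1_fixX (a : Coeffs) {s r h : ℝ} (hs : s ^ 2 = 1)
    (hd : 1 - h / 2 * (s * √((a.a₂ * r) ^ 2 + 4)) ≠ 0) :
    HasDerivAt (fun x => (mapK1 a (x, (r, 0, 0, h))).1)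
      ((1 + h / 2 * (s * √((a.a₂ * r) ^ 2 + 4))) / (1 - h / 2 * (s * √((a.a₂ * r) ^ 2 + 4))))
      (fixX a s r) := by
  have h4 : √((a.a₂ * r) ^ 2 + 4) ^ 2 = (a.a₂ * r) ^ 2 + 4 := Real.sq_sqrt (by positivity)
  have hf : (fun x => (mapK1 a (x, (r, 0, 0, h))).1) = fun x =>
      x + h * (x ^ 2 - a.a₂ * r * x - 1) / (1 - h / 2 * (2 * x - a.a₂ * r)) := by
    funext x
    have hG : G a (x, (r, 0, 0, h)) = 1 := by simp [G, kahanY, jac₂₁, field₂]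
    simp only [mapK1, hG, Real.sqrt_one, div_one, kahanX, kahanDet, jac₁₁, jac₁₂, jac₂₁, jac₂₂,
      field₁, field₂]
    ring_nf
  have hx : 2 * fixX a s r - a.a₂ * r = s * √((a.a₂ * r) ^ 2 + 4) := by simp only [fixX]; ring
  have hx0 : fixX a s r ^ 2 - a.a₂ * r * fixX a s r - 1 = 0 := by
    simp only [fixX]
    linear_combination (s ^ 2 / 4) * h4 + (((a.a₂ * r) ^ 2 + 4) / 4) * hs
  rw [hf]
  rw [← hx] at hd ⊢
  set x := fixX a s r
  have hid := hasDerivAt_id x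
  have hnum : HasDerivAt (fun x => h * (x ^ 2 - a.a₂ * r * x - 1)) (h * (2 * x - a.a₂ * r)) x := by
    simpa using (((hid.pow 2).sub (hid.const_mul (a.a₂ * r))).sub_const 1).const_mul h
  have hden : HasDerivAt (fun x => 1 - h / 2 * (2 * x - a.a₂ * r)) (-(h / 2 * 2)) x := by
    simpa using (((hid.const_mul 2).sub_const (a.a₂ * r)).const_mul (h / 2)).const_sub 1
  refine (hid.add (hnum.div hden hd)).congr_deriv ?_
  rw [hx0]
  generalize 2 * x - a.a₂ * r = E at hd ⊢
  have hd' : 2 - h * E ≠ 0 := fun h0 => hd (by linear_combination h0 / 2)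
  field_simp
  ring

/-- The graph of a function over the box. -/
def graphSet (ρ δ κ ν : ℝ) (g : ℝ × ℝ × ℝ × ℝ → ℝ) : Set K1 :=
  {z | z.2 ∈ box ρ δ κ ν ∧ z.1 = g z.2}

/-- The image under the reversal of a function whose graph is to be reversed. -/
def reverseGraph (g : ℝ × ℝ × ℝ × ℝ → ℝ) (p : ℝ × ℝ × ℝ × ℝ) : ℝ :=
  -g (p.1, p.2.1, -p.2.2.1, p.2.2.2)

theorem flip_mem_box {ρ δ κ ν : ℝ} {p : ℝ × ℝ × ℝ × ℝ} (hp : p ∈ box ρ δ κ ν) :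
    (p.1, p.2.1, -p.2.2.1, p.2.2.2) ∈ box ρ δ κ ν :=
  ⟨hp.1, hp.2.1, ⟨neg_le_neg hp.2.2.1.2, neg_le.1 hp.2.2.1.1⟩, hp.2.2.2⟩

theorem reverse_mem_D1 {ρ δ κ ν : ℝ} {z : K1} (hz : z ∈ D1 ρ δ κ ν) : reverse z ∈ D1 ρ δ κ ν :=
  flip_mem_box hz

section

variable {a : Coeffs} {ρ δ κ ν : ℝ} {g : ℝ × ℝ × ℝ × ℝ → ℝ}

theorem IsAttractingGraph.isCenterStable (h : IsAttractingGraph a ρ δ κ ν g) (hδ : 0 ≤ δ)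
    (hκ : 0 ≤ κ) : IsCenterStable a ρ δ κ ν (graphSet ρ δ κ ν g) := by
  refine ⟨⟨⟨g, h.contDiffOn, rfl⟩, ?_, ?_, ?_⟩, ?_⟩
  · rintro ⟨x, p⟩ ⟨hp, hx⟩
    obtain rfl : x = g p := hx
    exact h.forward_regular p hp
  · rintro ⟨x, p⟩ ⟨hp, hx⟩ hm
    obtain rfl : x = g p := hx
    exact ⟨hm, h.forward p hp hm⟩
  · rintro k hk _ ⟨r, hr, rfl⟩
    have hp : (r, 0, 0, k) ∈ box ρ δ κ ν := ⟨hr, ⟨le_rfl, hδ⟩, ⟨by simpa using hκ, hκ⟩, hk⟩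
    exact ⟨hp, (h.fixed r k hp).symm⟩
  · intro r _ k hk
    have hD : 0 < √((a.a₂ * r) ^ 2 + 4) := Real.sqrt_pos.2 (by positivity)
    have hm : 0 < k / 2 * √((a.a₂ * r) ^ 2 + 4) := mul_pos (half_pos hk.1) hD
    refine ⟨_, ?_, hasDerivAt_mapK1_fixX a (by norm_num) ?_⟩
    · rw [abs_lt, div_lt_one (by linarith), lt_div_iff₀ (by linarith)]
      constructor <;> linarith
    · have : 0 < 1 - k / 2 * (-1 * √((a.a₂ * r) ^ 2 + 4)) := by linarith
      exact this.ne'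

/-- The reversal conjugates the forward map to the backward map of the system with negated
coefficients, so backward invariance and backward regularity of its attracting graph are what is
needed here. -/
theorem IsAttractingGraph.isCenterUnstable (h : IsAttractingGraph a.neg ρ δ κ ν g) (hδ : 0 ≤ δ)
    (hκ : 0 ≤ κ) : IsCenterUnstable a ρ δ κ ν (graphSet ρ δ κ ν (reverseGraph g)) := by
  have hrev : ∀ z ∈ graphSet ρ δ κ ν (reverseGraph g), (reverse z).2 ∈ box ρ δ κ ν ∧
      reverse z = (g (reverse z).2, (reverse z).2) := by
    rintro z ⟨hp, hz⟩
    refine ⟨flip_mem_box hp, Prod.ext ?_ rfl⟩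
    simp only [reverse, hz, reverseGraph, neg_neg]
  have hdef : ∀ z ∈ graphSet ρ δ κ ν (reverseGraph g), 0 < detK1 a z ∧ 0 < G a z := by
    intro z hz
    obtain ⟨h1, h2⟩ := hrev z hz
    have h3 := h.back_regular _ h1
    rw [← h2] at h3
    have h4 := kahanY_back a.neg h3.1.ne'
    have h5 := h3.1
    rw [backDet, kahanDet_neg] at h5
    rw [kahanY_neg] at h4
    simp only [reverse, neg_neg] at h4 h5
    exact ⟨h5, by rw [G, h4]; exact h3.2⟩
  have hfix : ∀ r ∈ Icc 0 ρ, ∀ k ∈ Icc 0 ν,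
      (fixX a 1 r, (r, 0, 0, k)) ∈ graphSet ρ δ κ ν (reverseGraph g) := by
    intro r hr k hk
    have hp : (r, 0, 0, k) ∈ box ρ δ κ ν := ⟨hr, ⟨le_rfl, hδ⟩, ⟨by simpa using hκ, hκ⟩, hk⟩
    refine ⟨hp, ?_⟩
    simp only [reverseGraph, neg_zero]
    rw [h.fixed r k hp, fixX_neg]
  refine ⟨⟨⟨reverseGraph g, ?_, rfl⟩, hdef, ?_, ?_⟩, ?_⟩
  · exact (h.contDiffOn.comp (f := fun p : ℝ × ℝ × ℝ × ℝ => (p.1, p.2.1, -p.2.2.1, p.2.2.2))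
      (by fun_prop) fun p hp => flip_mem_box hp).neg
  · intro z hz hm
    obtain ⟨h1, h2⟩ := hrev z hz
    have h3 : mapK1 a z = reverse (backK1 a.neg (reverse z)) := by
      rw [← mapK1_reverse, reverse_reverse]
    refine ⟨hm, ?_⟩
    rw [h3] at hm ⊢
    have h4 : backK1 a.neg (reverse z) ∈ D1 ρ δ κ ν := by
      simpa [reverse_reverse] using reverse_mem_D1 hm
    have h5 := h.back _ h1
    rw [← h2] at h5
    simp only [reverseGraph, reverse, neg_neg]
    exact congrArg Neg.neg (h5 h4)
  · rintro k hk _ ⟨r, hr, rfl⟩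
    exact hfix r hr k hk
  · intro r hr k hk
    have hD : 0 < √((a.a₂ * r) ^ 2 + 4) := Real.sqrt_pos.2 (by positivity)
    have hm : 0 < k / 2 * √((a.a₂ * r) ^ 2 + 4) := mul_pos (half_pos hk.1) hD
    -- The multiplier is `(1 + d) / (1 - d)` with `d > 0`. It exceeds `1` once `1 - d > 0`, and `1 -
    -- d` is the determinant at the fixed point, positive on the graph.
    have hdet : 0 < 1 - k / 2 * (1 * √((a.a₂ * r) ^ 2 + 4)) := by
      have h1 := (hdef _ (hfix r hr k ⟨hk.1.le, hk.2⟩)).1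
      have h2 : detK1 a (fixX a 1 r, (r, 0, 0, k)) =
          1 - k / 2 * (1 * √((a.a₂ * r) ^ 2 + 4)) := by
        simp only [detK1, kahanDet, jac₁₁, jac₁₂, jac₂₁, jac₂₂, fixX]
        ring
      rwa [h2] at h1
    refine ⟨_, ?_, hasDerivAt_mapK1_fixX a (by norm_num) hdet.ne'⟩
    refine lt_of_lt_of_le ?_ (le_abs_self _)
    rw [lt_div_iff₀ hdet]
    linarith

theorem IsAttractingGraph.gam1_mem (h : IsAttractingGraph a ρ δ κ ν g) {k : ℝ} (hk : 0 < k)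
    {n : ℤ} (hy : 0 < (gam k n).2) (hD : gam1 k n ∈ D1 ρ δ κ ν) (hn : n < 0) :
    gam1 k n ∈ graphSet ρ δ κ ν g := by
  refine ⟨hD, ?_⟩
  have h1 := abs_gam1_fst hy
  have h2 := gam1_eq k n
  change (gam1 k n).2 ∈ box ρ δ κ ν at hD
  have h3 : (gam1 k n).2 = (0, (gam1 k n).2.2.1, 0, (gam1 k n).2.2.2.2) := congrArg Prod.snd h2
  rw [h3] at hD
  rw [h3, h.special _ _ (gam1_step_pos hk hy) hD, h1, abs_of_neg (gam1_fst_neg hk hy hn), neg_neg]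

theorem IsAttractingGraph.gam1_mem_reverse (h : IsAttractingGraph a ρ δ κ ν g) {k : ℝ}
    (hk : 0 < k) {n : ℤ} (hy : 0 < (gam k n).2) (hD : gam1 k n ∈ D1 ρ δ κ ν) (hn : 0 < n) :
    gam1 k n ∈ graphSet ρ δ κ ν (reverseGraph g) := by
  refine ⟨hD, ?_⟩
  have h1 := abs_gam1_fst hy
  have h2 := gam1_eq k n
  change (gam1 k n).2 ∈ box ρ δ κ ν at hD
  have h3 : (gam1 k n).2 = (0, (gam1 k n).2.2.1, 0, (gam1 k n).2.2.2.2) := congrArg Prod.snd h2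
  rw [h3] at hD
  rw [h3, reverseGraph]
  simp only [neg_zero]
  rw [h.special _ _ (gam1_step_pos hk hy) hD, h1, abs_of_pos (gam1_fst_pos hk hy hn), neg_neg]

end

end KahanCanard

theorem mainTheorem6 (a : KahanCanard.Coeffs) :
    ∃ ρ δ κ ν : ℝ, 0 < ρ ∧ 0 < δ ∧ 0 < κ ∧ 0 < ν ∧ ν < 1 ∧
      ∃ Ma Mr : Set KahanCanard.K1,
        KahanCanard.IsCenterStable a ρ δ κ ν Ma ∧
        KahanCanard.IsCenterUnstable a ρ δ κ ν Mr ∧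
        (∀ h : ℝ, 0 < h → ∀ n : ℤ, 0 < (KahanCanard.gam h n).2 →
          KahanCanard.gam1 h n ∈ KahanCanard.D1 ρ δ κ ν →
            (n < 0 → KahanCanard.gam1 h n ∈ Ma) ∧ (0 < n → KahanCanard.gam1 h n ∈ Mr)) ∧
        (∀ h₁ ∈ Set.Icc 0 ν, ∀ U ∈ 𝓝 ((-1, (0, 0, 0, h₁)) : KahanCanard.K1),
          ∃ h₀ : ℝ, 0 < h₀ ∧ ∀ h : ℝ, 0 < h → h < h₀ → ∃ n : ℤ, n < 0 ∧
            0 < (KahanCanard.gam h n).2 ∧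
            KahanCanard.gam1 h n ∈ KahanCanard.D1 ρ δ κ ν ∩ U) ∧
        (∀ h₁ ∈ Set.Icc 0 ν, ∀ U ∈ 𝓝 ((1, (0, 0, 0, h₁)) : KahanCanard.K1),
          ∃ h₀ : ℝ, 0 < h₀ ∧ ∀ h : ℝ, 0 < h → h < h₀ → ∃ n : ℤ, 0 < n ∧
            0 < (KahanCanard.gam h n).2 ∧
            KahanCanard.gam1 h n ∈ KahanCanard.D1 ρ δ κ ν ∩ U) := by
  obtain ⟨ρ₁, δ₁, κ₁, ν₁, hρ₁, hδ₁, hκ₁, hν₁, hν₁', g₁, hg₁⟩ :=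
    KahanCanard.exists_isAttractingGraph a
  obtain ⟨ρ₂, δ₂, κ₂, ν₂, hρ₂, hδ₂, hκ₂, hν₂, -, g₂, hg₂⟩ :=
    KahanCanard.exists_isAttractingGraph a.neg
  have hρ : 0 < min ρ₁ ρ₂ := lt_min hρ₁ hρ₂
  have hδ : 0 < min δ₁ δ₂ := lt_min hδ₁ hδ₂
  have hκ : 0 < min κ₁ κ₂ := lt_min hκ₁ hκ₂
  have hν : 0 < min ν₁ ν₂ := lt_min hν₁ hν₂
  -- The systems with coefficients `a` and `a.neg` come with different boxes; all properties pass to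
  -- the common smaller box.
  have h₁ := hg₁.mono (min_le_left ρ₁ ρ₂) (min_le_left δ₁ δ₂) (min_le_left κ₁ κ₂)
    (min_le_left ν₁ ν₂)
  have h₂ := hg₂.mono (min_le_right ρ₁ ρ₂) (min_le_right δ₁ δ₂) (min_le_right κ₁ κ₂)
    (min_le_right ν₁ ν₂)
  refine ⟨_, _, _, _, hρ, hδ, hκ, hν, (min_le_left _ _).trans_lt hν₁', _, _,
    h₁.isCenterStable hδ.le hκ.le, h₂.isCenterUnstable hδ.le hκ.le,
    fun h hh n hy hD => ⟨h₁.gam1_mem hh hy hD, h₂.gam1_mem_reverse hh hy hD⟩,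
    fun k hk U hU => ?_, fun k hk U hU => ?_⟩
  · obtain ⟨h₀, hh₀, H⟩ := KahanCanard.exists_gam1_mem (σ := -1) (by norm_num) hρ hδ hκ hν hk
      (by simpa using hU)
    refine ⟨h₀, hh₀, fun h hh hlt => ?_⟩
    obtain ⟨n, hn, hn'⟩ := H h hh hlt
    exact ⟨n, by linarith, hn'⟩
  · obtain ⟨h₀, hh₀, H⟩ := KahanCanard.exists_gam1_mem (σ := 1) (by norm_num) hρ hδ hκ hν hk
      (by simpa using hU)
    refine ⟨h₀, hh₀, fun h hh hlt => ?_⟩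
    obtain ⟨n, hn, hn'⟩ := H h hh hlt
    exact ⟨n, by linarith, hn'⟩
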